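/- Let $\Bbbk$ be an algebraically closed field and let $A$ be a finite-dimensional Hopf algebra over $\Bbbk$ (with $\Delta(a)=\sum a_1\otimes a_2$, counit $\epsilon$, antipode $S$) that is basic (that is, $A/\mathrm{rad}(A)\cong \Bbbk^n$ as an algebra, for some $n$) and radically graded (that is, $A=\bigoplus_{n\ge 0}A_n$ is a graded Hopf algebra with $\mathrm{rad}(A)^i=\bigoplus_{n\geq i}A_n$ for all $i\ge 0$). Let $G$ be the finite group of algebra homomorphisms $A\to\Bbbk$ under convolution. It acts on $A$ by the algebra automorphisms $g(a)=\sum a_1\,g(a_2)$. Assume that $\mathrm{char}(\Bbbk)$ does not divide $|G|$. All modules and bimodules are finite-dimensional; bicategories with one object are regarded as monoidal categories and pseudofunctors between them as strong monoidal functors. * $\mathrm{Rep}_A$ is the one-object bicategory of left $A$-modules under $\otimes_\Bbbk$, whose identity $1$-morphism is the trivial module $L_1$; $H_A$ is its full subcategory on the additive closure of $A\oplus L_1$. * $B_A$ is the one-object bicategory of $A$-$A$-bimodules under $\otimes_A$. * $\Gamma\colon \mathrm{Rep}_A\to B_A$ is the pseudofunctor $M\mapsto (A\otimes A^{op})\otimes_A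 M$, where $A$ acts on the right of $A\otimes A^{op}$ by multiplication with $\sum a_1\otimes S(a_2)$, and the bimodule structure is $a\cdot(x\otimes y)\cdot b=ax\otimes yb$; its structure isomorphisms are $\Gamma(M\otimes_\Bbbk N)\to\Gamma(M)\otimes_A\Gamma(N)$, $(a\otimes b)\otimes(m\otimes n)\mapsto ((a\otimes 1)\otimes m)\otimes((1\otimes b)\otimes n)$ and $\Gamma(L_1)\to A$, $(a\otimes b)\otimes c\mapsto c\,ab$. * For a bimodule $M$ and $g\in G$, let $M^g$ be $M$ with the actions $a\cdot m\cdot b=g(a)\,m\,g(b)$. Let $\mathcal X_A$ be the category of bimodules with $\mathrm{Hom}_{\mathcal X_A}(M,N)=\bigoplus_{g\in G}\mathrm{Hom}_{A\text{-}A}(M,N^g)$ and composition $(\psi\varphi)_s=\sum_g(\psi_{sg^{-1}})^g\varphi_g$. Then $X_A$ is the one-object bicategory given by the idempotent completion of $\mathcal X_A$, with horizontal composition induced by $M\otimes^G N=\bigoplus_{g}(M^g\otimes_A N)$ and with identity $1$-morphism $(A,\pi_1)$, $\pi_1=\frac1{|G|}(g)_{g\in G}$; $G_A$ is its full subcategory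 on the additive closure of $(A,\pi_1)\oplus(A\otimes_\Bbbk A,\mathrm{id})$. * $\Theta\colon X_A\to B_A$ is the faithful pseudofunctor that sends $(M,e)$ to the image of $\Theta(e)$ on $\Theta(M)=\bigoplus_{g\in G}M^g$, where $\Theta(f)=(f^g_{hg^{-1}})_{h,g}$ for a morphism $f$ of $\mathcal X_A$. Then, identifying $\mathrm{Rep}_A$ and $X_A$ with their essential images in $B_A$ under $\Gamma$ and $\Theta$, $\mathrm{Rep}_A$ is a subbicategory of $X_A$, and $H_A$ corresponds to a $1$-full subbicategory of $G_A$. Explicitly, there are a faithful pseudofunctor $\Lambda\colon\mathrm{Rep}_A\to X_A$ and a monoidal natural isomorphism $\Gamma\cong\Theta\circ\Lambda$ such that: 1. $\Lambda(M)\cong\Lambda(N)$ implies $M\cong N$; in particular, the essential image of $\Gamma$ is contained in that of $\Theta$; 2. $H_A$ and $G_A$ contain the identity $1$-morphisms and are closed under horizontal composition, $\Lambda$ maps the $1$-morphisms of $H_A$ to $1$-morphisms of $G_A$, and every $1$-morphism of $G_A$ is isomorphic in $X_A$ to $\Lambda(M)$ for some $1$-morphism $M$ of $H_A$; in particular, a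 bimodule is isomorphic to $\Gamma(M)$ for some $1$-morphism $M$ of $H_A$ if and only if it is isomorphic to $\Theta(X)$ for some $1$-morphism $X$ of $G_A$. -/

import Mathlib

open CategoryTheory MonoidalCategory TensorProduct MulOpposite

set_option linter.unusedVariables false
set_option linter.unusedSectionVars false
set_option linter.unusedSimpArgs false

universe u

noncomputable section

namespace HopfBimod

section

section Balanced

variable {k : Type u} [Field k] {A : Type u} [Ring A] [Algebra k A]
  {V W V' W' P : Type u} [AddCommGroup V] [Module k V] [AddCommGroup W] [Module k W]
  [AddCommGroup V'] [Module k V'] [AddCommGroup W'] [Module k W']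
  [AddCommGroup P] [Module k P]

/-- The relations `v · a ⊗ w = v ⊗ a · w` defining the tensor product over `A` of a right
`A`-module `V` and a left `A`-module `W`. -/
def balRel (r : Aᵐᵒᵖ →ₐ[k] Module.End k V) (l : A →ₐ[k] Module.End k W) :
    Submodule k (V ⊗[k] W) :=
  Submodule.span k {t | ∃ (a : A) (v : V) (w : W), t = r (op a) v ⊗ₜ[k] w - v ⊗ₜ[k] l a w}

/-- The tensor product `V ⊗_A W` of a right `A`-module `V` (with action `r`) and a left
`A`-module `W` (with action `l`), over a not necessarily commutative `k`-algebra `A`. -/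
def BT (r : Aᵐᵒᵖ →ₐ[k] Module.End k V) (l : A →ₐ[k] Module.End k W) : Type u :=
  (V ⊗[k] W) ⧸ balRel r l

namespace BT

instance (r : Aᵐᵒᵖ →ₐ[k] Module.End k V) (l : A →ₐ[k] Module.End k W) :
    AddCommGroup (BT r l) := inferInstanceAs (AddCommGroup ((V ⊗[k] W) ⧸ balRel r l))

instance (r : Aᵐᵒᵖ →ₐ[k] Module.End k V) (l : A →ₐ[k] Module.End k W) :
    Module k (BT r l) := inferInstanceAs (Module k ((V ⊗[k] W) ⧸ balRel r l))

instance [Module.Finite k V] [Module.Finite k W]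
    (r : Aᵐᵒᵖ →ₐ[k] Module.End k V) (l : A →ₐ[k] Module.End k W) :
    Module.Finite k (BT r l) := inferInstanceAs (Module.Finite k ((V ⊗[k] W) ⧸ balRel r l))

variable (r : Aᵐᵒᵖ →ₐ[k] Module.End k V) (l : A →ₐ[k] Module.End k W)
  (r' : Aᵐᵒᵖ →ₐ[k] Module.End k V') (l' : A →ₐ[k] Module.End k W')

/-- The universal balanced bilinear map `(v, w) ↦ v ⊗ w`. -/
def mk : V →ₗ[k] W →ₗ[k] BT r l :=
  (TensorProduct.mk k V W).compr₂ (Submodule.mkQ (balRel r l))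

theorem mk_smul (a : A) (v : V) (w : W) : mk r l (r (op a) v) w = mk r l v (l a w) :=
  (Submodule.Quotient.eq _).2 (Submodule.subset_span ⟨a, v, w, rfl⟩)

variable {r l}

/-- The universal property of `V ⊗_A W`. -/
def lift (f : V →ₗ[k] W →ₗ[k] P) (h : ∀ a v w, f (r (op a) v) w = f v (l a w)) :
    BT r l →ₗ[k] P :=
  Submodule.liftQ _ (TensorProduct.lift f) (Submodule.span_le.2 (by
    rintro _ ⟨a, v, w, rfl⟩
    simp [h]))

@[simp] theorem lift_mk (f : V →ₗ[k] W →ₗ[k] P) (h : ∀ a v w, f (r (op a) v) w = f v (l a w))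
    (v : V) (w : W) : lift f h (mk r l v w) = f v w := rfl

theorem ext_curry {f g : BT r l →ₗ[k] P} (h : (mk r l).compr₂ f = (mk r l).compr₂ g) : f = g := by
  apply Submodule.linearMap_qext
  apply TensorProduct.ext
  exact h

theorem ext {f g : BT r l →ₗ[k] P} (h : ∀ v w, f (mk r l v w) = g (mk r l v w)) : f = g :=
  ext_curry (LinearMap.ext fun v => LinearMap.ext fun w => h v w)

@[elab_as_elim]
theorem induction {p : BT r l → Prop} (z : BT r l) (mk : ∀ v w, p (mk r l v w))
    (add : ∀ x y, p x → p y → p (x + y)) : p z := by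
  obtain ⟨t, rfl⟩ := Submodule.mkQ_surjective (balRel r l) z
  induction t using TensorProduct.induction_on with
  | zero =>
    have h := mk 0 0
    rwa [map_zero] at h
  | tmul v w => exact mk v w
  | add x y hx hy =>
    rw [map_add]
    exact add _ _ hx hy

/-- Functoriality of the tensor product over `A`. -/
def map (f : V →ₗ[k] V') (g : W →ₗ[k] W') (hf : ∀ a v, f (r (op a) v) = r' (op a) (f v))
    (hg : ∀ a w, g (l a w) = l' a (g w)) : BT r l →ₗ[k] BT r' l' :=
  lift ((mk r' l').compl₁₂ f g) (fun a v w => by simp [hf, hg, mk_smul])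

@[simp] theorem map_mk (f : V →ₗ[k] V') (g : W →ₗ[k] W')
    (hf : ∀ a v, f (r (op a) v) = r' (op a) (f v))
    (hg : ∀ a w, g (l a w) = l' a (g w)) (v : V) (w : W) :
    map r' l' f g hf hg (mk r l v w) = mk r' l' (f v) (g w) := rfl

variable (r l) {C : Type u} [Ring C] [Algebra k C]

/-- An action on `V` that commutes with the right `A`-action induces an action on `V ⊗_A W`. -/
def actLeft (c : C →ₐ[k] Module.End k V)
    (hc : ∀ x a v, c x (r (op a) v) = r (op a) (c x v)) : C →ₐ[k] Module.End k (BT r l) :=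
  AlgHom.ofLinearMap
    { toFun := fun x => map r l (c x) LinearMap.id (hc x) (fun _ _ => rfl)
      map_add' := fun x y => ext fun v w => by simp
      map_smul' := fun x y => ext fun v w => by simp }
    (ext fun v w => by simp) (fun x y => ext fun v w => by simp)

@[simp] theorem actLeft_mk (c : C →ₐ[k] Module.End k V)
    (hc : ∀ x a v, c x (r (op a) v) = r (op a) (c x v)) (x : C) (v : V) (w : W) :
    actLeft r l c hc x (mk r l v w) = mk r l (c x v) w := rfl

/-- An action on `W` that commutes with the left `A`-action induces an action on `V ⊗_A W`. -/
def actRight (c : C →ₐ[k] Module.End k W)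
    (hc : ∀ x a w, c x (l a w) = l a (c x w)) : C →ₐ[k] Module.End k (BT r l) :=
  AlgHom.ofLinearMap
    { toFun := fun x => map r l LinearMap.id (c x) (fun _ _ => rfl) (hc x)
      map_add' := fun x y => ext fun v w => by simp
      map_smul' := fun x y => ext fun v w => by simp }
    (ext fun v w => by simp) (fun x y => ext fun v w => by simp)

@[simp] theorem actRight_mk (c : C →ₐ[k] Module.End k W)
    (hc : ∀ x a w, c x (l a w) = l a (c x w)) (x : C) (v : V) (w : W) :
    actRight r l c hc x (mk r l v w) = mk r l v (c x w) := rfl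

end BT

end Balanced

/-! ### The bicategory of bimodules -/

variable (k A : Type u) [Field k] [Ring A] [Algebra k A]

/-- A finite-dimensional `A`-`A`-bimodule over `k`, i.e. a `1`-morphism of `B_A`:
`l a m = a · m` and `r (op b) m = m · b`. -/
structure Bim where
  carrier : Type u
  [addCommGroup : AddCommGroup carrier]
  [module : Module k carrier]
  [finite : Module.Finite k carrier]
  l : A →ₐ[k] Module.End k carrier
  r : Aᵐᵒᵖ →ₐ[k] Module.End k carrier
  l_r : ∀ a b m, l a (r b m) = r b (l a m)

attribute [instance] Bim.addCommGroup Bim.module Bim.finite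

namespace Bim

variable {k A}

/-- Homomorphisms of bimodules: the `2`-morphisms of `B_A`. -/
@[ext]
structure Hom (M N : Bim k A) where
  lin : M.carrier →ₗ[k] N.carrier
  map_l : ∀ a m, lin (M.l a m) = N.l a (lin m)
  map_r : ∀ b m, lin (M.r b m) = N.r b (lin m)

attribute [simp] Hom.map_l Hom.map_r

instance : Category (Bim k A) where
  Hom := Hom
  id M := ⟨LinearMap.id, fun _ _ => rfl, fun _ _ => rfl⟩
  comp f g := ⟨g.lin ∘ₗ f.lin, fun _ _ => by simp, fun _ _ => by simp⟩

@[ext] theorem hom_ext {M N : Bim k A} {f g : M ⟶ N} (h : f.lin = g.lin) : f = g := Hom.ext h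

@[simp] theorem id_lin (M : Bim k A) : Hom.lin (𝟙 M) = LinearMap.id := rfl

@[simp] theorem comp_lin {M N K : Bim k A} (f : M ⟶ N) (g : N ⟶ K) :
    (f ≫ g).lin = g.lin ∘ₗ f.lin := rfl

@[simp] theorem hom_l {M N : Bim k A} (f : M ⟶ N) (a : A) (m : M.carrier) :
    f.lin (M.l a m) = N.l a (f.lin m) := f.map_l a m

@[simp] theorem hom_r {M N : Bim k A} (f : M ⟶ N) (b : Aᵐᵒᵖ) (m : M.carrier) :
    f.lin (M.r b m) = N.r b (f.lin m) := f.map_r b m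

/-- The horizontal composition `M ⊗_A N`. -/
def tensor (M N : Bim k A) : Bim k A where
  carrier := BT M.r N.l
  l := BT.actLeft M.r N.l M.l (fun a b m => M.l_r a (op b) m)
  r := BT.actRight M.r N.l N.r (fun b a n => (N.l_r a b n).symm)
  l_r a b m := by
    induction m using BT.induction with
    | mk v w => rfl
    | add x y hx hy => simp only [map_add, hx, hy]

/-- The pure tensors of `M ⊗_A N`. -/
def tmk (M N : Bim k A) : M.carrier →ₗ[k] N.carrier →ₗ[k] (M.tensor N).carrier := BT.mk M.r N.l

theorem tmk_bal {M N : Bim k A} (a : A) (m : M.carrier) (n : N.carrier) :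
    tmk M N (M.r (op a) m) n = tmk M N m (N.l a n) := BT.mk_smul M.r N.l a m n

@[simp] theorem tensor_l {M N : Bim k A} (a : A) (m : M.carrier) (n : N.carrier) :
    (M.tensor N).l a (tmk M N m n) = tmk M N (M.l a m) n := rfl

@[simp] theorem tensor_r {M N : Bim k A} (b : Aᵐᵒᵖ) (m : M.carrier) (n : N.carrier) :
    (M.tensor N).r b (tmk M N m n) = tmk M N m (N.r b n) := rfl

section

variable {P : Type u} [AddCommGroup P] [Module k P]

/-- The universal property of `M ⊗_A N`. -/
def tlift {M N : Bim k A} (f : M.carrier →ₗ[k] N.carrier →ₗ[k] P)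
    (h : ∀ a m n, f (M.r (op a) m) n = f m (N.l a n)) : (M.tensor N).carrier →ₗ[k] P :=
  BT.lift f h

@[simp] theorem tlift_tmk {M N : Bim k A} (f : M.carrier →ₗ[k] N.carrier →ₗ[k] P)
    (h : ∀ a m n, f (M.r (op a) m) n = f m (N.l a n)) (m : M.carrier) (n : N.carrier) :
    tlift f h (tmk M N m n) = f m n := rfl

@[elab_as_elim]
theorem t_ind {M N : Bim k A} {p : (M.tensor N).carrier → Prop} (z : (M.tensor N).carrier)
    (mk : ∀ m n, p (tmk M N m n)) (add : ∀ x y, p x → p y → p (x + y)) : p z :=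
  BT.induction z mk add

theorem t_ext {M N : Bim k A} {f g : (M.tensor N).carrier →ₗ[k] P}
    (h : ∀ m n, f (tmk M N m n) = g (tmk M N m n)) : f = g := BT.ext h

theorem t_ext_curry {M N : Bim k A} {f g : (M.tensor N).carrier →ₗ[k] P}
    (h : (tmk M N).compr₂ f = (tmk M N).compr₂ g) : f = g := BT.ext_curry h

theorem t_ext_left {M N K : Bim k A} {f g : ((M.tensor N).tensor K).carrier →ₗ[k] P}
    (h : ∀ m n x, f (tmk _ _ (tmk _ _ m n) x) = g (tmk _ _ (tmk _ _ m n) x)) : f = g :=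
  t_ext_curry (t_ext fun m n => LinearMap.ext fun x => h m n x)

theorem t_ext_right {M N K : Bim k A} {f g : (M.tensor (N.tensor K)).carrier →ₗ[k] P}
    (h : ∀ m n x, f (tmk _ _ m (tmk _ _ n x)) = g (tmk _ _ m (tmk _ _ n x))) : f = g :=
  t_ext_curry (LinearMap.ext fun m => t_ext fun n x => h m n x)

theorem t_ext_four {M N K L : Bim k A}
    {f g : (((M.tensor N).tensor K).tensor L).carrier →ₗ[k] P}
    (h : ∀ m n x y, f (tmk _ _ (tmk _ _ (tmk _ _ m n) x) y) =
      g (tmk _ _ (tmk _ _ (tmk _ _ m n) x) y)) : f = g :=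
  t_ext_curry (t_ext_left fun m n x => LinearMap.ext fun y => h m n x y)

end

/-- To see that a linear map from `M ⊗_A N` is a bimodule map, pure tensors suffice. -/
def homOfPure {M N K : Bim k A} (f : (M.tensor N).carrier →ₗ[k] K.carrier)
    (hl : ∀ a m n, f (tmk M N (M.l a m) n) = K.l a (f (tmk M N m n)))
    (hr : ∀ b m n, f (tmk M N m (N.r b n)) = K.r b (f (tmk M N m n))) : M.tensor N ⟶ K where
  lin := f
  map_l a := LinearMap.congr_fun (f := f ∘ₗ _) (g := K.l a ∘ₗ f) (t_ext fun m n => hl a m n)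
  map_r b := LinearMap.congr_fun (f := f ∘ₗ _) (g := K.r b ∘ₗ f) (t_ext fun m n => hr b m n)

/-- The tensor product of two bimodule homomorphisms. -/
def tensorMap {M N M' N' : Bim k A} (f : M ⟶ M') (g : N ⟶ N') : M.tensor N ⟶ M'.tensor N' :=
  homOfPure (tlift ((tmk M' N').compl₁₂ f.lin g.lin) (fun a m n => by simp [tmk_bal]))
    (fun a m n => by simp) (fun b m n => by simp)

@[simp] theorem tensorMap_tmk {M N M' N' : Bim k A} (f : M ⟶ M') (g : N ⟶ N')
    (m : M.carrier) (n : N.carrier) :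
    (tensorMap f g).lin (tmk M N m n) = tmk M' N' (f.lin m) (g.lin n) := rfl

/-- The associator `(M ⊗ N) ⊗ K → M ⊗ (N ⊗ K)`, `(m ⊗ n) ⊗ x ↦ m ⊗ (n ⊗ x)`. -/
def assocHom (M N K : Bim k A) : (M.tensor N).tensor K ⟶ M.tensor (N.tensor K) :=
  homOfPure
    (tlift
      (tlift
        (LinearMap.mk₂ k (fun m n => tmk M (N.tensor K) m ∘ₗ tmk N K n)
          (fun _ _ _ => by ext; simp) (fun _ _ _ => by ext; simp)
          (fun _ _ _ => by ext; simp) (fun _ _ _ => by ext; simp))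
        (fun a m n => by ext x; simp [tmk_bal]))
      (fun a z x => by
        induction z using t_ind with
        | mk m n => simp [tmk_bal]
        | add y z hy hz => simp only [map_add, LinearMap.add_apply, hy, hz]))
    (fun a z x => by
      induction z using t_ind with
      | mk m n => simp
      | add y z hy hz => simp only [map_add, LinearMap.add_apply, hy, hz])
    (fun b z x => by
      induction z using t_ind with
      | mk m n => simp
      | add y z hy hz => simp only [map_add, LinearMap.add_apply, hy, hz])

@[simp] theorem assocHom_tmk (M N K : Bim k A) (m : M.carrier) (n : N.carrier) (x : K.carrier) :
    (assocHom M N K).lin (tmk _ _ (tmk _ _ m n) x) = tmk _ _ m (tmk _ _ n x) := rfl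

/-- The inverse of the associator. -/
def assocInv (M N K : Bim k A) : M.tensor (N.tensor K) ⟶ (M.tensor N).tensor K :=
  homOfPure
    (tlift
      (LinearMap.flip (tlift
        (LinearMap.mk₂ k (fun n x => (tmk (M.tensor N) K).flip x ∘ₗ (tmk M N).flip n)
          (fun _ _ _ => by ext; simp) (fun _ _ _ => by ext; simp)
          (fun _ _ _ => by ext; simp) (fun _ _ _ => by ext; simp))
        (fun a n x => by
          ext m
          simp only [LinearMap.mk₂_apply, LinearMap.comp_apply, LinearMap.flip_apply]
          rw [← tensor_r, tmk_bal])))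
      (fun a m z => by
        induction z using t_ind with
        | mk n x => simp [tmk_bal]
        | add y z hy hz => simp only [map_add, hy, hz]))
    (fun a m z => by
      induction z using t_ind with
      | mk n x => simp
      | add y z hy hz => simp only [map_add, hy, hz])
    (fun b m z => by
      induction z using t_ind with
      | mk n x => simp
      | add y z hy hz => simp only [map_add, hy, hz])

@[simp] theorem assocInv_tmk (M N K : Bim k A) (m : M.carrier) (n : N.carrier) (x : K.carrier) :
    (assocInv M N K).lin (tmk _ _ m (tmk _ _ n x)) = tmk _ _ (tmk _ _ m n) x := rfl

variable (k A) [Module.Finite k A]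

/-- The regular bimodule `A`, which is the identity `1`-morphism of `B_A`. -/
def reg : Bim k A where
  carrier := A
  l := Algebra.lmul k A
  r := AlgHom.ofLinearMap
    { toFun := fun b => LinearMap.mulRight k b.unop
      map_add' := fun _ _ => by ext; simp [mul_add]
      map_smul' := fun _ _ => by ext; simp }
    (by ext; simp) (fun _ _ => by ext; simp [mul_assoc])
  l_r a b m := (mul_assoc a m b.unop).symm

variable {k A}

/-- The left unitor `A ⊗_A M ≅ M`, `a ⊗ m ↦ a · m`. -/
def leftU (M : Bim k A) : (reg k A).tensor M ≅ M where
  hom := homOfPure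
    (tlift M.l.toLinearMap (fun a (b : A) m => LinearMap.congr_fun (map_mul M.l b a) m))
    (fun a (b : A) m => LinearMap.congr_fun (map_mul M.l a b) m)
    (fun b (a : A) m => M.l_r a b m)
  inv :=
    { lin := tmk (reg k A) M (1 : A)
      map_l := fun a m => (tmk_bal (M := reg k A) a (1 : A) m).symm.trans
        (congrArg (fun x : A => tmk (reg k A) M x m) ((one_mul a).trans (mul_one a).symm))
      map_r := fun b m => rfl }
  hom_inv_id := hom_ext (t_ext fun (a : A) m => (tmk_bal (M := reg k A) a (1 : A) m).symm.trans
    (congrArg (fun x : A => tmk (reg k A) M x m) (one_mul a)))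
  inv_hom_id := hom_ext (LinearMap.ext fun m => LinearMap.congr_fun (map_one M.l) m)

@[simp] theorem leftU_tmk (M : Bim k A) (a : (reg k A).carrier) (m : M.carrier) :
    (leftU M).hom.lin (tmk (reg k A) M a m) = M.l (a : A) m := rfl

@[simp] theorem leftU_inv (M : Bim k A) (m : M.carrier) :
    (leftU M).inv.lin m = tmk (reg k A) M (1 : A) m := rfl

/-- The right unitor `M ⊗_A A ≅ M`, `m ⊗ a ↦ m · a`. -/
def rightU (M : Bim k A) : M.tensor (reg k A) ≅ M where
  hom := homOfPure (tlift (M.r.toLinearMap ∘ₗ (opLinearEquiv k).toLinearMap).flip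
      (fun a m (b : A) => (LinearMap.congr_fun (map_mul M.r (op b) (op a)) m).symm))
    (fun a m (b : A) => (M.l_r a (op b) m).symm)
    (fun b m (a : A) => LinearMap.congr_fun (map_mul M.r b (op a)) m)
  inv :=
    { lin := (tmk M (reg k A)).flip (1 : A)
      map_l := fun a m => rfl
      map_r := fun b m => (tmk_bal (N := reg k A) b.unop m (1 : A)).trans
        (congrArg (fun x : A => tmk M (reg k A) m x)
          ((mul_one b.unop).trans (one_mul b.unop).symm)) }
  hom_inv_id := hom_ext (t_ext fun m (a : A) => (tmk_bal (N := reg k A) a m (1 : A)).trans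
    (congrArg (fun x : A => tmk M (reg k A) m x) (mul_one a)))
  inv_hom_id := hom_ext (LinearMap.ext fun m => LinearMap.congr_fun (map_one M.r) m)

@[simp] theorem rightU_tmk (M : Bim k A) (m : M.carrier) (a : (reg k A).carrier) :
    (rightU M).hom.lin (tmk M (reg k A) m a) = M.r (op (a : A)) m := rfl

@[simp] theorem rightU_inv (M : Bim k A) (m : M.carrier) :
    (rightU M).inv.lin m = tmk M (reg k A) m (1 : A) := rfl

/-- The bicategory `B_A` has one object, so it is the monoidal category of `A`-`A`-bimodules
under `⊗_A`. -/
instance : MonoidalCategoryStruct (Bim k A) where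
  tensorObj := tensor
  whiskerLeft M _ _ f := tensorMap (𝟙 M) f
  whiskerRight f N := tensorMap f (𝟙 N)
  tensorHom := tensorMap
  tensorUnit := reg k A
  associator M N K :=
    { hom := assocHom M N K
      inv := assocInv M N K
      hom_inv_id := hom_ext (t_ext_left fun _ _ _ => by simp)
      inv_hom_id := hom_ext (t_ext_right fun _ _ _ => by simp) }
  leftUnitor := leftU
  rightUnitor := rightU

instance : MonoidalCategory (Bim k A) where
  tensorHom_def f g := hom_ext (t_ext fun _ _ => rfl)
  id_tensorHom_id M N := hom_ext (t_ext fun _ _ => rfl)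
  tensorHom_comp_tensorHom f g h i := hom_ext (t_ext fun _ _ => rfl)
  whiskerLeft_id M N := hom_ext (t_ext fun _ _ => rfl)
  id_whiskerRight M N := hom_ext (t_ext fun _ _ => rfl)
  associator_naturality f g h := hom_ext (t_ext_left fun _ _ _ => rfl)
  leftUnitor_naturality f := hom_ext (t_ext fun a m => (f.map_l a m).symm)
  rightUnitor_naturality f := hom_ext (t_ext fun m a => (f.map_r (op a) m).symm)
  pentagon M N K L := hom_ext (t_ext_four fun _ _ _ _ => rfl)
  triangle M N := hom_ext (t_ext_left fun m (a : A) n => (tmk_bal a m n).symm)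

end Bim

end

namespace Bim

variable {k A : Type u} [Field k] [Ring A] [Algebra k A]

/-- A bimodule homomorphism with a linear inverse is an isomorphism. -/
def isoOfInv {M N : Bim k A} (f : M ⟶ N) (g : N.carrier →ₗ[k] M.carrier)
    (h₁ : ∀ m, g (f.lin m) = m) (h₂ : ∀ n, f.lin (g n) = n) : M ≅ N where
  hom := f
  inv :=
    { lin := g
      map_l := fun a n => by rw [← h₁ (M.l a (g n)), hom_l, h₂]
      map_r := fun b n => by rw [← h₁ (M.r b (g n)), hom_r, h₂] }
  hom_inv_id := hom_ext (LinearMap.ext h₁)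
  inv_hom_id := hom_ext (LinearMap.ext h₂)

@[simp] theorem isoOfInv_hom {M N : Bim k A} (f : M ⟶ N) (g : N.carrier →ₗ[k] M.carrier)
    (h₁ : ∀ m, g (f.lin m) = m) (h₂ : ∀ n, f.lin (g n) = n) :
    (isoOfInv f g h₁ h₂).hom = f := rfl

@[simp] theorem isoOfInv_inv {M N : Bim k A} (f : M ⟶ N) (g : N.carrier →ₗ[k] M.carrier)
    (h₁ : ∀ m, g (f.lin m) = m) (h₂ : ∀ n, f.lin (g n) = n) :
    (isoOfInv f g h₁ h₂).inv.lin = g := rfl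

variable [Module.Finite k A]

@[simp] theorem tensorHom_lin {M N M' N' : Bim k A} (f : M ⟶ M') (g : N ⟶ N')
    (m : M.carrier) (n : N.carrier) :
    Hom.lin (f ⊗ₘ g) (tmk M N m n) = tmk M' N' (f.lin m) (g.lin n) := rfl

end Bim

/-! ### The skew category -/

variable {k A : Type u} [Field k] [Ring A] [Algebra k A]
  {G : Type u} [Group G] [Fintype G] [DecidableEq G] (σ : G →* (A ≃ₐ[k] A))

open Bim

/-- The bimodule `⨁_{g ∈ G} M^g`, where `M^g` is `M` with the actions
`a · m · b := g(a) m g(b)`. -/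
def bigTwist (M : Bim k A) : Bim k A where
  carrier := G → M.carrier
  l := AlgHom.ofLinearMap
    { toFun := fun a => LinearMap.pi fun g => M.l (σ g a) ∘ₗ LinearMap.proj g
      map_add' := fun _ _ => by ext; simp
      map_smul' := fun _ _ => by ext; simp }
    (by ext; simp) (fun _ _ => by ext; simp)
  r := AlgHom.ofLinearMap
    { toFun := fun b => LinearMap.pi fun g => M.r (op (σ g b.unop)) ∘ₗ LinearMap.proj g
      map_add' := fun _ _ => by ext; simp
      map_smul' := fun _ _ => by ext; simp }
    (by ext; simp) (fun _ _ => by ext; simp)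
  l_r a b x := funext fun g => M.l_r _ _ _

variable {σ}

/-- The projection `⨁_g M^g → M^h`. -/
def btProj (M : Bim k A) (h : G) : (bigTwist σ M).carrier →ₗ[k] M.carrier :=
  LinearMap.proj (R := k) (φ := fun _ : G => M.carrier) h

@[simp] theorem bigTwist_l {M : Bim k A} (a : A) (x : (bigTwist σ M).carrier) (g : G) :
    btProj M g ((bigTwist σ M).l a x) = M.l (σ g a) (btProj M g x) := rfl

@[simp] theorem bigTwist_r {M : Bim k A} (b : Aᵐᵒᵖ) (x : (bigTwist σ M).carrier) (g : G) :
    btProj M g ((bigTwist σ M).r b x) = M.r (op (σ g b.unop)) (btProj M g x) := rfl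

@[ext] theorem bigTwist_ext {M : Bim k A} {x y : (bigTwist σ M).carrier}
    (h : ∀ g, btProj M g x = btProj M g y) : x = y := funext h

/-- The element of `⨁_g M^g` with given components. -/
def btOf {M : Bim k A} (f : G → M.carrier) : (bigTwist σ M).carrier := f

@[simp] theorem btProj_btOf {M : Bim k A} (f : G → M.carrier) (g : G) :
    btProj M g (btOf f : (bigTwist σ M).carrier) = f g := rfl

/-- The inclusion `M^h → ⨁_g M^g`. -/
def btSingle (M : Bim k A) (h : G) : M.carrier →ₗ[k] (bigTwist σ M).carrier :=
  LinearMap.single k (fun _ : G => M.carrier) h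

@[simp] theorem btSingle_same {M : Bim k A} (h : G) (m : M.carrier) :
    btProj M h (btSingle M h m : (bigTwist σ M).carrier) = m :=
  Pi.single_eq_same (M := fun _ : G => M.carrier) h m

theorem btSingle_ne {M : Bim k A} {h g : G} (hg : g ≠ h) (m : M.carrier) :
    btProj M g (btSingle M h m : (bigTwist σ M).carrier) = 0 :=
  Pi.single_eq_of_ne (M := fun _ : G => M.carrier) hg m

theorem sum_btSingle {M : Bim k A} (x : (bigTwist σ M).carrier) :
    ∑ h, btSingle M h (btProj M h x) = x := by
  ext g
  rw [map_sum, Finset.sum_eq_single g]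
  · simp
  · intro b _ hb
    exact btSingle_ne hb.symm _
  · simp

theorem btSingle_l {M : Bim k A} (h : G) (a : A) (m : M.carrier) :
    (bigTwist σ M).l a (btSingle M h m) = btSingle M h (M.l (σ h a) m) := by
  ext g
  by_cases hg : g = h
  · subst hg; simp
  · simp [btSingle_ne hg]

theorem btSingle_r {M : Bim k A} (h : G) (a : A) (m : M.carrier) :
    (bigTwist σ M).r (op a) (btSingle M h m) = btSingle M h (M.r (op (σ h a)) m) := by
  ext g
  by_cases hg : g = h
  · subst hg; simp
  · simp [btSingle_ne hg]

/-- The relabelling `⨁_g M^g → (⨁_g M^g)^h` sending the component in `M^{gh}` to `(M^g)^h`. -/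
def shift (M : Bim k A) (h : G) : (bigTwist σ M).carrier →ₗ[k] (bigTwist σ M).carrier :=
  LinearMap.funLeft k M.carrier (fun g => g * h)

@[simp] theorem shift_apply {M : Bim k A} (h : G) (x : (bigTwist σ M).carrier) (g : G) :
    btProj M g (shift M h x) = btProj M (g * h) x := rfl

@[simp] theorem shift_shift {M : Bim k A} (h h' : G) (x : (bigTwist σ M).carrier) :
    shift M h' (shift M h x) = shift M (h' * h) x := by ext; simp [mul_assoc]

@[simp] theorem shift_one {M : Bim k A} (x : (bigTwist σ M).carrier) : shift M 1 x = x := by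
  ext; simp

theorem shift_single {M : Bim k A} (s h : G) (m : M.carrier) :
    shift M s (btSingle M h m : (bigTwist σ M).carrier) = btSingle M (h * s⁻¹) m := by
  ext g
  rw [shift_apply]
  by_cases hg : g = h * s⁻¹
  · subst hg
    rw [btSingle_same, inv_mul_cancel_right, btSingle_same]
  · rw [btSingle_ne hg, btSingle_ne fun h' => hg (by rw [← h', mul_inv_cancel_right])]

@[simp] theorem shift_l {M : Bim k A} (h : G) (a : A) (x : (bigTwist σ M).carrier) :
    shift M h ((bigTwist σ M).l a x) = (bigTwist σ M).l (σ h a) (shift M h x) := by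
  ext; simp

@[simp] theorem shift_r {M : Bim k A} (h : G) (a : A) (x : (bigTwist σ M).carrier) :
    shift M h ((bigTwist σ M).r (op a) x) = (bigTwist σ M).r (op (σ h a)) (shift M h x) := by
  ext; simp

/-- The objects of the skew category `𝒳_A`: those of the category of bimodules. -/
@[nolint unusedArguments]
structure Skew {k A : Type u} [Field k] [Ring A] [Algebra k A] {G : Type u} [Group G]
    (σ : G →* (A ≃ₐ[k] A)) where
  base : Bim k A

namespace Skew

/-- A morphism `M ⟶ N` of `𝒳_A` is a family `(φ_g)_{g ∈ G}` where `φ_g : M ⟶ N^g` is a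
homomorphism of bimodules. -/
@[ext]
structure Hom (M N : Skew σ) where
  app : G → M.base.carrier →ₗ[k] N.base.carrier
  map_l : ∀ g a m, app g (M.base.l a m) = N.base.l (σ g a) (app g m)
  map_r : ∀ g a m, app g (M.base.r (op a) m) = N.base.r (op (σ g a)) (app g m)

attribute [simp] Hom.map_l Hom.map_r

/-- `(ψ ∘ φ)_s = ∑_g (ψ_{s g⁻¹})^g ∘ φ_g`. -/
def Hom.comp {M N K : Skew σ} (φ : Hom M N) (ψ : Hom N K) : Hom M K where
  app s := ∑ g, ψ.app (s * g⁻¹) ∘ₗ φ.app g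
  map_l s a m := by simp [← map_sum]
  map_r s a m := by simp [← map_sum]

/-- A bimodule homomorphism, as a morphism of `𝒳_A` concentrated in the component of `1`. -/
def inclHom {M N : Skew σ} (f : M.base ⟶ N.base) : Hom M N where
  app := Pi.single 1 f.lin
  map_l g a m := by
    by_cases h : g = 1
    · subst h; simp
    · simp [Pi.single_eq_of_ne h]
  map_r g a m := by
    by_cases h : g = 1
    · subst h; simp
    · simp [Pi.single_eq_of_ne h]

theorem hom_comp_assoc {M N K L : Skew σ} (φ : Hom M N) (ψ : Hom N K) (χ : Hom K L) :
    (φ.comp ψ).comp χ = φ.comp (ψ.comp χ) := by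
  ext s m
  simp only [Hom.comp, LinearMap.sum_apply, LinearMap.comp_apply, map_sum]
  rw [Finset.sum_comm]
  refine Finset.sum_congr rfl fun h _ => ?_
  refine (Fintype.sum_equiv (Equiv.mulRight h) _ _ fun u => ?_).symm
  simp [mul_assoc]

instance : Category (Skew σ) where
  Hom := Hom
  id M := inclHom (𝟙 M.base)
  comp := Hom.comp
  id_comp φ := by
    ext s m
    simp only [Hom.comp, LinearMap.sum_apply, LinearMap.comp_apply]
    rw [Finset.sum_eq_single 1]
    · simp [inclHom]
    · intro g _ hg
      simp [inclHom, Pi.single_eq_of_ne hg]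
    · simp
  comp_id φ := by
    ext s m
    simp only [Hom.comp, LinearMap.sum_apply, LinearMap.comp_apply]
    rw [Finset.sum_eq_single s]
    · simp [inclHom]
    · intro g _ hg
      have : s * g⁻¹ ≠ 1 := fun h => hg (mul_inv_eq_one.1 h).symm
      simp [inclHom, Pi.single_eq_of_ne this]
    · simp
  assoc := hom_comp_assoc

@[ext] theorem hom_ext {M N : Skew σ} {φ ψ : M ⟶ N} (h : ∀ g m, φ.app g m = ψ.app g m) : φ = ψ :=
  Hom.ext (funext fun g => LinearMap.ext (h g))

/-- A bimodule homomorphism, as a morphism of `𝒳_A` concentrated in the component of `1`. -/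
def incl {M N : Skew σ} (f : M.base ⟶ N.base) : M ⟶ N := inclHom f

@[simp] theorem comp_app {M N K : Skew σ} (φ : M ⟶ N) (ψ : N ⟶ K) (s : G) (m : M.base.carrier) :
    (φ ≫ ψ).app s m = ∑ g, ψ.app (s * g⁻¹) (φ.app g m) := by
  change (Hom.comp φ ψ).app s m = _
  simp [Hom.comp]

theorem id_eq_incl (M : Skew σ) : 𝟙 M = incl (𝟙 M.base) := rfl

@[simp] theorem hom_l {M N : Skew σ} (φ : M ⟶ N) (g : G) (a : A) (m : M.base.carrier) :
    φ.app g (M.base.l a m) = N.base.l (σ g a) (φ.app g m) := φ.map_l g a m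

@[simp] theorem hom_r {M N : Skew σ} (φ : M ⟶ N) (g : G) (a : A) (m : M.base.carrier) :
    φ.app g (M.base.r (op a) m) = N.base.r (op (σ g a)) (φ.app g m) := φ.map_r g a m

instance (M N : Skew σ) : Add (M ⟶ N) where
  add φ ψ := ⟨fun g => φ.app g + ψ.app g, fun _ _ _ => by simp, fun _ _ _ => by simp⟩

instance (M N : Skew σ) : Zero (M ⟶ N) where
  zero := ⟨fun g => 0, fun _ _ _ => by simp, fun _ _ _ => by simp⟩

instance (M N : Skew σ) : Neg (M ⟶ N) where
  neg φ := ⟨fun g => - φ.app g, fun _ _ _ => by simp, fun _ _ _ => by simp⟩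

instance (M N : Skew σ) : SMul k (M ⟶ N) where
  smul c φ := ⟨fun g => c • φ.app g, fun _ _ _ => by simp, fun _ _ _ => by simp⟩

@[simp] theorem add_app {M N : Skew σ} (φ ψ : M ⟶ N) (g : G) (m : M.base.carrier) :
    (φ + ψ).app g m = φ.app g m + ψ.app g m := rfl

@[simp] theorem zero_app {M N : Skew σ} (g : G) (m : M.base.carrier) :
    Hom.app (0 : M ⟶ N) g m = 0 := rfl

@[simp] theorem neg_app {M N : Skew σ} (φ : M ⟶ N) (g : G) (m : M.base.carrier) :
    (- φ).app g m = - φ.app g m := rfl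

@[simp] theorem smul_app {M N : Skew σ} (c : k) (φ : M ⟶ N) (g : G) (m : M.base.carrier) :
    (c • φ).app g m = c • φ.app g m := rfl

instance : Preadditive (Skew σ) where
  homGroup M N :=
    { add_assoc := fun _ _ _ => by ext; simp [add_assoc]
      zero_add := fun _ => by ext; simp
      add_zero := fun _ => by ext; simp
      nsmul := nsmulRec
      zsmul := zsmulRec
      neg_add_cancel := fun _ => by ext; simp
      add_comm := fun _ _ => by ext; simp [add_comm] }
  add_comp _ _ _ _ _ _ := by ext; simp [Finset.sum_add_distrib]
  comp_add _ _ _ _ _ _ := by ext; simp [Finset.sum_add_distrib]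

end Skew


/-- The linear map with matrix `(φ_{h g⁻¹})_{h, g}`. -/
def thetaLin {M N : Skew σ} (φ : M ⟶ N) :
    (G → M.base.carrier) →ₗ[k] (G → N.base.carrier) :=
  LinearMap.pi fun h => ∑ g, φ.app (h * g⁻¹) ∘ₗ LinearMap.proj g

theorem thetaLin_apply {M N : Skew σ} (φ : M ⟶ N) (x : G → M.base.carrier) (h : G) :
    thetaLin φ x h = ∑ g, φ.app (h * g⁻¹) (x g) := by
  simp [thetaLin]

/-- The homomorphism `⨁_g M^g → ⨁_h N^h` with matrix `((φ_{h g⁻¹})^g)_{h, g}`. -/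
def thetaMap {M N : Skew σ} (φ : M ⟶ N) : bigTwist σ M.base ⟶ bigTwist σ N.base where
  lin := thetaLin φ
  map_l a x := by
    ext h
    have e : ∀ y : (bigTwist σ M.base).carrier, btProj (σ := σ) N.base h (thetaLin φ y) =
      ∑ g, φ.app (h * g⁻¹) (btProj (σ := σ) M.base g y) := fun y => thetaLin_apply (σ := σ) φ y h
    refine (e _).trans ((Eq.trans ?_ (congrArg _ (e x).symm)).trans (bigTwist_l _ _ _).symm)
    simp [map_sum, ← AlgEquiv.mul_apply, ← map_mul]
  map_r b x := by
    ext h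
    have e : ∀ y : (bigTwist σ M.base).carrier, btProj (σ := σ) N.base h (thetaLin φ y) =
      ∑ g, φ.app (h * g⁻¹) (btProj (σ := σ) M.base g y) := fun y => thetaLin_apply (σ := σ) φ y h
    refine (e _).trans ((Eq.trans ?_ (congrArg _ (e x).symm)).trans (bigTwist_r _ _ _).symm)
    simp [map_sum, ← AlgEquiv.mul_apply, ← map_mul]

@[simp] theorem thetaMap_lin {M N : Skew σ} (φ : M ⟶ N) (x : (bigTwist σ M.base).carrier) (h : G) :
    btProj N.base h ((thetaMap φ).lin x) = ∑ g, φ.app (h * g⁻¹) (btProj M.base g x) :=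
  thetaLin_apply φ x h

theorem incl_app_one {M N : Skew σ} (f : M.base ⟶ N.base) (m : M.base.carrier) :
    (Skew.incl f : M ⟶ N).app 1 m = f.lin m := by
  simp [Skew.incl, Skew.inclHom]

theorem incl_app_ne {M N : Skew σ} (f : M.base ⟶ N.base) {g : G} (hg : g ≠ 1)
    (m : M.base.carrier) : (Skew.incl f : M ⟶ N).app g m = 0 := by
  simp [Skew.incl, Skew.inclHom, Pi.single_eq_of_ne hg]

@[simp] theorem thetaMap_incl {M N : Skew σ} (f : M.base ⟶ N.base)
    (x : (bigTwist σ M.base).carrier) (h : G) :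
    btProj N.base h ((thetaMap (Skew.incl f : M ⟶ N)).lin x) = f.lin (btProj M.base h x) := by
  rw [thetaMap_lin, Finset.sum_eq_single h, mul_inv_cancel, incl_app_one]
  · intro g _ hg
    exact incl_app_ne f (fun h' => hg (mul_inv_eq_one.1 h').symm) _
  · simp

theorem thetaMap_id (M : Skew σ) : thetaMap (𝟙 M) = 𝟙 _ := by
  apply Bim.hom_ext
  refine LinearMap.ext fun x => bigTwist_ext fun h => ?_
  rw [Skew.id_eq_incl, thetaMap_incl]
  rfl

theorem thetaMap_comp {M N K : Skew σ} (φ : M ⟶ N) (ψ : N ⟶ K) :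
    thetaMap (φ ≫ ψ) = thetaMap φ ≫ thetaMap ψ := by
  apply Bim.hom_ext
  refine LinearMap.ext fun x => bigTwist_ext fun h => ?_
  rw [thetaMap_lin]
  refine Eq.trans ?_ (thetaMap_lin ψ ((thetaMap φ).lin x) h).symm
  simp only [Skew.comp_app, thetaMap_lin, map_sum]
  rw [Finset.sum_comm (s := (Finset.univ : Finset G)) (t := Finset.univ) (f := fun u v =>
    ψ.app (h * u⁻¹) (φ.app (u * v⁻¹) (btProj M.base v x)))]
  refine Finset.sum_congr rfl fun g _ => ?_
  refine Fintype.sum_equiv (Equiv.mulRight g) _ _ fun u => ?_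
  simp [mul_assoc]

theorem thetaMap_injective {M N : Skew σ} {φ ψ : M ⟶ N} (h : thetaMap φ = thetaMap ψ) :
    φ = ψ := by
  refine Skew.hom_ext fun g m => ?_
  have e := congrArg (fun f : bigTwist σ M.base ⟶ bigTwist σ N.base =>
    btProj N.base g (f.lin (btSingle M.base 1 m))) h
  have key : ∀ χ : M ⟶ N, btProj N.base g ((thetaMap χ).lin (btSingle M.base 1 m)) =
      χ.app g m := by
    intro χ
    rw [thetaMap_lin, Finset.sum_eq_single 1]
    · simp
    · intro u _ hu
      rw [btSingle_ne hu, map_zero]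
    · simp
  rwa [key, key] at e

theorem thetaMap_shift {M N : Skew σ} (φ : M ⟶ N) (s : G) (x : (bigTwist σ M.base).carrier) :
    (thetaMap φ).lin (shift M.base s x) = shift N.base s ((thetaMap φ).lin x) := by
  ext h
  rw [shift_apply, thetaMap_lin, thetaMap_lin]
  refine Fintype.sum_equiv (Equiv.mulRight s) _ _ fun u => ?_
  simp [mul_assoc]

variable (σ) in
/-- The functor `Θ : 𝒳_A ⥤ B_A`, `M ↦ ⨁_g M^g`. -/
def thetaSkew : Skew σ ⥤ Bim k A where
  obj M := bigTwist σ M.base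
  map φ := thetaMap φ
  map_id := thetaMap_id
  map_comp := thetaMap_comp

/-! ### The tensor product `⊗^G` -/

/-- `M ⊗^G N = ⨁_g (M^g ⊗_A N) = (⨁_g M^g) ⊗_A N`. -/
abbrev Skew.tensor (M N : Skew σ) : Skew σ := ⟨(bigTwist σ M.base).tensor N.base⟩

/-- `φ ⊗^G ψ`: the part of its component at `h` that maps `M^k ⊗_A N` to
`(M'^g ⊗_A N')^h` is `(φ_{g h k⁻¹})^k ⊗ ψ_h`. -/
def Skew.tensorMap {M N M' N' : Skew σ} (φ : M ⟶ M') (ψ : N ⟶ N') :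
    M.tensor N ⟶ M'.tensor N' where
  app h := tlift
    ((tmk (bigTwist σ M'.base) N'.base).compl₁₂ (shift M'.base h ∘ₗ (thetaMap φ).lin) (ψ.app h))
    (fun a x n => by
      simp only [LinearMap.compl₁₂_apply, LinearMap.comp_apply, Bim.hom_r, shift_r, Skew.hom_l,
        tmk_bal])
  map_l h a z := by
    induction z using t_ind with
    | mk x n =>
      simp only [Skew.tensor, tensor_l, tlift_tmk, LinearMap.compl₁₂_apply, LinearMap.comp_apply,
        Bim.hom_l, shift_l]
    | add y z hy hz => simp only [map_add, hy, hz]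
  map_r h a z := by
    induction z using t_ind with
    | mk x n =>
      simp only [Skew.tensor, tensor_r, tlift_tmk, LinearMap.compl₁₂_apply, LinearMap.comp_apply,
        Skew.hom_r]
    | add y z hy hz => simp only [map_add, hy, hz]

theorem tensorMap_app {M N M' N' : Skew σ} (φ : M ⟶ M') (ψ : N ⟶ N') (h : G)
    (x : (bigTwist σ M.base).carrier) (n : N.base.carrier) :
    (Skew.tensorMap φ ψ).app h (tmk _ _ x n) =
      tmk (bigTwist σ M'.base) N'.base (shift M'.base h ((thetaMap φ).lin x)) (ψ.app h n) := rfl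

/-- The homomorphism `Θ(M) ⊗_A Θ(N) → Θ(M ⊗^G N)`, sending `M^{g h} ⊗_A N^h` to
`(M^g ⊗_A N)^h` by `m ⊗ n ↦ m ⊗ n`. -/
def jHom (M N : Bim k A) :
    (bigTwist σ M).tensor (bigTwist σ N) ⟶ bigTwist σ ((bigTwist σ M).tensor N) :=
  homOfPure
    (tlift
      (LinearMap.mk₂ k
        (fun x y => btOf fun h => tmk (bigTwist σ M) N (shift M h x) (btProj N h y))
        (fun _ _ _ => by ext; simp) (fun _ _ _ => by ext; simp)
        (fun _ _ _ => by ext; simp) (fun _ _ _ => by ext; simp))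
      (fun a x y => by
        ext h
        simp [tmk_bal]))
    (fun a x y => by
      ext h
      simp)
    (fun b x y => by
      ext h
      simp)

@[simp] theorem jHom_tmk (M N : Bim k A) (x : (bigTwist σ M).carrier)
    (y : (bigTwist σ N).carrier) (h : G) :
    btProj ((bigTwist σ M).tensor N) h ((jHom M N).lin (tmk _ _ x y)) =
      tmk _ _ (shift M h x) (btProj N h y) := rfl

/-- The component at `h` of the inverse of `jHom`. -/
def jInvAux (M N : Bim k A) (h : G) : ((bigTwist σ M).tensor N).carrier →ₗ[k]
    ((bigTwist σ M).tensor (bigTwist σ N)).carrier :=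
  tlift ((tmk (bigTwist σ M) (bigTwist σ N)).compl₁₂ (shift M h⁻¹)
      (btSingle N h))
    (fun a x n => by
      simp only [LinearMap.compl₁₂_apply, shift_r, tmk_bal, btSingle_l]
      simp)

@[simp] theorem jInvAux_tmk (M N : Bim k A) (h : G) (x : (bigTwist σ M).carrier)
    (n : N.carrier) : jInvAux M N h (tmk _ _ x n) =
      tmk (bigTwist σ M) (bigTwist σ N) (shift M h⁻¹ x) (btSingle N h n) := rfl

/-- The inverse of `jHom`. -/
def jInv (M N : Bim k A) : (bigTwist σ ((bigTwist σ M).tensor N)).carrier →ₗ[k]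
    ((bigTwist σ M).tensor (bigTwist σ N)).carrier :=
  ∑ h, jInvAux M N h ∘ₗ btProj ((bigTwist σ M).tensor N) h

theorem jInv_apply (M N : Bim k A) (z : (bigTwist σ ((bigTwist σ M).tensor N)).carrier) :
    jInv M N z = ∑ h, jInvAux M N h (btProj ((bigTwist σ M).tensor N) h z) := by
  simp [jInv]

theorem jInv_jHom (M N : Bim k A)
    (z : ((bigTwist σ M).tensor (bigTwist σ N)).carrier) :
    jInv M N ((jHom M N).lin z) = z := by
  induction z using t_ind with
  | mk x y =>
    rw [jInv_apply]
    simp only [jHom_tmk, jInvAux_tmk, shift_shift, inv_mul_cancel, shift_one]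
    rw [← map_sum, sum_btSingle]
  | add y z hy hz => rw [map_add, map_add, hy, hz]

theorem jHom_jInvAux (M N : Bim k A) (h : G) (z : ((bigTwist σ M).tensor N).carrier) :
    (jHom M N).lin (jInvAux M N h z) = btSingle ((bigTwist σ M).tensor N) h z := by
  induction z using t_ind with
  | mk x n =>
    ext g
    rw [jInvAux_tmk, jHom_tmk]
    by_cases hg : g = h
    · subst hg
      simp
    · rw [btSingle_ne hg, btSingle_ne hg, map_zero]
  | add y z hy hz => simp only [map_add, hy, hz]

theorem jHom_jInv (M N : Bim k A) (z : (bigTwist σ ((bigTwist σ M).tensor N)).carrier) :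
    (jHom M N).lin (jInv M N z) = z := by
  rw [jInv_apply, map_sum]
  simp only [jHom_jInvAux]
  exact sum_btSingle z

/-- The canonical isomorphism `Θ(M) ⊗_A Θ(N) ≅ Θ(M ⊗^G N)`. -/
def jIso (M N : Bim k A) :
    (bigTwist σ M).tensor (bigTwist σ N) ≅ bigTwist σ ((bigTwist σ M).tensor N) :=
  isoOfInv (jHom M N) (jInv M N) (jInv_jHom M N) (jHom_jInv M N)

theorem jHom_shift (M N : Bim k A) (s : G) (x : (bigTwist σ M).carrier)
    (y : (bigTwist σ N).carrier) :
    shift ((bigTwist σ M).tensor N) s ((jHom M N).lin (tmk _ _ x y)) =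
      (jHom M N).lin (tmk _ _ (shift M s x) (shift N s y)) := by
  ext h
  simp

section Coherence

variable [Module.Finite k A]

theorem thetaMap_tensorMap {M N M' N' : Skew σ} (φ : M ⟶ M') (ψ : N ⟶ N') :
    jHom M.base N.base ≫ thetaMap (Skew.tensorMap φ ψ) = (thetaMap φ ⊗ₘ thetaMap ψ) ≫ jHom M'.base N'.base := by
  refine Bim.hom_ext (t_ext fun x y => bigTwist_ext fun s => ?_)
  change btProj _ s ((thetaMap (Skew.tensorMap φ ψ)).lin ((jHom M.base N.base).lin (tmk _ _ x y))) =
    btProj _ s ((jHom M'.base N'.base).lin (tmk _ _ ((thetaMap φ).lin x) ((thetaMap ψ).lin y)))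
  rw [thetaMap_lin, jHom_tmk, thetaMap_lin, map_sum]
  refine Finset.sum_congr rfl fun g _ => ?_
  rw [jHom_tmk, tensorMap_app, thetaMap_shift, shift_shift, inv_mul_cancel_right]

/-- The associator of `⊗^G`, induced by the associator of bimodules. -/
def assocSkew (M N K : Skew σ) : (M.tensor N).tensor K ⟶ M.tensor (N.tensor K) :=
  Skew.incl (((jIso M.base N.base).inv ⊗ₘ 𝟙 K.base) ≫
    (α_ (bigTwist σ M.base) (bigTwist σ N.base) K.base).hom)

/-- The inverse of the associator of `⊗^G`. -/
def assocSkewInv (M N K : Skew σ) : M.tensor (N.tensor K) ⟶ (M.tensor N).tensor K :=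
  Skew.incl ((α_ (bigTwist σ M.base) (bigTwist σ N.base) K.base).inv ≫
    ((jIso M.base N.base).hom ⊗ₘ 𝟙 K.base))

theorem incl_comp {M N K : Skew σ} (f : M.base ⟶ N.base) (g : N.base ⟶ K.base) :
    (Skew.incl f : M ⟶ N) ≫ (Skew.incl g : N ⟶ K) = Skew.incl (f ≫ g) := by
  apply thetaMap_injective
  rw [thetaMap_comp]
  refine Bim.hom_ext (LinearMap.ext fun x => bigTwist_ext fun h => ?_)
  rw [Bim.comp_lin, LinearMap.comp_apply, thetaMap_incl, thetaMap_incl, thetaMap_incl]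
  rfl

theorem assocSkew_hom_inv (M N K : Skew σ) : assocSkew M N K ≫ assocSkewInv M N K = 𝟙 _ := by
  rw [assocSkew, assocSkewInv, incl_comp, Skew.id_eq_incl]
  congr 1
  simp [MonoidalCategory.tensorHom_id]
  rfl

theorem assocSkew_inv_hom (M N K : Skew σ) : assocSkewInv M N K ≫ assocSkew M N K = 𝟙 _ := by
  rw [assocSkew, assocSkewInv, incl_comp, Skew.id_eq_incl]
  congr 1
  simp [MonoidalCategory.tensorHom_id]

theorem thetaMap_assocSkew (M N K : Skew σ) :
    (jHom M.base N.base ⊗ₘ 𝟙 (bigTwist σ K.base)) ≫ jHom (M.tensor N).base K.base ≫ thetaMap (assocSkew M N K) =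
      (α_ (bigTwist σ M.base) (bigTwist σ N.base) (bigTwist σ K.base)).hom ≫
        (𝟙 (bigTwist σ M.base) ⊗ₘ jHom N.base K.base) ≫ jHom M.base (N.tensor K).base := by
  refine Bim.hom_ext (t_ext_left fun x y z => bigTwist_ext fun h => ?_)
  change btProj _ h ((thetaMap (assocSkew M N K)).lin ((jHom (M.tensor N).base K.base).lin
    (tmk _ _ ((jHom M.base N.base).lin (tmk _ _ x y)) z))) =
    btProj _ h ((jHom M.base (N.tensor K).base).lin (tmk _ _ x ((jHom N.base K.base).lin (tmk _ _ y z))))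
  rw [assocSkew, thetaMap_incl, jHom_tmk, jHom_shift, jHom_tmk, jHom_tmk]
  change (assocHom _ _ _).lin (tmk _ _ (jInv M.base N.base ((jHom M.base N.base).lin
    (tmk _ _ (shift M.base h x) (shift N.base h y)))) (btProj K.base h z)) = _
  rw [jInv_jHom]
  rfl

end Coherence

/-! ### The unit object and the unitors -/

section Unit

open Bim

variable {k A : Type u} [Field k] [Ring A] [Algebra k A] [Module.Finite k A]
  {G : Type u} [Group G] [Fintype G] [DecidableEq G]

theorem jHom_thetaMap_incl {σ : G →* (A ≃ₐ[k] A)} {M N K : Bim k A}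
    (f : (bigTwist σ M).tensor N ⟶ K) (x : (bigTwist σ M).carrier) (y : (bigTwist σ N).carrier)
    (h : G) :
    btProj K h ((thetaMap (Skew.incl f :
      (⟨(bigTwist σ M).tensor N⟩ : Skew σ) ⟶ ⟨K⟩)).lin ((jHom M N).lin (tmk _ _ x y))) =
      f.lin (tmk _ _ (shift M h x) (btProj N h y)) := by
  rw [thetaMap_incl]
  rfl

variable (σ : G →* (A ≃ₐ[k] A))

theorem act_act (g h : G) (a : A) : σ g (σ h a) = σ (g * h) a := by rw [map_mul]; rfl

theorem act_inv_act (g : G) (a : A) : σ g⁻¹ (σ g a) = a := by rw [act_act]; simp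

/-- The linear map underlying `foldHom`. -/
def foldLin : (G → A) →ₗ[k] A :=
  ∑ g, (σ g⁻¹).toLinearMap ∘ₗ LinearMap.proj (R := k) (φ := fun _ : G => A) g

theorem foldLin_apply (x : G → A) : foldLin σ x = ∑ g, σ g⁻¹ (x g) := by simp [foldLin]

theorem foldLin_l (a : A) (x : G → A) :
    foldLin σ (fun g => σ g a * x g) = a * foldLin σ x := by
  simp [foldLin_apply, act_inv_act, Finset.mul_sum, -map_inv]

theorem foldLin_r (a : A) (x : G → A) :
    foldLin σ (fun g => x g * σ g a) = foldLin σ x * a := by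
  simp [foldLin_apply, act_inv_act, Finset.sum_mul, -map_inv]

theorem foldLin_shift (s : G) (x : G → A) :
    foldLin σ (fun g => x (g * s)) = σ s (foldLin σ x) := by
  rw [foldLin_apply, foldLin_apply, map_sum]
  refine Fintype.sum_equiv (Equiv.mulRight s) _ _ fun u => ?_
  rw [act_act]
  simp

/-- The bimodule homomorphism `⨁_g A^g → A`, `x ↦ ∑_g g⁻¹(x_g)`. -/
def foldHom : bigTwist σ (reg k A) ⟶ reg k A where
  lin := by exact foldLin (A := A) σ
  map_l a x := foldLin_l σ a x
  map_r b x := foldLin_r σ b.unop x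

theorem foldHom_lin (x : (bigTwist σ (reg k A)).carrier) :
    (foldHom σ).lin x = ∑ g, σ g⁻¹ (btProj (reg k A) g x : A) := foldLin_apply σ x

theorem act_smul_mul (c : k) (g : G) (a x : A) : c • σ g (a * x) = σ g a * (c • σ g x) := by
  rw [map_mul, mul_smul_comm]

theorem act_smul_mul' (c : k) (g : G) (a x : A) : c • σ g (x * a) = (c • σ g x) * σ g a := by
  rw [map_mul, smul_mul_assoc]

/-- The bimodule homomorphism `A → ⨁_g A^g`, `a ↦ |G|⁻¹ (g(a))_g`. -/
def spreadHom : reg k A ⟶ bigTwist σ (reg k A) where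
  lin := LinearMap.pi fun g => (Nat.card G : k)⁻¹ • (σ g).toLinearMap
  map_l a x := funext fun g => act_smul_mul σ _ g a x
  map_r b x := funext fun g => act_smul_mul' σ _ g b.unop x

theorem spreadHom_lin (a : A) (g : G) :
    btProj (reg k A) g ((spreadHom σ).lin a) = (Nat.card G : k)⁻¹ • (σ g) a := rfl

theorem foldLin_spread [NeZero (Nat.card G : k)] (a : A) :
    foldLin σ (fun g => (Nat.card G : k)⁻¹ • σ g a) = a := by
  rw [foldLin_apply]
  simp only [map_smul, act_inv_act, Finset.sum_const, Finset.card_univ,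
    ← Nat.card_eq_fintype_card]
  rw [← Nat.cast_smul_eq_nsmul k, smul_smul, mul_inv_cancel₀ (NeZero.ne _), one_smul]

theorem spreadHom_foldHom [NeZero (Nat.card G : k)] : spreadHom σ ≫ foldHom σ = 𝟙 _ :=
  Bim.hom_ext (LinearMap.ext fun a => foldLin_spread σ a)

theorem foldHom_shift (s : G) (x : (bigTwist σ (reg k A)).carrier) :
    (foldHom σ).lin (shift (reg k A) s x) = (σ s) ((foldHom σ).lin x : A) :=
  foldLin_shift σ s x

/-- The idempotent `π₁ = |G|⁻¹ (g)_{g ∈ G}` of `End_{𝒳_A}(A)`. -/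
def unitIdem : (⟨reg k A⟩ : Skew σ) ⟶ ⟨reg k A⟩ where
  app g := (Nat.card G : k)⁻¹ • (σ g).toLinearMap
  map_l g a m := act_smul_mul σ _ g a m
  map_r g b m := act_smul_mul' σ _ g b m

theorem smul_foldLin (c : k) (h : G) (x : G → A) :
    ∑ g, c • σ (h * g⁻¹) (x g) = c • σ h (foldLin σ x) := by
  simp only [foldLin_apply, map_sum, Finset.smul_sum, act_act]

theorem thetaMap_unitIdem : thetaMap (unitIdem σ) = foldHom σ ≫ spreadHom σ := by
  refine Bim.hom_ext (LinearMap.ext fun x => bigTwist_ext fun h => ?_)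
  rw [thetaMap_lin]
  exact smul_foldLin σ _ h x

theorem unitIdem_idem [NeZero (Nat.card G : k)] : unitIdem σ ≫ unitIdem σ = unitIdem σ := by
  apply thetaMap_injective
  rw [thetaMap_comp, thetaMap_unitIdem, Category.assoc, ← Category.assoc (spreadHom σ),
    spreadHom_foldHom, Category.id_comp]

variable {σ}

/-- `A ⊗^G M → M`, sending `a ⊗ m ∈ A^g ⊗_A M` to `g⁻¹(a) m`. -/
def lunit (M : Skew σ) : (⟨reg k A⟩ : Skew σ).tensor M ⟶ M :=
  Skew.incl ((foldHom σ ⊗ₘ 𝟙 M.base) ≫ (λ_ M.base).hom)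

/-- `M → A ⊗^G M`, `m ↦ |G|⁻¹ ∑_g 1_{A^g} ⊗ m`. -/
def lunitInv (M : Skew σ) : M ⟶ (⟨reg k A⟩ : Skew σ).tensor M :=
  Skew.incl ((λ_ M.base).inv ≫ (spreadHom σ ⊗ₘ 𝟙 M.base))

/-- The morphism of `𝒳_A` from `⨁_g M^g` to `M` whose component at `h` is the projection to
`M^h`. -/
def projSkew (M : Skew σ) : (⟨bigTwist σ M.base⟩ : Skew σ) ⟶ M where
  app h := btProj M.base h
  map_l _ _ _ := rfl
  map_r _ _ _ := rfl

/-- `M ⊗^G A → M`, sending `m ⊗ a ∈ M^g ⊗_A A` to `m g(a) ∈ M`, in the component of `g`. -/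
def runit (M : Skew σ) : M.tensor (⟨reg k A⟩ : Skew σ) ⟶ M :=
  (Skew.incl (ρ_ (bigTwist σ M.base)).hom :
    M.tensor (⟨reg k A⟩ : Skew σ) ⟶ ⟨bigTwist σ M.base⟩) ≫ projSkew M

/-- The morphism of `𝒳_A` from `M` to `⨁_g M^g` whose component at `h` is `|G|⁻¹` times the
identification of `M` with `(M^{h⁻¹})^h`. -/
def injSkew (M : Skew σ) : M ⟶ (⟨bigTwist σ M.base⟩ : Skew σ) where
  app h := (Nat.card G : k)⁻¹ • btSingle M.base h⁻¹
  map_l h a m := by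
    simp [btSingle_l, ← AlgEquiv.mul_apply, ← map_mul]
  map_r h a m := by
    simp [btSingle_r, ← AlgEquiv.mul_apply, ← map_mul]

/-- `M → M ⊗^G A`, with component `m ↦ |G|⁻¹ m ⊗ 1 ∈ (M^{h⁻¹} ⊗_A A)^h` at `h`. -/
def runitInv (M : Skew σ) : M ⟶ M.tensor (⟨reg k A⟩ : Skew σ) :=
  injSkew M ≫ (Skew.incl (ρ_ (bigTwist σ M.base)).inv :
    (⟨bigTwist σ M.base⟩ : Skew σ) ⟶ M.tensor (⟨reg k A⟩ : Skew σ))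

theorem thetaMap_comp_lin {M N K : Skew σ} (φ : M ⟶ N) (ψ : N ⟶ K)
    (x : (bigTwist σ M.base).carrier) :
    (thetaMap (φ ≫ ψ)).lin x = (thetaMap ψ).lin ((thetaMap φ).lin x) := by
  rw [thetaMap_comp]
  rfl

theorem thetaMap_lunit (M : Skew σ) : jHom (reg k A) M.base ≫ thetaMap (lunit M) =
    (foldHom σ ⊗ₘ 𝟙 (bigTwist σ M.base)) ≫ (λ_ (bigTwist σ M.base)).hom := by
  refine Bim.hom_ext (t_ext fun x y => bigTwist_ext fun h => ?_)
  refine (jHom_thetaMap_incl _ x y h).trans ?_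
  exact congrArg (fun a : A => M.base.l a (btProj M.base h y)) (foldHom_shift σ h x)

theorem thetaMap_lunitInv (M : Skew σ) : thetaMap (lunitInv M) =
    (λ_ (bigTwist σ M.base)).inv ≫ (spreadHom σ ⊗ₘ 𝟙 (bigTwist σ M.base)) ≫
      jHom (reg k A) M.base := by
  refine Bim.hom_ext (LinearMap.ext fun y => bigTwist_ext fun h => ?_)
  refine (thetaMap_incl _ y h).trans ?_
  change tmk (bigTwist σ (reg k A)) M.base ((spreadHom σ).lin (1 : A)) (btProj M.base h y) =
    tmk (bigTwist σ (reg k A)) M.base (shift (reg k A) h ((spreadHom σ).lin (1 : A)))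
      (btProj M.base h y)
  congr 2
  refine bigTwist_ext fun g => ?_
  rw [shift_apply, spreadHom_lin, spreadHom_lin, map_one, map_one]

theorem thetaMap_runit (M : Skew σ) : jHom M.base (reg k A) ≫ thetaMap (runit M) =
    (𝟙 (bigTwist σ M.base) ⊗ₘ foldHom σ) ≫ (ρ_ (bigTwist σ M.base)).hom := by
  refine Bim.hom_ext (t_ext fun x y => bigTwist_ext fun s => ?_)
  refine (congrArg (btProj M.base s) (thetaMap_comp_lin (Skew.incl (ρ_ (bigTwist σ M.base)).hom :
    M.tensor (⟨reg k A⟩ : Skew σ) ⟶ ⟨bigTwist σ M.base⟩) (projSkew M) _)).trans ?_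
  refine (thetaMap_lin (projSkew M) _ s).trans ?_
  refine (Finset.sum_congr rfl fun h _ => congrArg _ (jHom_thetaMap_incl _ x y h)).trans ?_
  have e : ∀ z : G → A, ∑ h, M.base.r (op (σ (s * h⁻¹) (z h))) (btProj M.base s x) =
      M.base.r (op (σ s (foldLin σ z))) (btProj M.base s x) := fun z => by
    simp only [foldLin_apply, map_sum, act_act, Finset.op_sum, LinearMap.sum_apply]
  refine Eq.trans (Finset.sum_congr rfl fun h _ => ?_) (e y)
  change btProj M.base (s * h⁻¹) ((bigTwist σ M.base).r (op (btProj (reg k A) h y : A))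
    (shift M.base h x)) = _
  rw [bigTwist_r, shift_apply, inv_mul_cancel_right]
  rfl

theorem thetaMap_runitInv (M : Skew σ) : thetaMap (runitInv M) =
    (ρ_ (bigTwist σ M.base)).inv ≫ (𝟙 (bigTwist σ M.base) ⊗ₘ spreadHom σ) ≫
      jHom M.base (reg k A) := by
  refine Bim.hom_ext (LinearMap.ext fun x => bigTwist_ext fun s => ?_)
  refine (congrArg (btProj (M.tensor (⟨reg k A⟩ : Skew σ)).base s)
    (thetaMap_comp_lin (injSkew M) _ _)).trans ?_
  refine (thetaMap_incl _ ((thetaMap (injSkew M)).lin x) s).trans ?_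
  have e : btProj (bigTwist σ M.base) s ((thetaMap (injSkew M)).lin x) =
      (Nat.card G : k)⁻¹ • shift M.base s x := by
    rw [thetaMap_lin]
    change ∑ g, (Nat.card G : k)⁻¹ • btSingle M.base (s * g⁻¹)⁻¹ (btProj M.base g x) = _
    rw [← Finset.smul_sum]
    congr 1
    conv_rhs => rw [← sum_btSingle x, map_sum]
    simp [shift_single]
  rw [e]
  change tmk (bigTwist σ M.base) (reg k A) ((Nat.card G : k)⁻¹ • shift M.base s x) (1 : A) =
    tmk (bigTwist σ M.base) (reg k A) (shift M.base s x) ((Nat.card G : k)⁻¹ • (σ s) (1 : A))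
  rw [map_one]
  exact (LinearMap.map_smul₂ _ _ _ _).trans
    (map_smul (tmk (bigTwist σ M.base) (reg k A) (shift M.base s x)) _ _).symm

end Unit

/-! ### Passing to the idempotent completion

An auxiliary construction, in which `C` will be the skew category `𝒳_A` with `⊗^G`, and `F` the
faithful functor `Θ` from `𝒳_A` to bimodules. It produces the bicategory `X_A` on the idempotent
completion of `𝒳_A` and the extension of the pseudofunctor `Θ` to it. -/

section Karoubi

open Idempotents

universe v₁ v₂ u₁ u₂

variable {C : Type u₁} [Category.{v₁} C] {D : Type u₂} [Category.{v₂} D] [MonoidalCategory D]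

/-- A tensor product on `C` with associator, and with an idempotent `idem` on an object `unit`
whose formal image is a unit object, together with the comparison of this tensor product with
the one of `D` along the functor `F`. -/
structure TensorData (F : C ⥤ D) where
  obj : C → C → C
  map : ∀ {X X' Y Y' : C}, (X ⟶ X') → (Y ⟶ Y') → (obj X Y ⟶ obj X' Y')
  assoc : ∀ X Y Z, obj (obj X Y) Z ≅ obj X (obj Y Z)
  unit : C
  idem : unit ⟶ unit
  lun : ∀ X, obj unit X ⟶ X
  lunInv : ∀ X, X ⟶ obj unit X
  run : ∀ X, obj X unit ⟶ X
  runInv : ∀ X, X ⟶ obj X unit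
  J : ∀ X Y, F.obj X ⊗ F.obj Y ≅ F.obj (obj X Y)
  fold : F.obj unit ⟶ 𝟙_ D
  spread : 𝟙_ D ⟶ F.obj unit
  J_map : ∀ {X X' Y Y' : C} (f : X ⟶ X') (g : Y ⟶ Y'),
    (J X Y).hom ≫ F.map (map f g) = (F.map f ⊗ₘ F.map g) ≫ (J X' Y').hom
  J_assoc : ∀ X Y Z, ((J X Y).hom ⊗ₘ 𝟙 (F.obj Z)) ≫ (J (obj X Y) Z).hom ≫
    F.map (assoc X Y Z).hom = (α_ (F.obj X) (F.obj Y) (F.obj Z)).hom ≫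
      (𝟙 (F.obj X) ⊗ₘ (J Y Z).hom) ≫ (J X (obj Y Z)).hom
  spread_fold : spread ≫ fold = 𝟙 _
  fold_spread : fold ≫ spread = F.map idem
  J_lun : ∀ X, (J unit X).hom ≫ F.map (lun X) = (fold ⊗ₘ 𝟙 (F.obj X)) ≫ (λ_ (F.obj X)).hom
  map_lunInv : ∀ X, F.map (lunInv X) =
    (λ_ (F.obj X)).inv ≫ (spread ⊗ₘ 𝟙 (F.obj X)) ≫ (J unit X).hom
  J_run : ∀ X, (J X unit).hom ≫ F.map (run X) = (𝟙 (F.obj X) ⊗ₘ fold) ≫ (ρ_ (F.obj X)).hom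
  map_runInv : ∀ X, F.map (runInv X) =
    (ρ_ (F.obj X)).inv ≫ (𝟙 (F.obj X) ⊗ₘ spread) ≫ (J X unit).hom

namespace TensorData

variable {F : C ⥤ D} [F.Faithful] (T : TensorData F)

theorem F_map {X X' Y Y' : C} (f : X ⟶ X') (g : Y ⟶ Y') :
    F.map (T.map f g) = (T.J X Y).inv ≫ (F.map f ⊗ₘ F.map g) ≫ (T.J X' Y').hom := by
  rw [Iso.eq_inv_comp, J_map]

theorem F_assoc (X Y Z : C) : F.map (T.assoc X Y Z).hom =
    (T.J (T.obj X Y) Z).inv ≫ ((T.J X Y).inv ⊗ₘ 𝟙 (F.obj Z)) ≫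
      (α_ (F.obj X) (F.obj Y) (F.obj Z)).hom ≫
      (𝟙 (F.obj X) ⊗ₘ (T.J Y Z).hom) ≫ (T.J X (T.obj Y Z)).hom := by
  rw [Iso.eq_inv_comp, ← T.J_assoc, tensorHom_comp_tensorHom_assoc]
  simp

theorem F_lun (X : C) : F.map (T.lun X) =
    (T.J T.unit X).inv ≫ (T.fold ⊗ₘ 𝟙 (F.obj X)) ≫ (λ_ (F.obj X)).hom := by
  rw [Iso.eq_inv_comp, T.J_lun]

theorem F_run (X : C) : F.map (T.run X) =
    (T.J X T.unit).inv ≫ (𝟙 (F.obj X) ⊗ₘ T.fold) ≫ (ρ_ (F.obj X)).hom := by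
  rw [Iso.eq_inv_comp, T.J_run]

theorem map_comp {X X' X'' Y Y' Y'' : C} (f : X ⟶ X') (g : Y ⟶ Y') (f' : X' ⟶ X'')
    (g' : Y' ⟶ Y'') : T.map f g ≫ T.map f' g' = T.map (f ≫ f') (g ≫ g') := by
  apply F.map_injective
  simp only [Functor.map_comp, F_map, Category.assoc, Iso.hom_inv_id_assoc,
    tensorHom_comp_tensorHom_assoc]

theorem assoc_nat {X X' Y Y' Z Z' : C} (f : X ⟶ X') (g : Y ⟶ Y') (h : Z ⟶ Z') :
    T.map (T.map f g) h ≫ (T.assoc _ _ _).hom = (T.assoc _ _ _).hom ≫ T.map f (T.map g h) := by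
  apply F.map_injective
  simp only [Functor.map_comp, F_map, F_assoc, Category.assoc, Iso.hom_inv_id_assoc,
    tensorHom_comp_tensorHom_assoc, Category.comp_id, Category.id_comp, Iso.hom_inv_id]
  have h₁ : ((T.J X Y).inv ≫ (F.map f ⊗ₘ F.map g)) ⊗ₘ F.map h =
      ((T.J X Y).inv ⊗ₘ 𝟙 _) ≫ ((F.map f ⊗ₘ F.map g) ⊗ₘ F.map h) := by
    rw [tensorHom_comp_tensorHom, Category.id_comp]
  have h₂ : F.map f ⊗ₘ ((F.map g ⊗ₘ F.map h) ≫ (T.J Y' Z').hom) =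
      (F.map f ⊗ₘ (F.map g ⊗ₘ F.map h)) ≫ (𝟙 _ ⊗ₘ (T.J Y' Z').hom) := by
    rw [tensorHom_comp_tensorHom, Category.comp_id]
  rw [h₁, h₂]
  simp only [Category.assoc, associator_naturality_assoc]

theorem assoc_nat_inv {X X' Y Y' Z Z' : C} (f : X ⟶ X') (g : Y ⟶ Y') (h : Z ⟶ Z') :
    T.map f (T.map g h) ≫ (T.assoc _ _ _).inv = (T.assoc _ _ _).inv ≫ T.map (T.map f g) h := by
  rw [Iso.comp_inv_eq, Category.assoc, assoc_nat, Iso.inv_hom_id_assoc]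

theorem lun_nat {X Y : C} (f : X ⟶ Y) : T.map T.idem f ≫ T.lun Y = T.lun X ≫ f := by
  apply F.map_injective
  simp only [Functor.map_comp, F_map, F_lun, Category.assoc, Iso.hom_inv_id_assoc,
    tensorHom_comp_tensorHom_assoc, ← fold_spread, spread_fold, Category.comp_id]
  rw [← leftUnitor_naturality, ← id_tensorHom, tensorHom_comp_tensorHom_assoc, Category.id_comp,
    Category.comp_id]

theorem run_nat {X Y : C} (f : X ⟶ Y) : T.map f T.idem ≫ T.run Y = T.run X ≫ f := by
  apply F.map_injective
  simp only [Functor.map_comp, F_map, F_run, Category.assoc, Iso.hom_inv_id_assoc,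
    tensorHom_comp_tensorHom_assoc, ← fold_spread, spread_fold, Category.comp_id]
  rw [← rightUnitor_naturality, ← tensorHom_id, tensorHom_comp_tensorHom_assoc, Category.id_comp,
    Category.comp_id]

theorem lunInv_nat {X Y : C} (f : X ⟶ Y) : f ≫ T.lunInv Y = T.lunInv X ≫ T.map T.idem f := by
  apply F.map_injective
  simp only [Functor.map_comp, F_map, map_lunInv, Category.assoc, Iso.hom_inv_id_assoc,
    tensorHom_comp_tensorHom_assoc, ← fold_spread, reassoc_of% T.spread_fold]
  rw [leftUnitor_inv_naturality_assoc, ← id_tensorHom, tensorHom_comp_tensorHom_assoc,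
    Category.id_comp, Category.id_comp, Category.comp_id]

theorem runInv_nat {X Y : C} (f : X ⟶ Y) : f ≫ T.runInv Y = T.runInv X ≫ T.map f T.idem := by
  apply F.map_injective
  simp only [Functor.map_comp, F_map, map_runInv, Category.assoc, Iso.hom_inv_id_assoc,
    tensorHom_comp_tensorHom_assoc, ← fold_spread, reassoc_of% T.spread_fold]
  rw [rightUnitor_inv_naturality_assoc, ← tensorHom_id, tensorHom_comp_tensorHom_assoc,
    Category.id_comp, Category.id_comp, Category.comp_id]

theorem lunInv_lun (X : C) : T.lunInv X ≫ T.lun X = 𝟙 X := by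
  apply F.map_injective
  simp only [Functor.map_comp, F_lun, map_lunInv, Category.assoc, Iso.hom_inv_id_assoc,
    tensorHom_comp_tensorHom_assoc, spread_fold]
  simp

theorem lun_lunInv (X : C) : T.lun X ≫ T.lunInv X = T.map T.idem (𝟙 X) := by
  apply F.map_injective
  simp only [Functor.map_comp, F_lun, map_lunInv, F_map, Category.assoc, Iso.hom_inv_id_assoc,
    tensorHom_comp_tensorHom_assoc, fold_spread]
  simp

theorem runInv_run (X : C) : T.runInv X ≫ T.run X = 𝟙 X := by
  apply F.map_injective
  simp only [Functor.map_comp, F_run, map_runInv, Category.assoc, Iso.hom_inv_id_assoc,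
    tensorHom_comp_tensorHom_assoc, spread_fold]
  simp

theorem run_runInv (X : C) : T.run X ≫ T.runInv X = T.map (𝟙 X) T.idem := by
  apply F.map_injective
  simp only [Functor.map_comp, F_run, map_runInv, F_map, Category.assoc, Iso.hom_inv_id_assoc,
    tensorHom_comp_tensorHom_assoc, fold_spread]
  simp

theorem idem_idem : T.idem ≫ T.idem = T.idem := by
  apply F.map_injective
  rw [Functor.map_comp, ← fold_spread, Category.assoc, reassoc_of% T.spread_fold]

theorem map_p (P Q : Karoubi C) : T.map P.p Q.p ≫ T.map P.p Q.p = T.map P.p Q.p := by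
  rw [map_comp, P.idem, Q.idem]

/-- `(X, e) ⊗ (Y, f) = (X ⊗ Y, e ⊗ f)`. -/
abbrev tensorObj (P Q : Karoubi C) : Karoubi C := ⟨T.obj P.X Q.X, T.map P.p Q.p, T.map_p P Q⟩

/-- The tensor product of morphisms between formal images of idempotents. -/
def tensorHom {P P' Q Q' : Karoubi C} (f : P ⟶ P') (g : Q ⟶ Q') :
    T.tensorObj P Q ⟶ T.tensorObj P' Q' :=
  ⟨T.map f.f g.f, by simp [tensorObj, map_comp]⟩

/-- The tensor structure `(X, e) ⊗ (Y, f) = (X ⊗ Y, e ⊗ f)` on the idempotent completion of `C`,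
with unit object `(unit, idem)`, and with associators and unitors induced by those of `C`. -/
abbrev monoidalStruct : MonoidalCategoryStruct (Karoubi C) where
  tensorObj := T.tensorObj
  whiskerLeft P _ _ g := T.tensorHom (𝟙 P) g
  whiskerRight f Q := T.tensorHom f (𝟙 Q)
  tensorHom := T.tensorHom
  tensorUnit := ⟨T.unit, T.idem, T.idem_idem⟩
  associator P Q R :=
    { hom := ⟨T.map (T.map P.p Q.p) R.p ≫ (T.assoc _ _ _).hom ≫ T.map P.p (T.map Q.p R.p), by
        simp [tensorObj, map_comp, reassoc_of% T.map_comp]⟩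
      inv := ⟨T.map P.p (T.map Q.p R.p) ≫ (T.assoc _ _ _).inv ≫ T.map (T.map P.p Q.p) R.p, by
        simp [tensorObj, map_comp, reassoc_of% T.map_comp]⟩
      hom_inv_id := by
        ext
        simp [tensorObj, map_comp, reassoc_of% T.map_comp, reassoc_of% T.assoc_nat,
          reassoc_of% T.assoc_nat_inv]
      inv_hom_id := by
        ext
        simp [tensorObj, map_comp, reassoc_of% T.map_comp, reassoc_of% T.assoc_nat,
          reassoc_of% T.assoc_nat_inv] }
  leftUnitor P :=
    { hom := ⟨T.map T.idem P.p ≫ T.lun P.X ≫ P.p, by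
        simp [tensorObj, reassoc_of% T.map_comp, T.idem_idem]⟩
      inv := ⟨P.p ≫ T.lunInv P.X ≫ T.map T.idem P.p, by
        simp [tensorObj, map_comp, T.idem_idem]⟩
      hom_inv_id := by
        ext
        simp [tensorObj, reassoc_of% T.lun_nat, reassoc_of% T.lun_lunInv, map_comp, T.idem_idem,
          reassoc_of% T.lunInv_nat P.p]
      inv_hom_id := by
        ext
        simp [tensorObj, reassoc_of% T.lun_nat, reassoc_of% T.lunInv_lun, reassoc_of% T.map_comp] }
  rightUnitor P :=
    { hom := ⟨T.map P.p T.idem ≫ T.run P.X ≫ P.p, by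
        simp [tensorObj, reassoc_of% T.map_comp, T.idem_idem]⟩
      inv := ⟨P.p ≫ T.runInv P.X ≫ T.map P.p T.idem, by
        simp [tensorObj, map_comp, T.idem_idem]⟩
      hom_inv_id := by
        ext
        simp [tensorObj, reassoc_of% T.run_nat, reassoc_of% T.run_runInv, map_comp, T.idem_idem,
          reassoc_of% T.runInv_nat P.p]
      inv_hom_id := by
        ext
        simp [tensorObj, reassoc_of% T.run_nat, reassoc_of% T.runInv_run, reassoc_of% T.map_comp] }

end TensorData

/-- A choice of images in `D` of the idempotents of `C`, along a functor `F : C ⥤ D`. -/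
structure ImageData (F : C ⥤ D) where
  im : Karoubi C → D
  ι : ∀ P : Karoubi C, im P ⟶ F.obj P.X
  π : ∀ P : Karoubi C, F.obj P.X ⟶ im P
  ι_π : ∀ P, ι P ≫ π P = 𝟙 _
  π_ι : ∀ P, π P ≫ ι P = F.map P.p

namespace ImageData

variable {F : C ⥤ D} (I : ImageData F)

attribute [simp] ι_π π_ι

@[simp] theorem ι_p (P : Karoubi C) : I.ι P ≫ F.map P.p = I.ι P := by
  rw [← I.π_ι, ← Category.assoc, ι_π, Category.id_comp]

@[simp] theorem p_π (P : Karoubi C) : F.map P.p ≫ I.π P = I.π P := by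
  rw [← I.π_ι, Category.assoc, ι_π, Category.comp_id]

/-- The extension of `F` to the idempotent completion, `(X, e) ↦ F(e) F(X)`. -/
def functor : Karoubi C ⥤ D where
  obj := I.im
  map {P Q} f := I.ι P ≫ F.map f.f ≫ I.π Q
  map_id P := by simp
  map_comp {P Q R} f g := by
    simp only [Category.assoc, reassoc_of% I.π_ι, Karoubi.comp_f]
    rw [← F.map_comp_assoc Q.p, Karoubi.p_comp, F.map_comp, Category.assoc]

theorem functor_obj (P : Karoubi C) : I.functor.obj P = I.im P := rfl

theorem functor_map {P Q : Karoubi C} (f : P ⟶ Q) :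
    I.functor.map f = I.ι P ≫ F.map f.f ≫ I.π Q := rfl

instance [F.Faithful] : I.functor.Faithful where
  map_injective {P Q f g} h := by
    ext
    apply F.map_injective
    have h' := congrArg (fun x => I.π P ≫ x ≫ I.ι Q) h
    simp only [functor_map, Category.assoc, π_ι, reassoc_of% I.π_ι, ← F.map_comp] at h'
    simpa using h'

variable [F.Faithful] (T : TensorData F)

/-- The comparison isomorphism of the images, given by `J`. -/
def mu (P Q : Karoubi C) : I.im P ⊗ I.im Q ≅ I.im (T.tensorObj P Q) where
  hom := (I.ι P ⊗ₘ I.ι Q) ≫ (T.J P.X Q.X).hom ≫ I.π (T.tensorObj P Q)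
  inv := I.ι (T.tensorObj P Q) ≫ (T.J P.X Q.X).inv ≫ (I.π P ⊗ₘ I.π Q)
  hom_inv_id := by
    have h : F.map (T.tensorObj P Q).p = _ := T.F_map P.p Q.p
    simp only [Category.assoc, reassoc_of% I.π_ι, h, Iso.hom_inv_id_assoc,
      tensorHom_comp_tensorHom, I.ι_p, I.p_π, I.ι_π]
    simp
  inv_hom_id := by
    have h : F.map (T.tensorObj P Q).p = _ := T.F_map P.p Q.p
    simp only [Category.assoc, tensorHom_comp_tensorHom_assoc, I.π_ι]
    rw [← reassoc_of% h, I.p_π (T.tensorObj P Q), I.ι_π]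

/-- The comparison isomorphism of the unit objects, given by `fold` and `spread`. -/
def eps : 𝟙_ D ≅ I.im ⟨T.unit, T.idem, T.idem_idem⟩ where
  hom := T.spread ≫ I.π ⟨T.unit, T.idem, T.idem_idem⟩
  inv := I.ι ⟨T.unit, T.idem, T.idem_idem⟩ ≫ T.fold
  hom_inv_id := by
    simp only [Category.assoc, reassoc_of% I.π_ι]
    rw [← T.fold_spread, Category.assoc, T.spread_fold, Category.comp_id, T.spread_fold]
  inv_hom_id := by
    simp only [Category.assoc, reassoc_of% T.fold_spread]
    rw [I.p_π ⟨T.unit, T.idem, T.idem_idem⟩, I.ι_π]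

theorem p_fold : F.map T.idem ≫ T.fold = T.fold := by
  rw [← T.fold_spread, Category.assoc, T.spread_fold, Category.comp_id]

theorem mu_tensorHom {P P' Q Q' : Karoubi C} (f : P ⟶ P') (g : Q ⟶ Q') :
    I.ι (T.tensorObj P Q) ≫ F.map (T.map f.f g.f) ≫ I.π (T.tensorObj P' Q') =
      (I.mu T P Q).inv ≫ ((I.ι P ≫ F.map f.f ≫ I.π P') ⊗ₘ (I.ι Q ≫ F.map g.f ≫ I.π Q')) ≫
        (I.mu T P' Q').hom := by
  simp only [mu, Category.assoc, tensorHom_comp_tensorHom_assoc, I.π_ι,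
    reassoc_of% I.π_ι, T.F_map, ← F.map_comp, Karoubi.comp_p, Karoubi.p_comp]

theorem mu_assoc (P Q R : Karoubi C) :
    I.ι (T.tensorObj (T.tensorObj P Q) R) ≫ F.map (T.map (T.map P.p Q.p) R.p ≫
      (T.assoc _ _ _).hom ≫ T.map P.p (T.map Q.p R.p)) ≫ I.π (T.tensorObj P (T.tensorObj Q R)) =
    (((I.mu T _ _).symm ≪≫ ((I.mu T _ _).symm ⊗ᵢ .refl _))
        ≪≫ α_ (I.im P) (I.im Q) (I.im R)
        ≪≫ ((.refl _ ⊗ᵢ I.mu T _ _) ≪≫ I.mu T _ _)).hom := by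
  have h₁ : F.map (T.map P.p Q.p) ≫ (T.J P.X Q.X).inv ≫ (I.π P ⊗ₘ I.π Q) =
      (T.J P.X Q.X).inv ≫ (I.π P ⊗ₘ I.π Q) := by
    rw [T.F_map, Category.assoc, Category.assoc, Iso.hom_inv_id_assoc, tensorHom_comp_tensorHom,
      I.p_π, I.p_π]
  have h₂ : (I.ι Q ⊗ₘ I.ι R) ≫ (T.J Q.X R.X).hom ≫ F.map (T.map Q.p R.p) =
      (I.ι Q ⊗ₘ I.ι R) ≫ (T.J Q.X R.X).hom := by
    rw [T.J_map, tensorHom_comp_tensorHom_assoc, I.ι_p, I.ι_p]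
  have h₄ : F.map (T.map P.p (T.map Q.p R.p)) ≫ I.π (T.tensorObj P (T.tensorObj Q R)) =
      I.π (T.tensorObj P (T.tensorObj Q R)) := I.p_π (T.tensorObj P (T.tensorObj Q R))
  have h₆ : I.ι P ⊗ₘ ((I.ι Q ⊗ₘ I.ι R) ≫ (T.J Q.X R.X).hom) =
      (I.ι P ⊗ₘ (I.ι Q ⊗ₘ I.ι R)) ≫ (𝟙 _ ⊗ₘ (T.J Q.X R.X).hom) := by
    rw [tensorHom_comp_tensorHom, Category.comp_id]
  simp only [mu, Iso.trans_hom, Iso.symm_hom, tensorIso_hom, Iso.refl_hom, Category.assoc,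
    tensorHom_comp_tensorHom_assoc, reassoc_of% I.π_ι, I.π_ι, Category.comp_id, Category.id_comp,
    F.map_comp]
  rw [h₁, h₂, h₄]
  simp only [Category.assoc, tensorHom_comp_tensorHom_assoc, T.F_map, T.F_assoc,
    Iso.hom_inv_id_assoc, Category.comp_id, Iso.hom_inv_id]
  rw [h₆, Category.assoc, ← associator_naturality_assoc, tensorHom_comp_tensorHom_assoc,
    Category.assoc, tensorHom_comp_tensorHom]
  simp only [I.π_ι]

theorem mu_lun (P : Karoubi C) :
    I.ι (T.tensorObj ⟨T.unit, T.idem, T.idem_idem⟩ P) ≫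
      F.map (T.map T.idem P.p ≫ T.lun P.X ≫ P.p) ≫ I.π P =
    (((I.mu T _ _).symm ≪≫ ((I.eps T).symm ⊗ᵢ .refl _)) ≪≫ λ_ (I.im P)).hom := by
  rw [reassoc_of% T.lun_nat, P.idem, F.map_comp, Category.assoc, I.p_π, T.F_lun]
  simp only [mu, eps, Iso.trans_hom, Iso.symm_hom, tensorIso_hom, Iso.refl_hom, Category.assoc,
    tensorHom_comp_tensorHom_assoc, reassoc_of% I.π_ι, p_fold, Category.comp_id]
  rw [← leftUnitor_naturality, ← id_tensorHom, tensorHom_comp_tensorHom_assoc, Category.id_comp,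
    Category.comp_id]

theorem mu_run (P : Karoubi C) :
    I.ι (T.tensorObj P ⟨T.unit, T.idem, T.idem_idem⟩) ≫
      F.map (T.map P.p T.idem ≫ T.run P.X ≫ P.p) ≫ I.π P =
    (((I.mu T _ _).symm ≪≫ (.refl _ ⊗ᵢ (I.eps T).symm)) ≪≫ ρ_ (I.im P)).hom := by
  rw [reassoc_of% T.run_nat, P.idem, F.map_comp, Category.assoc, I.p_π, T.F_run]
  simp only [mu, eps, Iso.trans_hom, Iso.symm_hom, tensorIso_hom, Iso.refl_hom, Category.assoc,
    tensorHom_comp_tensorHom_assoc, reassoc_of% I.π_ι, p_fold, Category.comp_id]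
  rw [← rightUnitor_naturality, ← tensorHom_id, tensorHom_comp_tensorHom_assoc, Category.id_comp,
    Category.comp_id]

/-- The functor `(X, e) ↦ F(e) F(X)` preserves the tensor structures. -/
def inducing : letI := T.monoidalStruct
    Monoidal.InducingFunctorData I.functor :=
  letI := T.monoidalStruct
  { μIso := I.mu T
    εIso := I.eps T
    whiskerLeft_eq := fun P _ _ g => (I.mu_tensorHom T (𝟙 P) g).trans (by
      rw [Karoubi.id_f, I.p_π, I.ι_π, id_tensorHom]
      rfl)
    whiskerRight_eq := fun f Q => (I.mu_tensorHom T f (𝟙 Q)).trans (by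
      rw [Karoubi.id_f, I.p_π, I.ι_π, tensorHom_id]
      rfl)
    tensorHom_eq := I.mu_tensorHom T
    associator_eq := I.mu_assoc T
    leftUnitor_eq := I.mu_lun T
    rightUnitor_eq := I.mu_run T }

end ImageData

end Karoubi

/-! ### The bicategory `X_A` and the pseudofunctor `Θ` -/

namespace Bim

variable {k A : Type u} [Field k] [Ring A] [Algebra k A]

/-- The image of an endomorphism of a bimodule. -/
def image {M : Bim k A} (e : M ⟶ M) : Bim k A where
  carrier := LinearMap.range e.lin
  l := AlgHom.ofLinearMap
    { toFun := fun a => (M.l a).restrict (p := LinearMap.range e.lin) (q := LinearMap.range e.lin)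
        (by rintro _ ⟨m, rfl⟩; exact ⟨M.l a m, by simp⟩)
      map_add' := fun _ _ => by ext; simp
      map_smul' := fun _ _ => by ext; simp }
    (by ext; simp) (fun _ _ => by ext; simp)
  r := AlgHom.ofLinearMap
    { toFun := fun b => (M.r b).restrict (p := LinearMap.range e.lin) (q := LinearMap.range e.lin)
        (by rintro _ ⟨m, rfl⟩; exact ⟨M.r b m, by simp⟩)
      map_add' := fun _ _ => by ext; simp
      map_smul' := fun _ _ => by ext; simp }
    (by ext; simp) (fun _ _ => by ext; simp)
  l_r a b x := Subtype.ext (M.l_r a b x)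

/-- The inclusion of the image of `e`. -/
def imageι {M : Bim k A} (e : M ⟶ M) : image e ⟶ M where
  lin := Submodule.subtype _
  map_l _ _ := rfl
  map_r _ _ := rfl

/-- The corestriction of `e` to its image. -/
def imageπ {M : Bim k A} (e : M ⟶ M) : M ⟶ image e where
  lin := LinearMap.rangeRestrict e.lin
  map_l a m := Subtype.ext (e.map_l a m)
  map_r b m := Subtype.ext (e.map_r b m)

theorem imageπ_ι {M : Bim k A} (e : M ⟶ M) : imageπ e ≫ imageι e = e := rfl

theorem imageι_π {M : Bim k A} (e : M ⟶ M) (he : e ≫ e = e) : imageι e ≫ imageπ e = 𝟙 _ := by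
  refine hom_ext (LinearMap.ext ?_)
  rintro ⟨_, m, rfl⟩
  exact Subtype.ext (LinearMap.congr_fun (congrArg Hom.lin he) m)

end Bim

section XA

open Bim Idempotents

variable {k A : Type u} [Field k] [Ring A] [Algebra k A] [Module.Finite k A]
  {G : Type u} [Group G] [Fintype G] [DecidableEq G] (σ : G →* (A ≃ₐ[k] A))

instance : (thetaSkew σ).Faithful where
  map_injective h := thetaMap_injective h

/-- The tensor product `⊗^G` on `𝒳_A` with its associator, the object `(A, π₁)` with its unitors,
and the comparison isomorphisms `Θ(M) ⊗_A Θ(N) ≅ Θ(M ⊗^G N)`. -/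
def skewTensor [NeZero (Nat.card G : k)] : TensorData (thetaSkew σ) where
  obj := Skew.tensor
  map := Skew.tensorMap
  assoc M N K := ⟨assocSkew M N K, assocSkewInv M N K, assocSkew_hom_inv M N K,
    assocSkew_inv_hom M N K⟩
  unit := ⟨reg k A⟩
  idem := unitIdem σ
  lun := lunit
  lunInv := lunitInv
  run := runit
  runInv := runitInv
  J M N := jIso M.base N.base
  fold := foldHom σ
  spread := spreadHom σ
  J_map := thetaMap_tensorMap
  J_assoc := thetaMap_assocSkew
  spread_fold := spreadHom_foldHom σ
  fold_spread := (thetaMap_unitIdem σ).symm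
  J_lun := thetaMap_lunit
  map_lunInv := thetaMap_lunitInv
  J_run := thetaMap_runit
  map_runInv := thetaMap_runitInv

theorem theta_idem (P : Karoubi (Skew σ)) : thetaMap P.p ≫ thetaMap P.p = thetaMap P.p := by
  rw [← thetaMap_comp, P.idem]

/-- The images `Θ(e) Θ(M)`. -/
def skewImage : ImageData (thetaSkew σ) where
  im P := image (thetaMap P.p)
  ι P := imageι (thetaMap P.p)
  π P := imageπ (thetaMap P.p)
  ι_π P := imageι_π (thetaMap P.p) (theta_idem σ P)
  π_ι P := imageπ_ι (thetaMap P.p)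

/-- The bicategory `X_A` has one object; as a monoidal category, it is the idempotent completion
of `𝒳_A` with the tensor product `⊗^G` and the unit object `(A, π₁)`. -/
abbrev XA : Type (u + 1) := Karoubi (Skew σ)

/-- `Θ : X_A → B_A`, `(M, e) ↦ Θ(e) (⨁_g M^g)`. -/
def Theta : XA σ ⥤ Bim k A := (skewImage σ).functor

instance : (Theta σ).Faithful := inferInstanceAs (skewImage σ).functor.Faithful

variable [NeZero (Nat.card G : k)]

instance : MonoidalCategoryStruct (XA σ) := (skewTensor σ).monoidalStruct

/-- `Θ` preserves the tensor structures. -/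
def thetaData : Monoidal.InducingFunctorData (Theta σ) := (skewImage σ).inducing (skewTensor σ)

instance : MonoidalCategory (XA σ) := Monoidal.induced (Theta σ) (thetaData σ)

/-- `Θ` is a pseudofunctor. -/
instance : (Theta σ).Monoidal := Monoidal.fromInducedMonoidal (Theta σ) (thetaData σ)

end XA

/-! ### The bicategory `Rep_A` -/

section Act

variable {k A B C V W U V' W' : Type u} [Field k] [Ring A] [Algebra k A] [Ring B] [Algebra k B] [Ring C] [Algebra k C]
  [AddCommGroup V] [Module k V] [AddCommGroup W] [Module k W] [AddCommGroup U] [Module k U]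
  [AddCommGroup V'] [Module k V'] [AddCommGroup W'] [Module k W']

/-- The action of `A ⊗ B` on `V ⊗ W`. -/
def act₂ (ρ : A →ₐ[k] Module.End k V) (τ : B →ₐ[k] Module.End k W) :
    A ⊗[k] B →ₐ[k] Module.End k (V ⊗[k] W) :=
  Module.endTensorEndAlgHom.comp (Algebra.TensorProduct.map ρ τ)

@[simp] theorem act₂_tmul (ρ : A →ₐ[k] Module.End k V) (τ : B →ₐ[k] Module.End k W) (a : A)
    (b : B) (v : V) (w : W) : act₂ ρ τ (a ⊗ₜ b) (v ⊗ₜ w) = ρ a v ⊗ₜ τ b w := rfl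

theorem act₂_nat {ρ : A →ₐ[k] Module.End k V} {τ : B →ₐ[k] Module.End k W}
    {ρ' : A →ₐ[k] Module.End k V'} {τ' : B →ₐ[k] Module.End k W'}
    (f : V →ₗ[k] V') (g : W →ₗ[k] W') (hf : ∀ a v, f (ρ a v) = ρ' a (f v))
    (hg : ∀ a v, g (τ a v) = τ' a (g v)) (t : A ⊗[k] B) (z : V ⊗[k] W) :
    TensorProduct.map f g (act₂ ρ τ t z) = act₂ ρ' τ' t (TensorProduct.map f g z) := by
  induction t with
  | zero => simp
  | add x y hx hy => simp only [map_add, LinearMap.add_apply, hx, hy]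
  | tmul a b =>
    induction z with
    | zero => simp
    | add x y hx hy => simp only [map_add, hx, hy]
    | tmul v w => simp [hf, hg]

theorem act₂_assoc (ρ : A →ₐ[k] Module.End k V) (τ : B →ₐ[k] Module.End k W)
    (κ : C →ₐ[k] Module.End k U) (s : (A ⊗[k] B) ⊗[k] C) (z : (V ⊗[k] W) ⊗[k] U) :
    TensorProduct.assoc k V W U (act₂ (act₂ ρ τ) κ s z) =
      act₂ ρ (act₂ τ κ) (TensorProduct.assoc k A B C s) (TensorProduct.assoc k V W U z) := by
  induction s with
  | zero => simp
  | add x y hx hy => simp only [map_add, LinearMap.add_apply, hx, hy]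
  | tmul s c =>
    induction s with
    | zero => simp
    | add x y hx hy => simp only [map_add, LinearMap.add_apply, TensorProduct.add_tmul, hx, hy]
    | tmul a b =>
      induction z with
      | zero => simp
      | add x y hx hy => simp only [map_add, hx, hy]
      | tmul z u =>
        induction z with
        | zero => simp
        | add x y hx hy => simp only [map_add, TensorProduct.add_tmul, hx, hy]
        | tmul v w => simp

end Act

section ActComul

variable {k A V W U : Type u} [Field k] [Ring A] [HopfAlgebra k A]
  [AddCommGroup V] [Module k V] [AddCommGroup W] [Module k W] [AddCommGroup U] [Module k U]

/-- The action of `A` on `V ⊗ W` through the comultiplication. -/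
def actComul (ρ : A →ₐ[k] Module.End k V) (τ : A →ₐ[k] Module.End k W) :
    A →ₐ[k] Module.End k (V ⊗[k] W) :=
  (act₂ ρ τ).comp (Bialgebra.comulAlgHom k A)

theorem actComul_apply (ρ : A →ₐ[k] Module.End k V) (τ : A →ₐ[k] Module.End k W) (a : A)
    (z : V ⊗[k] W) : actComul ρ τ a z = act₂ ρ τ (Coalgebra.comul a) z := rfl

theorem act₂_comul_left (ρ : A →ₐ[k] Module.End k V) (τ : A →ₐ[k] Module.End k W)
    (κ : A →ₐ[k] Module.End k U) (t : A ⊗[k] A) (z : (V ⊗[k] W) ⊗[k] U) :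
    act₂ (actComul ρ τ) κ t z = act₂ (act₂ ρ τ) κ (Coalgebra.comul.rTensor A t) z := by
  induction t with
  | zero => simp
  | add x y hx hy => simp only [map_add, LinearMap.add_apply, hx, hy]
  | tmul a b =>
    induction z with
    | zero => simp
    | add x y hx hy => simp only [map_add, hx, hy]
    | tmul v w => rfl

theorem act₂_comul_right (ρ : A →ₐ[k] Module.End k V) (τ : A →ₐ[k] Module.End k W)
    (κ : A →ₐ[k] Module.End k U) (t : A ⊗[k] A) (z : U ⊗[k] (V ⊗[k] W)) :
    act₂ κ (actComul ρ τ) t z = act₂ κ (act₂ ρ τ) (Coalgebra.comul.lTensor A t) z := by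
  induction t with
  | zero => simp
  | add x y hx hy => simp only [map_add, LinearMap.add_apply, hx, hy]
  | tmul a b =>
    induction z with
    | zero => simp
    | add x y hx hy => simp only [map_add, hx, hy]
    | tmul v w => rfl

theorem actComul_assoc (ρ : A →ₐ[k] Module.End k V) (τ : A →ₐ[k] Module.End k W)
    (κ : A →ₐ[k] Module.End k U) (a : A) (z : (V ⊗[k] W) ⊗[k] U) :
    TensorProduct.assoc k V W U (actComul (actComul ρ τ) κ a z) =
      actComul ρ (actComul τ κ) a (TensorProduct.assoc k V W U z) := by
  rw [actComul_apply, actComul_apply, act₂_comul_left, act₂_assoc, Coalgebra.coassoc_apply,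
    act₂_comul_right]

variable (k A) in
/-- The trivial action of `A` on `k`, through the counit. -/
def actCounit : A →ₐ[k] Module.End k k := (Algebra.lmul k k).comp (Bialgebra.counitAlgHom k A)

@[simp] theorem actCounit_apply (a : A) (c : k) :
    actCounit k A a c = Coalgebra.counit (R := k) a * c := rfl

theorem actComul_counit_left (ρ : A →ₐ[k] Module.End k V) (a : A) (z : k ⊗[k] V) :
    TensorProduct.lid k V (actComul (actCounit k A) ρ a z) = ρ a (TensorProduct.lid k V z) := by
  have e : ∀ (t : A ⊗[k] A), TensorProduct.lid k V (act₂ (actCounit k A) ρ t z) =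
      ρ (TensorProduct.lid k A (Coalgebra.counit.rTensor A t)) (TensorProduct.lid k V z) := by
    intro t
    induction t with
    | zero => simp
    | add x y hx hy => simp only [map_add, LinearMap.add_apply, hx, hy]
    | tmul a b =>
      induction z with
      | zero => simp
      | add x y hx hy => simp only [map_add, hx, hy]
      | tmul v w => simp [mul_smul, smul_comm v]
  rw [actComul_apply, e, Coalgebra.rTensor_counit_comul, TensorProduct.lid_tmul, one_smul]

theorem actComul_counit_right (ρ : A →ₐ[k] Module.End k V) (a : A) (z : V ⊗[k] k) :
    TensorProduct.rid k V (actComul ρ (actCounit k A) a z) = ρ a (TensorProduct.rid k V z) := by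
  have e : ∀ (t : A ⊗[k] A), TensorProduct.rid k V (act₂ ρ (actCounit k A) t z) =
      ρ (TensorProduct.rid k A (Coalgebra.counit.lTensor A t)) (TensorProduct.rid k V z) := by
    intro t
    induction t with
    | zero => simp
    | add x y hx hy => simp only [map_add, LinearMap.add_apply, hx, hy]
    | tmul a b =>
      induction z with
      | zero => simp
      | add x y hx hy => simp only [map_add, hx, hy]
      | tmul v w => simp [mul_smul, smul_comm w]
  rw [actComul_apply, e, Coalgebra.lTensor_counit_comul, TensorProduct.rid_tmul, one_smul]

end ActComul

section RepDef

variable (k A : Type u) [Field k] [Ring A] [HopfAlgebra k A]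

/-- A finite-dimensional `A`-module: `ρ a m = a · m`. -/
structure RepA where
  carrier : Type u
  [addCommGroup : AddCommGroup carrier]
  [module : Module k carrier]
  [finite : Module.Finite k carrier]
  ρ : A →ₐ[k] Module.End k carrier

attribute [instance] RepA.addCommGroup RepA.module RepA.finite

namespace RepA

variable {k A}

/-- Homomorphisms of `A`-modules. -/
@[ext]
structure Hom (M N : RepA k A) where
  lin : M.carrier →ₗ[k] N.carrier
  map_ρ : ∀ a m, lin (M.ρ a m) = N.ρ a (lin m)

attribute [simp] Hom.map_ρ

instance : Category (RepA k A) where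
  Hom := Hom
  id M := ⟨LinearMap.id, fun _ _ => rfl⟩
  comp f g := ⟨g.lin ∘ₗ f.lin, fun _ _ => by simp⟩

@[ext] theorem hom_ext {M N : RepA k A} {f g : M ⟶ N} (h : f.lin = g.lin) : f = g := Hom.ext h

@[simp] theorem id_lin (M : RepA k A) : Hom.lin (𝟙 M) = LinearMap.id := rfl

@[simp] theorem comp_lin {M N K : RepA k A} (f : M ⟶ N) (g : N ⟶ K) :
    (f ≫ g).lin = g.lin ∘ₗ f.lin := rfl

@[simp] theorem hom_ρ {M N : RepA k A} (f : M ⟶ N) (a : A) (m : M.carrier) :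
    f.lin (M.ρ a m) = N.ρ a (f.lin m) := f.map_ρ a m

instance (M N : RepA k A) : Add (M ⟶ N) where
  add f g := ⟨f.lin + g.lin, fun _ _ => by simp⟩

instance (M N : RepA k A) : Zero (M ⟶ N) where
  zero := ⟨0, fun _ _ => by simp⟩

instance (M N : RepA k A) : Neg (M ⟶ N) where
  neg f := ⟨- f.lin, fun _ _ => by simp⟩

@[simp] theorem add_lin {M N : RepA k A} (f g : M ⟶ N) : (f + g).lin = f.lin + g.lin := rfl

@[simp] theorem zero_lin {M N : RepA k A} : Hom.lin (0 : M ⟶ N) = 0 := rfl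

@[simp] theorem neg_lin {M N : RepA k A} (f : M ⟶ N) : (- f).lin = - f.lin := rfl

instance : Preadditive (RepA k A) where
  homGroup M N :=
    { add_assoc := fun _ _ _ => by ext; simp [add_assoc]
      zero_add := fun _ => by ext; simp
      add_zero := fun _ => by ext; simp
      nsmul := nsmulRec
      zsmul := zsmulRec
      neg_add_cancel := fun _ => by ext; simp
      add_comm := fun _ _ => by ext; simp [add_comm] }
  add_comp _ _ _ _ _ _ := by ext; simp
  comp_add _ _ _ _ _ _ := by ext; simp

/-- The tensor product over `k`, on which `A` acts through the comultiplication. -/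
def tensor (M N : RepA k A) : RepA k A where
  carrier := M.carrier ⊗[k] N.carrier
  ρ := actComul M.ρ N.ρ

variable (k A) in
/-- The trivial module, on which `A` acts through the counit. -/
def triv : RepA k A where
  carrier := k
  ρ := actCounit k A

variable (k A) in
/-- The regular module. -/
def reg [Module.Finite k A] : RepA k A where
  carrier := A
  ρ := Algebra.lmul k A

/-- The tensor product of homomorphisms. -/
def tensorMap {M N M' N' : RepA k A} (f : M ⟶ M') (g : N ⟶ N') : M.tensor N ⟶ M'.tensor N' where
  lin := TensorProduct.map f.lin g.lin
  map_ρ a z := act₂_nat f.lin g.lin f.map_ρ g.map_ρ _ z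

/-- The associator `(m ⊗ n) ⊗ x ↦ m ⊗ (n ⊗ x)`. -/
def assocHom (M N K : RepA k A) : (M.tensor N).tensor K ⟶ M.tensor (N.tensor K) where
  lin := (TensorProduct.assoc k M.carrier N.carrier K.carrier).toLinearMap
  map_ρ := actComul_assoc M.ρ N.ρ K.ρ

/-- A homomorphism of modules with a linear inverse is an isomorphism. -/
def isoOfEquiv {M N : RepA k A} (f : M ⟶ N) (e : M.carrier ≃ₗ[k] N.carrier)
    (h : f.lin = e.toLinearMap) : M ≅ N where
  hom := f
  inv :=
    { lin := e.symm.toLinearMap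
      map_ρ := fun a n => by
        have h' : ∀ m, f.lin m = e m := fun m => LinearMap.congr_fun h m
        apply e.injective
        have h₁ := f.map_ρ a (e.symm n)
        simp only [h', LinearEquiv.apply_symm_apply] at h₁
        simpa using h₁.symm }
  hom_inv_id := hom_ext (LinearMap.ext fun m =>
    (congrArg e.symm (LinearMap.congr_fun h m)).trans (e.symm_apply_apply m))
  inv_hom_id := hom_ext (LinearMap.ext fun n =>
    (LinearMap.congr_fun h (e.symm n)).trans (e.apply_symm_apply n))

/-- The left unitor `c ⊗ m ↦ c m`. -/
def leftHom (M : RepA k A) : (triv k A).tensor M ⟶ M where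
  lin := (TensorProduct.lid k M.carrier).toLinearMap
  map_ρ := actComul_counit_left M.ρ

/-- The right unitor `m ⊗ c ↦ c m`. -/
def rightHom (M : RepA k A) : M.tensor (triv k A) ⟶ M where
  lin := (TensorProduct.rid k M.carrier).toLinearMap
  map_ρ := actComul_counit_right M.ρ

/-- The bicategory `Rep_A` has one object, so it is the monoidal category of `A`-modules. -/
instance : MonoidalCategoryStruct (RepA k A) where
  tensorObj := tensor
  whiskerLeft M _ _ f := tensorMap (𝟙 M) f
  whiskerRight f N := tensorMap f (𝟙 N)
  tensorHom := tensorMap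
  tensorUnit := triv k A
  associator M N K := isoOfEquiv (assocHom M N K) (TensorProduct.assoc k _ _ _) rfl
  leftUnitor M := isoOfEquiv (leftHom M) (TensorProduct.lid k _) rfl
  rightUnitor M := isoOfEquiv (rightHom M) (TensorProduct.rid k _) rfl

theorem ten_ext {M N : RepA k A} {P : Type u} [AddCommGroup P] [Module k P]
    {f g : (M.tensor N).carrier →ₗ[k] P} (h : ∀ m n, f (m ⊗ₜ[k] n) = g (m ⊗ₜ[k] n)) : f = g :=
  TensorProduct.ext (LinearMap.ext fun m => LinearMap.ext fun n => h m n)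

theorem ten_ext_left {M N K : RepA k A} {P : Type u} [AddCommGroup P] [Module k P]
    {f g : ((M.tensor N).tensor K).carrier →ₗ[k] P}
    (h : ∀ m n x, f ((m ⊗ₜ[k] n) ⊗ₜ[k] x) = g ((m ⊗ₜ[k] n) ⊗ₜ[k] x)) : f = g :=
  TensorProduct.ext (TensorProduct.ext
    (LinearMap.ext fun m => LinearMap.ext fun n => LinearMap.ext fun x => h m n x))

theorem ten_ext_four {M N K L : RepA k A} {P : Type u} [AddCommGroup P] [Module k P]
    {f g : (((M.tensor N).tensor K).tensor L).carrier →ₗ[k] P}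
    (h : ∀ m n x y, f (((m ⊗ₜ[k] n) ⊗ₜ[k] x) ⊗ₜ[k] y) = g (((m ⊗ₜ[k] n) ⊗ₜ[k] x) ⊗ₜ[k] y)) :
    f = g :=
  TensorProduct.ext (TensorProduct.ext (TensorProduct.ext
    (LinearMap.ext fun m => LinearMap.ext fun n => LinearMap.ext fun x => LinearMap.ext fun y =>
      h m n x y)))

instance : MonoidalCategory (RepA k A) where
  tensorHom_def f g := hom_ext (ten_ext fun _ _ => rfl)
  id_tensorHom_id M N := hom_ext (ten_ext fun _ _ => rfl)
  tensorHom_comp_tensorHom f g h i := hom_ext (ten_ext fun _ _ => rfl)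
  whiskerLeft_id M N := hom_ext (ten_ext fun _ _ => rfl)
  id_whiskerRight M N := hom_ext (ten_ext fun _ _ => rfl)
  associator_naturality f g h := hom_ext (ten_ext_left fun _ _ _ => rfl)
  leftUnitor_naturality f := hom_ext (ten_ext fun (c : k) m => (map_smul f.lin c m).symm)
  rightUnitor_naturality f := hom_ext (ten_ext fun m (c : k) => (map_smul f.lin c m).symm)
  pentagon M N K L := hom_ext (ten_ext_four fun _ _ _ _ => rfl)
  triangle M N := hom_ext (ten_ext_left fun m (c : k) n =>
    (TensorProduct.smul_tmul c m n).symm)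

end RepA

end RepDef

/-! ### The pseudofunctor `Γ` -/

section GammaRaw

variable {k A V : Type u} [Field k] [Ring A] [HopfAlgebra k A] [AddCommGroup V] [Module k V]

variable (k A) in
/-- The homomorphism `φ : A → A ⊗ Aᵒᵖ`, `a ↦ a₁ ⊗ S(a₂)`. -/
def phi : A →ₐ[k] A ⊗[k] Aᵐᵒᵖ :=
  (Algebra.TensorProduct.map (AlgHom.id k A) (HopfAlgebra.antipodeAlgHomOp k A)).comp
    (Bialgebra.comulAlgHom k A)

variable (k A) in
/-- The right action of `A` on `A ⊗ Aᵒᵖ` through `φ`. -/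
def phiRight : Aᵐᵒᵖ →ₐ[k] Module.End k (A ⊗[k] Aᵐᵒᵖ) :=
  AlgHom.ofLinearMap
    { toFun := fun a => LinearMap.mulRight k (phi k A a.unop)
      map_add' := fun x y => by
        rw [show unop (x + y) = unop x + unop y from rfl, map_add]
        exact LinearMap.ext fun z => mul_add z _ _
      map_smul' := fun c x => by
        rw [show unop (c • x) = c • unop x from rfl, map_smul]
        exact LinearMap.ext fun z => mul_smul_comm c z _ }
    (LinearMap.ext fun z => (congrArg (z * ·) (map_one (phi k A))).trans (mul_one z))
    (fun x y => LinearMap.ext fun z =>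
      (congrArg (z * ·) (map_mul (phi k A) y.unop x.unop)).trans (mul_assoc z _ _).symm)

@[simp] theorem phiRight_apply (a : A) (z : A ⊗[k] Aᵐᵒᵖ) :
    phiRight k A (op a) z = z * phi k A a := rfl

/-- The bilinear map `(x, z) ↦ x · (v ⊗ S(z) b)`. -/
def leftBil (ρ : A →ₐ[k] Module.End k V) (v : V) (b : A) : A →ₗ[k] A →ₗ[k] V ⊗[k] A :=
  LinearMap.mk₂ k (fun x z => actComul ρ (Algebra.lmul k A) x
    (v ⊗ₜ[k] (HopfAlgebra.antipode k z * b)))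
    (fun _ _ _ => by simp) (fun _ _ _ => by simp)
    (fun _ _ _ => by simp [add_mul, TensorProduct.tmul_add]) (fun _ _ _ => by simp)

theorem leftBil_apply (ρ : A →ₐ[k] Module.End k V) (v : V) (b x z : A) :
    leftBil ρ v b x z = actComul ρ (Algebra.lmul k A) x
      (v ⊗ₜ[k] (HopfAlgebra.antipode k z * b)) := rfl

/-- The bilinear map `(x, z) ↦ (1 ⊗ z b) φ(x)`. -/
def rightBil (b : A) : A →ₗ[k] A →ₗ[k] A ⊗[k] Aᵐᵒᵖ :=
  LinearMap.mk₂ k (fun x z => ((1 : A) ⊗ₜ[k] op (z * b)) * phi k A x)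
    (fun _ _ _ => by rw [map_add, mul_add])
    (fun _ _ _ => by rw [map_smul]; exact mul_smul_comm _ _ _)
    (fun _ _ _ => by rw [add_mul, MulOpposite.op_add, TensorProduct.tmul_add, add_mul])
    (fun _ _ _ => by
      rw [smul_mul_assoc, MulOpposite.op_smul, TensorProduct.tmul_smul]; exact smul_mul_assoc _ _ _)

theorem rightBil_apply (b x z : A) :
    rightBil (k := k) b x z = ((1 : A) ⊗ₜ[k] op (z * b)) * phi k A x := rfl

theorem tripleLeft (ρ : A →ₐ[k] Module.End k V) (v : V) (b : A) (t : A ⊗[k] A) :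
    TensorProduct.lift (leftBil ρ v b) t =
      TensorProduct.map ((LinearMap.flip ρ.toLinearMap) v)
        (LinearMap.mulRight k b ∘ₗ LinearMap.mul' k A ∘ₗ (HopfAlgebra.antipode k).lTensor A)
        (TensorProduct.assoc k A A A (Coalgebra.comul.rTensor A t)) := by
  induction t with
  | zero => simp
  | add x y hx hy => simp only [map_add, hx, hy]
  | tmul x z =>
    simp only [TensorProduct.lift.tmul, leftBil_apply, actComul_apply,
      LinearMap.rTensor_tmul]
    induction Coalgebra.comul (R := k) x with
    | zero => simp
    | add x y hx hy => simp only [map_add, LinearMap.add_apply, TensorProduct.add_tmul, hx, hy]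
    | tmul x y => simp [mul_assoc]

theorem tripleLeft' (ρ : A →ₐ[k] Module.End k V) (v : V) (b : A) (t : A ⊗[k] A) :
    TensorProduct.map ((LinearMap.flip ρ.toLinearMap) v)
        (LinearMap.mulRight k b ∘ₗ LinearMap.mul' k A ∘ₗ (HopfAlgebra.antipode k).lTensor A)
        (Coalgebra.comul.lTensor A t) =
      ρ (TensorProduct.rid k A (Coalgebra.counit.lTensor A t)) v ⊗ₜ b := by
  induction t with
  | zero => simp
  | add x y hx hy => simp only [map_add, hx, hy, LinearMap.add_apply, TensorProduct.add_tmul]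
  | tmul x y =>
    simp only [LinearMap.lTensor_tmul, TensorProduct.map_tmul, LinearMap.comp_apply,
      HopfAlgebra.mul_antipode_lTensor_comul_apply]
    simp [Algebra.algebraMap_eq_smul_one, TensorProduct.smul_tmul']

/-- `Σ c₁ v ⊗ c₂ S(c₃) b = c v ⊗ b`. -/
theorem tripleEq (ρ : A →ₐ[k] Module.End k V) (v : V) (b c : A) :
    TensorProduct.lift (leftBil ρ v b)
      (Coalgebra.comul c) = ρ c v ⊗ₜ[k] b := by
  rw [tripleLeft, Coalgebra.coassoc_apply, tripleLeft', Coalgebra.lTensor_counit_comul,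
    TensorProduct.rid_tmul, one_smul]

/-- The map `(A ⊗ Aᵒᵖ) × V → V ⊗ A`, `(a ⊗ b, v) ↦ a · (v ⊗ b)`. -/
def straightBil (ρ : A →ₐ[k] Module.End k V) :
    A ⊗[k] Aᵐᵒᵖ →ₗ[k] V →ₗ[k] V ⊗[k] A :=
  TensorProduct.lift (LinearMap.mk₂ k
    (fun a b => actComul ρ (Algebra.lmul k A) a ∘ₗ (TensorProduct.mk k V A).flip b.unop)
    (fun _ _ _ => by simp [LinearMap.add_comp]) (fun _ _ _ => by simp [LinearMap.smul_comp])
    (fun _ _ _ => by ext; simp [TensorProduct.tmul_add]) (fun _ _ _ => by ext; simp))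

@[simp] theorem straightBil_tmul (ρ : A →ₐ[k] Module.End k V) (a b : A) (v : V) :
    straightBil ρ (a ⊗ₜ op b) v = actComul ρ (Algebra.lmul k A) a (v ⊗ₜ b) := rfl

theorem straightBil_mul (ρ : A →ₐ[k] Module.End k V) (a b : A) (t : A ⊗[k] A) (v : V) :
    straightBil ρ (a ⊗ₜ op b * (Algebra.TensorProduct.map (AlgHom.id k A)
        (HopfAlgebra.antipodeAlgHomOp k A)) t) v =
      actComul ρ (Algebra.lmul k A) a
      (TensorProduct.lift (leftBil ρ v b) t) := by
  induction t with
  | zero => simp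
  | add x y hx hy => simp only [map_add, mul_add, LinearMap.add_apply, hx, hy]
  | tmul x z =>
    have : (HopfAlgebra.antipodeAlgHomOp k A z) = op (HopfAlgebra.antipode k z) := rfl
    simp [this, ← op_mul, leftBil_apply]

theorem straightBil_bal (ρ : A →ₐ[k] Module.End k V) (c : A) (z : A ⊗[k] Aᵐᵒᵖ) (v : V) :
    straightBil ρ (phiRight k A (op c) z) v = straightBil ρ z (ρ c v) := by
  induction z with
  | zero => simp
  | add x y hx hy => simp only [map_add, LinearMap.add_apply, hx, hy]
  | tmul a b =>
    obtain ⟨b, rfl⟩ := op_surjective b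
    exact (straightBil_mul ρ a b _ v).trans (congrArg _ (tripleEq ρ v b c))

theorem tripleRight (b : A) (t : A ⊗[k] A) :
    TensorProduct.lift (rightBil (k := k) b) t =
      TensorProduct.map LinearMap.id
        ((opLinearEquiv k).toLinearMap ∘ₗ LinearMap.mulRight k b ∘ₗ LinearMap.mul' k A ∘ₗ
          (HopfAlgebra.antipode k).rTensor A)
        (TensorProduct.assoc k A A A (Coalgebra.comul.rTensor A t)) := by
  induction t with
  | zero => simp
  | add x y hx hy => simp only [map_add, hx, hy]
  | tmul x z =>
    simp only [TensorProduct.lift.tmul, rightBil_apply, phi, AlgHom.comp_apply,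
      Bialgebra.comulAlgHom_apply, LinearMap.rTensor_tmul]
    induction Coalgebra.comul (R := k) x with
    | zero => simp
    | add x y hx hy => simp only [map_add, mul_add, TensorProduct.add_tmul, hx, hy]
    | tmul x y =>
      have : (HopfAlgebra.antipodeAlgHomOp k A y) = op (HopfAlgebra.antipode k y) := rfl
      simp [this, ← op_mul, mul_assoc]

theorem tripleRight' (b : A) (t : A ⊗[k] A) :
    TensorProduct.map LinearMap.id
        ((opLinearEquiv k).toLinearMap ∘ₗ LinearMap.mulRight k b ∘ₗ LinearMap.mul' k A ∘ₗ
          (HopfAlgebra.antipode k).rTensor A)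
        (Coalgebra.comul.lTensor A t) =
      (TensorProduct.rid k A (Coalgebra.counit.lTensor A t)) ⊗ₜ op b := by
  induction t with
  | zero => simp
  | add x y hx hy => simp only [map_add, hx, hy, TensorProduct.add_tmul]
  | tmul x y =>
    simp only [LinearMap.lTensor_tmul, TensorProduct.map_tmul, LinearMap.comp_apply,
      HopfAlgebra.mul_antipode_rTensor_comul_apply]
    simp [Algebra.algebraMap_eq_smul_one, TensorProduct.smul_tmul']

/-- `Σ (1 ⊗ c₂ b) φ(c₁) = c ⊗ b`. -/
theorem tripleEq' (b c : A) :
    TensorProduct.lift (rightBil (k := k) b)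
      (Coalgebra.comul c) = c ⊗ₜ op b := by
  rw [tripleRight, Coalgebra.coassoc_apply, tripleRight', Coalgebra.lTensor_counit_comul,
    TensorProduct.rid_tmul, one_smul]

/-- The isomorphism `(A ⊗ Aᵒᵖ) ⊗_A V ≅ V ⊗ A`, `(a ⊗ b) ⊗ v ↦ a · (v ⊗ b)`. -/
def straight (ρ : A →ₐ[k] Module.End k V) : BT (phiRight k A) ρ →ₗ[k] V ⊗[k] A :=
  BT.lift (straightBil ρ) (straightBil_bal ρ)

/-- The inverse `v ⊗ b ↦ (1 ⊗ b) ⊗ v`. -/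
def straightInv (ρ : A →ₐ[k] Module.End k V) : V ⊗[k] A →ₗ[k] BT (phiRight k A) ρ :=
  TensorProduct.lift ((BT.mk (phiRight k A) ρ ∘ₗ (TensorProduct.mk k A Aᵐᵒᵖ 1) ∘ₗ
    (opLinearEquiv k).toLinearMap).flip)

theorem straightInv_tmul (ρ : A →ₐ[k] Module.End k V) (v : V) (b : A) :
    straightInv ρ (v ⊗ₜ b) = BT.mk (phiRight k A) ρ ((1 : A) ⊗ₜ op b) v := rfl

theorem straightInv_act₂ (ρ : A →ₐ[k] Module.End k V) (v : V) (b : A) (t : A ⊗[k] A) :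
    straightInv ρ (act₂ ρ (Algebra.lmul k A) t (v ⊗ₜ b)) =
      BT.mk (phiRight k A) ρ (TensorProduct.lift (rightBil (k := k) b) t) v := by
  induction t with
  | zero => simp
  | add x y hx hy => simp only [map_add, LinearMap.add_apply, hx, hy]
  | tmul x z =>
    exact (BT.mk_smul (phiRight k A) ρ x ((1 : A) ⊗ₜ op (z * b)) v).symm

theorem straight_straightInv (ρ : A →ₐ[k] Module.End k V) (z : V ⊗[k] A) :
    straight ρ (straightInv ρ z) = z := by
  induction z with
  | zero => simp
  | add x y hx hy => simp only [map_add, hx, hy]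
  | tmul v b =>
    exact LinearMap.congr_fun (map_one (actComul ρ (Algebra.lmul k A))) (v ⊗ₜ b)

theorem straightInv_straight (ρ : A →ₐ[k] Module.End k V) (z : BT (phiRight k A) ρ) :
    straightInv ρ (straight ρ z) = z := by
  induction z using BT.induction with
  | add x y hx hy => simp only [map_add, hx, hy]
  | mk z v =>
    induction z with
    | zero => simp
    | add x y hx hy => simp only [map_add, LinearMap.add_apply, hx, hy]
    | tmul a b =>
      obtain ⟨b, rfl⟩ := op_surjective b
      refine (straightInv_act₂ ρ v b (Coalgebra.comul a)).trans ?_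
      rw [tripleEq']

theorem actComul_right (ρ : A →ₐ[k] Module.End k V) (a : A) (b : Aᵐᵒᵖ) (z : V ⊗[k] A) :
    actComul ρ (Algebra.lmul k A) a (TensorProduct.map LinearMap.id (LinearMap.mulRight k b.unop) z)
      = TensorProduct.map LinearMap.id (LinearMap.mulRight k b.unop)
        (actComul ρ (Algebra.lmul k A) a z) :=
  (act₂_nat LinearMap.id (LinearMap.mulRight k b.unop) (fun _ _ => rfl)
    (fun x y => mul_assoc x y b.unop) _ z).symm

section

variable {W P : Type u} [AddCommGroup W] [Module k W] [AddCommGroup P] [Module k P]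

theorem split_act₂ (ρ : A →ₐ[k] Module.End k V) (τ : A →ₐ[k] Module.End k W)
    (T : V ⊗[k] A →ₗ[k] W ⊗[k] A →ₗ[k] P)
    (hT : ∀ v q z, T (v ⊗ₜ 1) (actComul τ (Algebra.lmul k A) q z) = T (v ⊗ₜ q) z)
    (t : A ⊗[k] A) (x : V) (z : W ⊗[k] A) :
    TensorProduct.lift (T ∘ₗ (TensorProduct.mk k V A).flip 1)
      (act₂ ρ (actComul τ (Algebra.lmul k A)) t (x ⊗ₜ[k] z)) =
      T (act₂ ρ (Algebra.lmul k A) t (x ⊗ₜ[k] (1 : A))) z := by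
  induction t with
  | zero => simp
  | add x y hx hy => simp only [map_add, LinearMap.add_apply, hx, hy]
  | tmul p q => simp [hT]

/-- The bilinear map `(x ⊗ p, z) ↦ x ⊗ p · z`. -/
def unsplitBil (τ : A →ₐ[k] Module.End k W) :
    V ⊗[k] A →ₗ[k] W ⊗[k] A →ₗ[k] V ⊗[k] (W ⊗[k] A) :=
  TensorProduct.lift (LinearMap.mk₂ k
      (fun x p => TensorProduct.mk k V (W ⊗[k] A) x ∘ₗ actComul τ (Algebra.lmul k A) p)
      (fun _ _ _ => by rw [map_add, LinearMap.add_comp])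
      (fun _ _ _ => by rw [map_smul, LinearMap.smul_comp])
      (fun _ _ _ => by rw [map_add, LinearMap.comp_add])
      (fun _ _ _ => by rw [map_smul, LinearMap.comp_smul]))

theorem unsplitBil_bal (τ : A →ₐ[k] Module.End k W) (a : A) (m : V ⊗[k] A) (n : W ⊗[k] A) :
    unsplitBil τ (TensorProduct.map LinearMap.id (LinearMap.mulRight k a) m) n =
      unsplitBil τ m (actComul τ (Algebra.lmul k A) a n) := by
  induction m with
  | zero => simp
  | add x y hx hy => simp only [map_add, LinearMap.add_apply, hx, hy]
  | tmul x p =>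
    refine congrArg (fun t => x ⊗ₜ[k] t) ?_
    exact LinearMap.congr_fun (map_mul (actComul τ (Algebra.lmul k A)) p a) n

end

end GammaRaw

section Gamma

variable {k A : Type u} [Field k] [Ring A] [HopfAlgebra k A] [Module.Finite k A]

/-- The bimodule `Γ(M) = (A ⊗ Aᵒᵖ) ⊗_A M`, where `A` acts on the right of `A ⊗ Aᵒᵖ` through `φ`,
and where `a · (x ⊗ y) · b = a x ⊗ y b` on `A ⊗ Aᵒᵖ`. -/
def gamma (M : RepA k A) : Bim k A where
  carrier := BT (phiRight k A) M.ρ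
  l := BT.actLeft (phiRight k A) M.ρ
    ((Algebra.lmul k (A ⊗[k] Aᵐᵒᵖ)).comp Algebra.TensorProduct.includeLeft)
    (fun x a z => (mul_assoc _ z (phi k A a)).symm)
  r := BT.actLeft (phiRight k A) M.ρ
    ((Algebra.lmul k (A ⊗[k] Aᵐᵒᵖ)).comp Algebra.TensorProduct.includeRight)
    (fun x a z => (mul_assoc _ z (phi k A a)).symm)
  l_r a b m := by
    induction m using BT.induction with
    | add x y hx hy => simp only [map_add, hx, hy]
    | mk z v =>
      refine congrArg (fun t => BT.mk (phiRight k A) M.ρ t v) ?_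
      change (a ⊗ₜ[k] (1 : Aᵐᵒᵖ)) * (((1 : A) ⊗ₜ[k] b) * z) =
        ((1 : A) ⊗ₜ[k] b) * ((a ⊗ₜ[k] (1 : Aᵐᵒᵖ)) * z)
      rw [← mul_assoc, ← mul_assoc]
      simp

/-- The elements `(a ⊗ b) ⊗ m` of `Γ(M)`. -/
def gmk (M : RepA k A) (a b : A) (m : M.carrier) : (gamma M).carrier :=
  BT.mk (phiRight k A) M.ρ (a ⊗ₜ op b) m

theorem gamma_l (M : RepA k A) (c a b : A) (m : M.carrier) :
    (gamma M).l c (gmk M a b m) = gmk M (c * a) b m := by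
  refine congrArg (fun t => BT.mk (phiRight k A) M.ρ t m) ?_
  change (c ⊗ₜ[k] (1 : Aᵐᵒᵖ)) * (a ⊗ₜ[k] op b) = _
  simp

theorem gmk_eq (M : RepA k A) (a b : A) (m : M.carrier) :
    gmk M a b m = (gamma M).l a (gmk M 1 b m) := by
  rw [gamma_l, mul_one]

theorem gamma_r (M : RepA k A) (c a b : A) (m : M.carrier) :
    (gamma M).r (op c) (gmk M a b m) = gmk M a (b * c) m := by
  refine congrArg (fun t => BT.mk (phiRight k A) M.ρ t m) ?_
  change ((1 : A) ⊗ₜ[k] op c) * (a ⊗ₜ[k] op b) = _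
  simp

/-- The homomorphism `Γ(f)`, `(a ⊗ b) ⊗ m ↦ (a ⊗ b) ⊗ f(m)`. -/
def gammaMap {M N : RepA k A} (f : M ⟶ N) : gamma M ⟶ gamma N where
  lin := BT.map (phiRight k A) N.ρ LinearMap.id f.lin (fun _ _ => rfl) f.map_ρ
  map_l a := LinearMap.congr_fun
    (f := BT.map (phiRight k A) N.ρ LinearMap.id f.lin (fun _ _ => rfl) f.map_ρ ∘ₗ (gamma M).l a)
    (g := (gamma N).l a ∘ₗ
      BT.map (phiRight k A) N.ρ LinearMap.id f.lin (fun _ _ => rfl) f.map_ρ)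
    (BT.ext fun _ _ => rfl)
  map_r b := LinearMap.congr_fun
    (f := BT.map (phiRight k A) N.ρ LinearMap.id f.lin (fun _ _ => rfl) f.map_ρ ∘ₗ (gamma M).r b)
    (g := (gamma N).r b ∘ₗ
      BT.map (phiRight k A) N.ρ LinearMap.id f.lin (fun _ _ => rfl) f.map_ρ)
    (BT.ext fun _ _ => rfl)

variable (k A) in
/-- `Γ : Rep_A → B_A`. -/
def Gamma : RepA k A ⥤ Bim k A where
  obj := gamma
  map := gammaMap
  map_id M := Bim.hom_ext (BT.ext fun _ _ => rfl)
  map_comp f g := Bim.hom_ext (BT.ext fun _ _ => rfl)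

/-! An isomorphic form of `Γ`, on `M ⊗ A`, used to see that `Γ` is a pseudofunctor. -/

/-- The bimodule `M ⊗ A` with diagonal left action. -/
def diag (M : RepA k A) : Bim k A where
  carrier := M.carrier ⊗[k] A
  l := actComul M.ρ (Algebra.lmul k A)
  r := AlgHom.ofLinearMap
    { toFun := fun b => TensorProduct.map LinearMap.id (LinearMap.mulRight k b.unop)
      map_add' := fun x y => by ext; simp [mul_add, TensorProduct.tmul_add]
      map_smul' := fun c x => by ext; simp }
    (by ext; simp) (fun x y => by ext; simp [mul_assoc])
  l_r a b z := actComul_right M.ρ a b z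

/-- `f ⊗ A` for a module homomorphism `f`. -/
def diagMap {M N : RepA k A} (f : M ⟶ N) : diag M ⟶ diag N where
  lin := TensorProduct.map f.lin LinearMap.id
  map_l a z := act₂_nat f.lin LinearMap.id f.map_ρ (fun _ _ => rfl) _ z
  map_r b z := LinearMap.congr_fun (f := TensorProduct.map f.lin LinearMap.id ∘ₗ
      TensorProduct.map LinearMap.id (LinearMap.mulRight k b.unop))
    (g := TensorProduct.map LinearMap.id (LinearMap.mulRight k b.unop) ∘ₗ
      TensorProduct.map f.lin LinearMap.id) (TensorProduct.ext rfl) z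

theorem diag_ext {M : RepA k A} {P : Type u} [AddCommGroup P] [Module k P]
    {f g : (diag M).carrier →ₗ[k] P}
    (h : ∀ m (b : A), f (m ⊗ₜ[k] b) = g (m ⊗ₜ[k] b)) : f = g :=
  TensorProduct.ext (LinearMap.ext fun m => LinearMap.ext fun b => h m b)

theorem diag_ext_tensor {M N : RepA k A} {P : Type u} [AddCommGroup P] [Module k P]
    {f g : (diag (M.tensor N)).carrier →ₗ[k] P}
    (h : ∀ m n (b : A), f ((m ⊗ₜ[k] n) ⊗ₜ[k] b) = g ((m ⊗ₜ[k] n) ⊗ₜ[k] b)) : f = g :=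
  TensorProduct.ext (TensorProduct.ext (LinearMap.ext fun m => LinearMap.ext fun n =>
    LinearMap.ext fun b => h m n b))

theorem diag_ext_left {M N K : RepA k A} {P : Type u} [AddCommGroup P] [Module k P]
    {f g : (diag ((M.tensor N).tensor K)).carrier →ₗ[k] P}
    (h : ∀ m n x (b : A), f (((m ⊗ₜ[k] n) ⊗ₜ[k] x) ⊗ₜ[k] b) =
      g (((m ⊗ₜ[k] n) ⊗ₜ[k] x) ⊗ₜ[k] b)) : f = g :=
  TensorProduct.ext (TensorProduct.ext (TensorProduct.ext (LinearMap.ext fun m =>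
    LinearMap.ext fun n => LinearMap.ext fun x => LinearMap.ext fun b => h m n x b)))

variable (k A) in
/-- The functor `M ↦ M ⊗ A`. -/
def Diag : RepA k A ⥤ Bim k A where
  obj := diag
  map := diagMap
  map_id M := Bim.hom_ext (diag_ext fun _ _ => rfl)
  map_comp f g := Bim.hom_ext (diag_ext fun _ _ => rfl)

/-- The map `x ⊗ z ↦ (x ⊗ 1) ⊗ z`. -/
def splitLin (M N : RepA k A) :
    M.carrier ⊗[k] (N.carrier ⊗[k] A) →ₗ[k] ((diag M).tensor (diag N)).carrier :=
  TensorProduct.lift (Bim.tmk (diag M) (diag N) ∘ₗ (TensorProduct.mk k M.carrier A).flip 1)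

theorem splitLin_tmul (M N : RepA k A) (x : M.carrier) (z : (diag N).carrier) :
    splitLin M N (x ⊗ₜ[k] z) = Bim.tmk (diag M) (diag N) (x ⊗ₜ[k] (1 : A)) z := rfl

theorem splitLin_act₂ (M N : RepA k A) (t : A ⊗[k] A) (x : M.carrier)
    (z : N.carrier ⊗[k] A) :
    splitLin M N (act₂ M.ρ (actComul N.ρ (Algebra.lmul k A)) t (x ⊗ₜ[k] z)) =
      Bim.tmk (diag M) (diag N) (act₂ M.ρ (Algebra.lmul k A) t (x ⊗ₜ[k] (1 : A))) z := by
  refine split_act₂ M.ρ N.ρ (Bim.tmk (diag M) (diag N)) (fun v q z => ?_) t x z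
  refine (Bim.tmk_bal (M := diag M) (N := diag N) q (v ⊗ₜ[k] (1 : A)) z).symm.trans ?_
  exact congrArg (fun b : A => Bim.tmk (diag M) (diag N) (v ⊗ₜ[k] b) z) (one_mul q)

/-- The comparison `(x ⊗ y) ⊗ b ↦ (x ⊗ 1) ⊗ (y ⊗ b)`. -/
def split (M N : RepA k A) : diag (M.tensor N) ⟶ (diag M).tensor (diag N) where
  lin := splitLin M N ∘ₗ (TensorProduct.assoc k M.carrier N.carrier A).toLinearMap
  map_l c z := by
    refine LinearMap.congr_fun
      (f := (splitLin M N ∘ₗ (TensorProduct.assoc k M.carrier N.carrier A).toLinearMap) ∘ₗ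
        actComul (actComul M.ρ N.ρ) (Algebra.lmul k A) c)
      (g := ((diag M).tensor (diag N)).l c ∘ₗ
        (splitLin M N ∘ₗ (TensorProduct.assoc k M.carrier N.carrier A).toLinearMap))
      (TensorProduct.ext (TensorProduct.ext (LinearMap.ext fun x => LinearMap.ext fun y =>
        LinearMap.ext fun b => ?_))) z
    refine (congrArg (splitLin M N) (actComul_assoc M.ρ N.ρ (Algebra.lmul k A) c
      ((x ⊗ₜ[k] y) ⊗ₜ[k] b))).trans ?_
    exact splitLin_act₂ M N (Coalgebra.comul c) x (y ⊗ₜ[k] b)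
  map_r c z := by
    refine LinearMap.congr_fun
      (f := (splitLin M N ∘ₗ (TensorProduct.assoc k M.carrier N.carrier A).toLinearMap) ∘ₗ
        TensorProduct.map LinearMap.id (LinearMap.mulRight k c.unop))
      (g := ((diag M).tensor (diag N)).r c ∘ₗ
        (splitLin M N ∘ₗ (TensorProduct.assoc k M.carrier N.carrier A).toLinearMap))
      (TensorProduct.ext (TensorProduct.ext (LinearMap.ext fun x => LinearMap.ext fun y =>
        LinearMap.ext fun b => ?_))) z
    rfl

theorem split_tmul (M N : RepA k A) (x : M.carrier) (y : N.carrier) (b : A) :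
    (split M N).lin ((x ⊗ₜ[k] y) ⊗ₜ[k] b) =
      Bim.tmk (diag M) (diag N) (x ⊗ₜ[k] (1 : A)) (y ⊗ₜ[k] b) := rfl

/-- The inverse `(x ⊗ p) ⊗ z ↦ x ⊗ p · z` of `split`. -/
def unsplit (M N : RepA k A) :
    ((diag M).tensor (diag N)).carrier →ₗ[k] (M.carrier ⊗[k] N.carrier) ⊗[k] A :=
  (TensorProduct.assoc k M.carrier N.carrier A).symm.toLinearMap ∘ₗ
    Bim.tlift (unsplitBil N.ρ) (unsplitBil_bal N.ρ)

theorem unsplit_tmul (M N : RepA k A) (x : M.carrier) (p : A) (z : (diag N).carrier) :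
    TensorProduct.assoc k M.carrier N.carrier A
      (unsplit M N (Bim.tmk (diag M) (diag N) (x ⊗ₜ[k] p) z)) =
      x ⊗ₜ[k] actComul N.ρ (Algebra.lmul k A) p z :=
  LinearEquiv.apply_symm_apply _ _

theorem unsplit_split (M N : RepA k A) : unsplit M N ∘ₗ (split M N).lin = LinearMap.id :=
  diag_ext_tensor fun x y b => (TensorProduct.assoc k M.carrier N.carrier A).injective
    ((unsplit_tmul M N x 1 (y ⊗ₜ[k] b)).trans (congrArg (fun t => x ⊗ₜ[k] t)
      (LinearMap.congr_fun (map_one (actComul N.ρ (Algebra.lmul k A))) (y ⊗ₜ[k] b))))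

theorem split_unsplit (M N : RepA k A) : (split M N).lin ∘ₗ unsplit M N = LinearMap.id := by
  refine Bim.t_ext_curry (TensorProduct.ext (LinearMap.ext fun x => LinearMap.ext fun p =>
    LinearMap.ext fun z => ?_))
  refine (congrArg (splitLin M N) (unsplit_tmul M N x p z)).trans ?_
  refine (Bim.tmk_bal (M := diag M) (N := diag N) p (x ⊗ₜ[k] (1 : A)) z).symm.trans ?_
  exact congrArg (fun b : A => Bim.tmk (diag M) (diag N) (x ⊗ₜ[k] b) z) (one_mul p)

/-- The isomorphism `k ⊗ A ≅ A`. -/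
def diagUnit : diag (RepA.triv k A) ⟶ Bim.reg k A where
  lin := (TensorProduct.lid k A).toLinearMap
  map_l := actComul_counit_left (Algebra.lmul k A)
  map_r b z := LinearMap.congr_fun
    (f := (TensorProduct.lid k A).toLinearMap ∘ₗ
      TensorProduct.map LinearMap.id (LinearMap.mulRight k b.unop))
    (g := LinearMap.mulRight k b.unop ∘ₗ (TensorProduct.lid k A).toLinearMap)
    (TensorProduct.ext (LinearMap.ext fun c => LinearMap.ext fun x =>
      (smul_mul_assoc c x b.unop).symm)) z

instance : (Diag k A).OplaxMonoidal where
  η := diagUnit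
  δ := split
  δ_natural_left f X' := Bim.hom_ext (diag_ext_tensor fun _ _ _ => rfl)
  δ_natural_right X' f := Bim.hom_ext (diag_ext_tensor fun _ _ _ => rfl)
  oplax_associativity X Y Z := Bim.hom_ext (diag_ext_left fun _ _ _ _ => rfl)
  oplax_left_unitality X := Bim.hom_ext (diag_ext fun m b =>
    congrArg (fun a : A => Bim.tmk (Bim.reg k A) (diag X) a (m ⊗ₜ[k] b)) (one_smul k (1 : A)).symm)
  oplax_right_unitality X := Bim.hom_ext (diag_ext fun m b => by
    refine Eq.trans ?_ ((Bim.tmk_bal (M := diag X) (N := Bim.reg k A) b (m ⊗ₜ[k] (1 : A))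
      (1 : A)).trans (congrArg (fun a : A => Bim.tmk (diag X) (Bim.reg k A) (m ⊗ₜ[k] (1 : A)) a)
        ((mul_one b).trans (one_smul k b).symm)))
    exact congrArg (fun a : A => Bim.tmk (diag X) (Bim.reg k A) (m ⊗ₜ[k] a) (1 : A))
      (one_mul b).symm)

instance (M N : RepA k A) : IsIso (Functor.OplaxMonoidal.δ (Diag k A) M N) :=
  (Bim.isoOfInv (split M N) (unsplit M N) (LinearMap.congr_fun (unsplit_split M N))
    (LinearMap.congr_fun (split_unsplit M N))).isIso_hom

instance : IsIso (Functor.OplaxMonoidal.η (Diag k A)) :=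
  (Bim.isoOfInv (diagUnit (k := k) (A := A)) (TensorProduct.lid k A).symm.toLinearMap
    (TensorProduct.lid k A).symm_apply_apply (TensorProduct.lid k A).apply_symm_apply).isIso_hom

instance : (Diag k A).Monoidal := Functor.Monoidal.ofOplaxMonoidal (Diag k A)

/-- The homomorphism `(a ⊗ b) ⊗ m ↦ a · (m ⊗ b)`. -/
def gammaDiagHom (M : RepA k A) : gamma M ⟶ diag M where
  lin := straight M.ρ
  map_l c := LinearMap.congr_fun
    (f := straight M.ρ ∘ₗ (gamma M).l c)
    (g := actComul M.ρ (Algebra.lmul k A) c ∘ₗ straight M.ρ)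
    (BT.ext_curry (TensorProduct.ext' fun a b => LinearMap.ext fun v => by
      obtain ⟨b, rfl⟩ := op_surjective b
      refine (congrArg (straight M.ρ) (gamma_l M c a b v)).trans ?_
      exact LinearMap.congr_fun (map_mul (actComul M.ρ (Algebra.lmul k A)) c a) (v ⊗ₜ[k] b)))
  map_r c := LinearMap.congr_fun
    (f := straight M.ρ ∘ₗ (gamma M).r c)
    (g := TensorProduct.map LinearMap.id (LinearMap.mulRight k c.unop) ∘ₗ straight M.ρ)
    (BT.ext_curry (TensorProduct.ext' fun a b => LinearMap.ext fun v => by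
      obtain ⟨b, rfl⟩ := op_surjective b
      refine (congrArg (straight M.ρ) (gamma_r M c.unop a b v)).trans ?_
      exact actComul_right M.ρ a c (v ⊗ₜ[k] b)))

/-- The isomorphism `Γ(M) ≅ M ⊗ A`. -/
def gammaDiag : Gamma k A ≅ Diag k A :=
  NatIso.ofComponents
    (fun M => Bim.isoOfInv (gammaDiagHom M) (straightInv M.ρ) (straightInv_straight M.ρ)
      (straight_straightInv M.ρ))
    (fun {M N} f => Bim.hom_ext (BT.ext_curry (TensorProduct.ext' fun a b =>
      LinearMap.ext fun v => by
        obtain ⟨b, rfl⟩ := op_surjective b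
        exact ((diagMap f).map_l a (v ⊗ₜ[k] b)).symm)))

/-- `Γ` is a pseudofunctor. -/
instance : (Gamma k A).Monoidal := Functor.Monoidal.transport gammaDiag.symm

/-- The comparison map `Γ(M ⊗ N) → Γ(M) ⊗_A Γ(N)`. -/
theorem gamma_δ (M N : RepA k A) (a b : A) (x : M.carrier) (y : N.carrier) :
    Bim.Hom.lin (Functor.OplaxMonoidal.δ (Gamma k A) M N) (gmk (M ⊗ N) a b (x ⊗ₜ[k] y)) =
      Bim.tmk (gamma M) (gamma N) (gmk M a 1 x) (gmk N 1 b y) := by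
  refine (congrArg (Bim.Hom.lin (Functor.OplaxMonoidal.δ (Gamma k A) M N))
    (gmk_eq (M ⊗ N) a b (x ⊗ₜ[k] y))).trans ?_
  refine (Bim.Hom.map_l (Functor.OplaxMonoidal.δ (Gamma k A) M N) a _).trans ?_
  refine Eq.trans ?_ (congrArg (fun z => Bim.tmk (gamma M) (gamma N) z (gmk N 1 b y))
    (gmk_eq M a 1 x)).symm
  refine Eq.trans ?_ (Bim.tensor_l (M := gamma M) (N := gamma N) a (gmk M 1 1 x) (gmk N 1 b y))
  refine congrArg (Bim.l ((gamma M).tensor (gamma N)) a) ?_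
  rw [Functor.Monoidal.transport_δ]
  have e : (gammaDiagHom (M ⊗ N)).lin (gmk (M ⊗ N) 1 b (x ⊗ₜ[k] y)) = (x ⊗ₜ[k] y) ⊗ₜ[k] b :=
    LinearMap.congr_fun (map_one (actComul (M ⊗ N).ρ (Algebra.lmul k A))) _
  exact congrArg (fun z => Bim.Hom.lin (split M N ≫ (gammaDiag.inv.app M ⊗ₘ gammaDiag.inv.app N)) z)
    e

/-- The comparison map `Γ(k) → A`. -/
theorem gamma_η (a b : A) (c : k) :
    Bim.Hom.lin (Functor.OplaxMonoidal.η (Gamma k A)) (gmk (𝟙_ (RepA k A)) a b c) =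
      c • (a * b) := by
  refine (congrArg (Bim.Hom.lin (Functor.OplaxMonoidal.η (Gamma k A)))
    (gmk_eq (𝟙_ (RepA k A)) a b c)).trans ?_
  refine (Bim.Hom.map_l (Functor.OplaxMonoidal.η (Gamma k A)) a _).trans ?_
  refine Eq.trans ?_ (mul_smul_comm c a b)
  refine congrArg (fun z : A => a * z) ?_
  rw [Functor.Monoidal.transport_η]
  have e : (gammaDiagHom (𝟙_ (RepA k A))).lin (gmk (𝟙_ (RepA k A)) 1 b c) = c ⊗ₜ[k] b :=
    LinearMap.congr_fun (map_one (actComul (𝟙_ (RepA k A)).ρ (Algebra.lmul k A))) _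
  exact congrArg (TensorProduct.lid k A) e

end Gamma

/-! ### The group `G` and its action on `A` -/

section Character

variable (k A : Type u) [Field k] [Ring A] [HopfAlgebra k A]

/-- The group `G` of characters of `A`, i.e. of algebra homomorphisms `A → k`, under convolution.
If `A` is basic, its elements correspond to the isomorphism classes of simple `A`-modules. -/
def Characters : Type u := WithConv (A →ₐ[k] k)

namespace Characters

instance : Monoid (Characters k A) := inferInstanceAs (Monoid (WithConv (A →ₐ[k] k)))

variable {k A}

/-- The underlying algebra homomorphism. -/
def hom (χ : Characters k A) : A →ₐ[k] k := WithConv.ofConv χ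

@[ext] theorem ext {χ ψ : Characters k A} (h : ∀ a, χ.hom a = ψ.hom a) : χ = ψ :=
  WithConv.ofConv_injective (AlgHom.ext h)

theorem one_hom (a : A) : (1 : Characters k A).hom a = Coalgebra.counit (R := k) a := rfl

theorem mul_hom (χ ψ : Characters k A) (a : A) :
    (χ * ψ).hom a = LinearMap.mul' k k
      (TensorProduct.map χ.hom.toLinearMap ψ.hom.toLinearMap (Coalgebra.comul a)) := rfl

/-- The inverse of a character, given by the antipode. -/
instance : Inv (Characters k A) where
  inv χ := WithConv.toConv (AlgHom.ofLinearMap (χ.hom.toLinearMap ∘ₗ HopfAlgebra.antipode k)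
    (by simp) (fun x y => by simp [HopfAlgebra.antipode_mul_antidistrib, mul_comm]))

theorem inv_hom (χ : Characters k A) (a : A) : (χ⁻¹).hom a = χ.hom (HopfAlgebra.antipode k a) := rfl

instance : Group (Characters k A) where
  inv_mul_cancel χ := by
    ext a
    have e : ∀ t : A ⊗[k] A, LinearMap.mul' k k
        (TensorProduct.map (χ⁻¹).hom.toLinearMap χ.hom.toLinearMap t) =
        χ.hom (LinearMap.mul' k A ((HopfAlgebra.antipode k).rTensor A t)) := by
      intro t
      induction t with
      | zero => simp
      | add x y hx hy => simp only [map_add, hx, hy]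
      | tmul x y => simp [inv_hom]
    rw [mul_hom, e, HopfAlgebra.mul_antipode_rTensor_comul_apply, one_hom]
    exact χ.hom.commutes _

instance [Module.Finite k A] : Finite (Characters k A) := by
  have h := linearIndependent_toLinearMap k A k
  have := h.finite
  exact Finite.of_injective (fun χ : Characters k A => χ.hom) WithConv.ofConv_injective

instance [Module.Finite k A] : Fintype (Characters k A) := Fintype.ofFinite _

instance : DecidableEq (Characters k A) := Classical.decEq _

/-- The map `a ↦ Σ a₁ χ(a₂)`. -/
def actHom (χ : Characters k A) : A →ₐ[k] A :=
  (Algebra.TensorProduct.rid k k A).toAlgHom.comp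
    ((Algebra.TensorProduct.map (AlgHom.id k A) χ.hom).comp (Bialgebra.comulAlgHom k A))

theorem actHom_apply (χ : Characters k A) (a : A) : χ.actHom a = TensorProduct.rid k A
    (TensorProduct.map LinearMap.id χ.hom.toLinearMap (Coalgebra.comul a)) := rfl

theorem actHom_mul (χ ψ : Characters k A) (a : A) : (χ * ψ).actHom a = χ.actHom (ψ.actHom a) := by
  have e₁ : ∀ t : A ⊗[k] A, TensorProduct.rid k A
      (TensorProduct.map LinearMap.id (χ * ψ).hom.toLinearMap t) =
      TensorProduct.rid k A (TensorProduct.map LinearMap.id (LinearMap.mul' k k ∘ₗ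
        TensorProduct.map χ.hom.toLinearMap ψ.hom.toLinearMap) (Coalgebra.comul.lTensor A t)) := by
    intro t
    induction t with
    | zero => simp
    | add x y hx hy => simp only [map_add, hx, hy]
    | tmul x y => simp [mul_hom]
  have e₂ : ∀ t : A ⊗[k] A, TensorProduct.rid k A
      (TensorProduct.map LinearMap.id (LinearMap.mul' k k ∘ₗ
        TensorProduct.map χ.hom.toLinearMap ψ.hom.toLinearMap)
        (TensorProduct.assoc k A A A (Coalgebra.comul.rTensor A t))) =
      χ.actHom (TensorProduct.rid k A (TensorProduct.map LinearMap.id ψ.hom.toLinearMap t)) := by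
    intro t
    induction t with
    | zero => simp
    | add x y hx hy => simp only [map_add, hx, hy]
    | tmul x y =>
      simp only [LinearMap.rTensor_tmul, TensorProduct.map_tmul, TensorProduct.rid_tmul, map_smul,
        actHom_apply, LinearMap.id_apply]
      induction Coalgebra.comul (R := k) x with
      | zero => simp
      | add x y hx hy => simp only [map_add, TensorProduct.add_tmul, hx, hy, smul_add]
      | tmul z w => simp [mul_smul, smul_comm (χ.hom w)]
  rw [actHom_apply, e₁, ← Coalgebra.coassoc_apply, e₂, ← actHom_apply]

theorem actHom_one (a : A) : (1 : Characters k A).actHom a = a := by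
  have e : ∀ t : A ⊗[k] A, TensorProduct.map LinearMap.id (1 : Characters k A).hom.toLinearMap t =
      Coalgebra.counit.lTensor A t := by
    intro t
    induction t with
    | zero => simp
    | add x y hx hy => simp only [map_add, hx, hy]
    | tmul x y => rfl
  rw [actHom_apply, e, Coalgebra.lTensor_counit_comul, TensorProduct.rid_tmul, one_smul]

variable (k A) in
/-- The action of `G` on `A` by algebra automorphisms, `g · a = Σ a₁ g(a₂)`. -/
def act : Characters k A →* (A ≃ₐ[k] A) where
  toFun χ := AlgEquiv.ofAlgHom χ.actHom χ⁻¹.actHom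
    (AlgHom.ext fun a => by
      change χ.actHom (χ⁻¹.actHom a) = a
      rw [← actHom_mul, mul_inv_cancel, actHom_one])
    (AlgHom.ext fun a => by
      change χ⁻¹.actHom (χ.actHom a) = a
      rw [← actHom_mul, inv_mul_cancel, actHom_one])
  map_one' := AlgEquiv.ext actHom_one
  map_mul' χ ψ := AlgEquiv.ext (actHom_mul χ ψ)

end Characters

end Character

/-! ### Radically graded basic Hopf algebras -/

section Basic

variable (k A : Type u) [Field k] [Ring A]

/-- `A` is basic: the quotient by its Jacobson radical is a product of copies of `k`. -/
def IsBasic [Algebra k A] : Prop :=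
  ∃ n : ℕ, Nonempty ((A ⧸ Ring.jacobson A) ≃ₐ[k] (Fin n → k))

/-- `A` is radically graded: it is a graded Hopf algebra `A = ⨁ A_n` whose grading is given by the
radical filtration, i.e. `rad(A)^i = ⨁_{n ≥ i} A_n` for all `i`. -/
def IsRadicallyGraded [HopfAlgebra k A] : Prop :=
  ∃ (𝒜 : ℕ → Submodule k A) (_ : GradedAlgebra 𝒜),
    (∀ n, ∀ a ∈ 𝒜 n, Coalgebra.comul (R := k) a ∈
      ⨆ (p : ℕ × ℕ) (_ : p.1 + p.2 = n),
        LinearMap.range (TensorProduct.map (𝒜 p.1).subtype (𝒜 p.2).subtype)) ∧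
    (∀ n, 0 < n → ∀ a ∈ 𝒜 n, Coalgebra.counit (R := k) a = 0) ∧
    (∀ n, ∀ a ∈ 𝒜 n, HopfAlgebra.antipode k a ∈ 𝒜 n) ∧
    ∀ i a, a ∈ Ring.jacobson A ^ i ↔ a ∈ ⨆ n ≥ i, 𝒜 n

end Basic

/-! ### The bicategories `H_A` and `G_A` -/

section Main

/-- The additive closure of a class of objects of a preadditive category: the objects `X` which
are direct summands of a finite direct sum of objects `s j` of the class, i.e. which admit morphisms
`f j : X ⟶ s j` and `g j : s j ⟶ X` with `Σ_j f j ≫ g j = 𝟙`. -/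
def AddClosure {C : Type*} [Category C] [Preadditive C] (S : ObjectProperty C) :
    ObjectProperty C :=
  fun X => ∃ (n : ℕ) (s : Fin n → C) (f : ∀ j, X ⟶ s j) (g : ∀ j, s j ⟶ X),
    (∀ j, S (s j)) ∧ ∑ j, f j ≫ g j = 𝟙 X

section Free

variable (k A : Type u) [Field k] [Ring A] [Algebra k A] [Module.Finite k A]

/-- The bimodule `A ⊗_k A`, with `a · (x ⊗ y) · b = a x ⊗ y b`. -/
def Bim.free : Bim k A where
  carrier := A ⊗[k] A
  l := AlgHom.ofLinearMap
    { toFun := fun a => (LinearMap.mulLeft k a).rTensor A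
      map_add' := fun _ _ => by ext; simp [add_mul, TensorProduct.add_tmul]
      map_smul' := fun _ _ => by ext; simp [TensorProduct.smul_tmul'] }
    (by ext; simp) (fun _ _ => by ext; simp [mul_assoc])
  r := AlgHom.ofLinearMap
    { toFun := fun b => (LinearMap.mulRight k b.unop).lTensor A
      map_add' := fun _ _ => by ext; simp [mul_add, TensorProduct.tmul_add]
      map_smul' := fun _ _ => by ext; simp }
    (by ext; simp) (fun _ _ => by ext; simp [mul_assoc])
  l_r a b z := by
    induction z with
    | zero => simp
    | add x y hx hy => simp only [map_add, hx, hy]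
    | tmul x y => rfl

variable {k A} {G : Type u} [Group G] [Fintype G] [DecidableEq G] (σ : G →* (A ≃ₐ[k] A))

/-- The object `A ⊗_k A`, with the identity as idempotent, of `X_A`. -/
def freeXA : XA σ := (Idempotents.toKaroubi (Skew σ)).obj ⟨Bim.free k A⟩

/-- The objects of `G_A`: the additive closure of `(A, π₁) ⊕ (A ⊗_k A)` in `X_A`. The bicategory
`G_A` is the full subcategory on these objects. -/
def GA [NeZero (Nat.card G : k)] : ObjectProperty (XA σ) :=
  AddClosure fun X => X = 𝟙_ (XA σ) ∨ X = freeXA σ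

end Free

section HA

variable (k A : Type u) [Field k] [Ring A] [HopfAlgebra k A] [Module.Finite k A]

/-- The objects of `H_A`: the additive closure of `A ⊕ L₁` in `Rep_A`, where `L₁` is the trivial
module. The bicategory `H_A` is the full subcategory on these objects. -/
def HA : ObjectProperty (RepA k A) :=
  AddClosure fun M => M = 𝟙_ (RepA k A) ∨ M = RepA.reg k A

end HA

end Main

end HopfBimod

end

open HopfBimod

/-!
The proof replaces `Γ` by the isomorphic monoidal functor `M ↦ M ⊗ A` (with the diagonal left
action) and observes that the bimodule `M ⊗ A` carries an action of `G`, namely `m ⊗ a ↦ m ⊗ g(a)`,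
that is compatible with the action of `G` on `A`. A bimodule `M` with such an equivariant structure
`τ` defines the object `(M, |G|⁻¹ (τ_g)_g)` of `X_A`, whose image under `Θ` is `M` again
(`EqStr.thetaIso`). This gives the functor `Λ` (`Lam`) and the isomorphism `Γ ≅ Θ ∘ Λ`
(`gammaLam`). Since `Θ` is faithful, and since the morphisms in its image are exactly the
equivariant ones (`exists_theta_map_eq`), `Λ` inherits its monoidal structure from `M ↦ M ⊗ A`: it
is enough that the comparison isomorphisms of the latter are equivariant. Moreover
`M = (M ⊗ A) ⊗_A k` can be recovered from the bimodule `M ⊗ A`, so `Λ` is faithful and reflects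
isomorphism classes.

The bimodule `A ⊗ A = Λ(A)` is free of rank one on an invariant generator (`kappa`), so `Λ(A)` is a
direct summand of the free bimodule in `X_A`, and `Λ` maps `H_A` to `G_A`; that `H_A` is closed
under tensor products comes down to `A ⊗ A` being a free left module.

Conversely, the degree zero part of `A` is the algebra of functions on `G`, with primitive
idempotents `e_x` satisfying `g(e_x) = e_{x g⁻¹}` and `(1 ⊗ S) Δ(e_h) = ∑_u e_u ⊗ e_{h⁻¹ u}`
(`exists_characterBasis`). The free bimodule decomposes in `X_A` into the summands given by right
multiplication with `e_x ⊗ e_y`. The group `G` permutes these idempotents freely and the sum over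
the orbit of `e_x ⊗ e_y` is `(1 ⊗ S) Δ(e_h)` with `h = x y⁻¹`, so this summand is `Λ(A e_h)`
(`exists_lam_iso_freeSummand`). Endomorphisms of these summands and of the identity `1`-morphism
act by a scalar on the quotients of a radical filtration, so they are invertible or nilpotent
(`freeSummand_local`, `unit_local`). The Krull–Schmidt argument `AddClosure.induction_local` then
shows that every object of `G_A` is a direct sum of such objects, hence is isomorphic to `Λ(M)` for
some `M` in `H_A` (`exists_lam_iso`). Closure of `G_A` under horizontal composition follows.
-/

noncomputable section

namespace HopfBimod

/-! ### Additive closures and decompositions into local objects -/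

section AdditiveClosure

variable {C : Type*} [Category C] [Preadditive C]

namespace AddClosure

variable {S T : ObjectProperty C}

theorem of_fintype {X : C} {ι : Type*} [Fintype ι] (s : ι → C) (f : ∀ j, X ⟶ s j)
    (g : ∀ j, s j ⟶ X) (hs : ∀ j, S (s j)) (h : ∑ j, f j ≫ g j = 𝟙 X) : AddClosure S X := by
  let e := (Fintype.equivFin ι).symm
  refine ⟨Fintype.card ι, fun j => s (e j), fun j => f (e j), fun j => g (e j),
    fun j => hs (e j), ?_⟩
  rw [← h]
  exact Fintype.sum_equiv e _ _ fun _ => rfl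

theorem of_retract {X Y : C} (f : X ⟶ Y) (g : Y ⟶ X) (h : f ≫ g = 𝟙 X) (hY : S Y) :
    AddClosure S X :=
  of_fintype (ι := Unit) (fun _ => Y) (fun _ => f) (fun _ => g) (fun _ => hY) (by simpa using h)

theorem of_mem {X : C} (hX : S X) : AddClosure S X := of_retract (𝟙 X) (𝟙 X) (by simp) hX

theorem of_id_eq_zero {X : C} (h : 𝟙 X = 0) : AddClosure S X :=
  of_fintype (ι := Empty) Empty.rec (fun j => j.elim) (fun j => j.elim) (fun j => j.elim)
    (by simpa using h.symm)

theorem trans {X : C} (h : ∀ Y, S Y → AddClosure T Y) (hX : AddClosure S X) : AddClosure T X := by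
  obtain ⟨n, s, f, g, hs, e⟩ := hX
  choose m t a b ht e' using fun j => h _ (hs j)
  refine of_fintype (ι := Σ j, Fin (m j)) (fun j => t j.1 j.2) (fun j => f j.1 ≫ a j.1 j.2)
    (fun j => b j.1 j.2 ≫ g j.1) (fun j => ht j.1 j.2) ?_
  rw [Fintype.sum_sigma, ← e]
  refine Finset.sum_congr rfl fun j _ => ?_
  conv_rhs => rw [← Category.id_comp (g j), ← e' j]
  simp only [Preadditive.sum_comp, Preadditive.comp_sum, Category.assoc]

theorem retract {X Y : C} (f : X ⟶ Y) (g : Y ⟶ X) (h : f ≫ g = 𝟙 X) (hY : AddClosure S Y) :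
    AddClosure S X :=
  trans (S := fun Z => Z = Y) (fun _ e => e ▸ hY) (of_retract f g h rfl)

theorem iso {X Y : C} (e : X ≅ Y) (hY : AddClosure S Y) : AddClosure S X :=
  retract e.hom e.inv e.hom_inv_id hY

/-- The additive closure contains the direct sum of two of its objects. -/
theorem add {X Y Z : C} (i : Y ⟶ X) (r : X ⟶ Y) (j : Z ⟶ X) (s : X ⟶ Z)
    (h : r ≫ i + s ≫ j = 𝟙 X) (hY : AddClosure S Y) (hZ : AddClosure S Z) : AddClosure S X := by
  refine trans (S := AddClosure S) (fun _ h => h) ?_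
  refine of_fintype (ι := Bool) (fun b => Bool.rec Y Z b) (fun b => Bool.rec r s b)
    (fun b => Bool.rec i j b) (fun b => by cases b <;> assumption) ?_
  simp [← h, add_comm]

theorem map {D : Type*} [Category D] [Preadditive D] (F : C ⥤ D) [F.Additive]
    {T : ObjectProperty D} (h : ∀ Y, S Y → AddClosure T (F.obj Y)) {X : C}
    (hX : AddClosure S X) : AddClosure T (F.obj X) := by
  obtain ⟨n, s, f, g, hs, e⟩ := hX
  refine trans (S := AddClosure T) (fun _ h => h) ?_
  refine of_fintype (fun j => F.obj (s j)) (fun j => F.map (f j)) (fun j => F.map (g j))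
    (fun j => h _ (hs j)) ?_
  simp only [← F.map_comp, ← F.map_sum, e, F.map_id]

/-- If a class of objects has its tensor products in its additive closure, then the additive
closure is closed under tensor products. -/
theorem tensor [MonoidalCategory C] [MonoidalPreadditive C]
    (h : ∀ X Y, S X → S Y → AddClosure S (X ⊗ Y)) {X Y : C} (hX : AddClosure S X)
    (hY : AddClosure S Y) : AddClosure S (X ⊗ Y) := by
  refine map (S := S) (tensorRight Y) (fun X' hX' => ?_) hX
  exact map (S := S) (tensorLeft X') (fun Y' hY' => h _ _ hX' hY') hY

end AddClosure

theorem comp_pow_succ {X Y : C} (f : X ⟶ Y) (w : Y ⟶ X) (n : ℕ) :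
    (show End X from f ≫ w) ^ (n + 1) = f ≫ (show Y ⟶ Y from (show End Y from w ≫ f) ^ n) ≫ w := by
  induction n with
  | zero =>
    rw [pow_one, pow_zero]
    change f ≫ w = f ≫ 𝟙 Y ≫ w
    rw [Category.id_comp]
  | succ n ih =>
    rw [pow_succ, ih, pow_succ]
    change (f ≫ w) ≫ f ≫ _ ≫ w = f ≫ ((w ≫ f) ≫ _) ≫ w
    simp only [Category.assoc]

theorem isNilpotent_comp {X Y : C} (f : X ⟶ Y) (w : Y ⟶ X)
    (h : IsNilpotent (show End Y from w ≫ f)) : IsNilpotent (show End X from f ≫ w) := by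
  obtain ⟨n, hn⟩ := h
  refine ⟨n + 1, ?_⟩
  rw [comp_pow_succ, hn]
  exact (congrArg (f ≫ ·) Limits.zero_comp).trans Limits.comp_zero

/-- An object is zero if a finite sum of endomorphisms factoring through objects `s j` is
invertible, while all composites `s j ⟶ X ⟶ s j` are nilpotent. -/
theorem id_eq_zero_of_sum {X : C} {ι : Type*} (s : ι → C) (f : ∀ j, X ⟶ s j)
    (hn : ∀ j (w : s j ⟶ X), IsNilpotent (show End (s j) from w ≫ f j)) (t : Finset ι) :
    ∀ (g : ∀ j, s j ⟶ X), IsIso (∑ j ∈ t, f j ≫ g j) → 𝟙 X = 0 := by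
  classical
  induction t using Finset.induction_on with
  | empty =>
    intro g hg
    rw [Finset.sum_empty] at hg
    rw [← IsIso.hom_inv_id (0 : X ⟶ X), Limits.zero_comp]
  | insert a t ha ih =>
    intro g hg
    rw [Finset.sum_insert ha] at hg
    set v := f a ≫ g a + ∑ j ∈ t, f j ≫ g j
    have e : ∑ j ∈ t, f j ≫ g j ≫ inv v = 𝟙 X - f a ≫ g a ≫ inv v := by
      rw [← IsIso.hom_inv_id v]
      conv_rhs => enter [1, 1]; simp only [v]
      simp only [Preadditive.add_comp, Preadditive.sum_comp, Category.assoc]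
      abel
    refine ih (fun j => g j ≫ inv v) ?_
    rw [e]
    -- the term of `a` is nilpotent, so the remaining terms still sum to an isomorphism
    have hN := isNilpotent_comp (f a) (g a ≫ inv v) (hn a _)
    exact (isUnit_iff_isIso _).1 (IsNilpotent.isUnit_one_sub hN)

/-- A form of the Krull–Schmidt theorem: a class `P` of objects that contains the zero objects,
and contains `Y ⊕ Z` if `Y` belongs to `S` and `Z` to `P`, contains the additive closure of `S`,
provided that all endomorphisms of the objects of `S` are invertible or nilpotent. The function `d`
is any measure of size that decreases on passing to a proper direct summand. -/
theorem AddClosure.induction_local [IsIdempotentComplete C] {S P : ObjectProperty C}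
    (hS : ∀ Y, S Y → ∀ t : Y ⟶ Y, IsIso t ∨ IsNilpotent (show End Y from t))
    (d : C → ℕ) (hd : ∀ (X Y : C) (i : X ⟶ Y) (r : Y ⟶ X), i ≫ r = 𝟙 X → r ≫ i ≠ 𝟙 Y → d X < d Y)
    (h₀ : ∀ X, 𝟙 X = 0 → P X)
    (h₁ : ∀ (X Y Z : C) (i : Y ⟶ X) (r : X ⟶ Y) (j : Z ⟶ X) (s : X ⟶ Z), i ≫ r = 𝟙 Y →
      j ≫ s = 𝟙 Z → i ≫ s = 0 → j ≫ r = 0 → r ≫ i + s ≫ j = 𝟙 X → S Y → P Z → P X)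
    {X : C} (hX : AddClosure S X) : P X := by
  induction hn : d X using Nat.strong_induction_on generalizing X with
  | _ n ih =>
  obtain ⟨m, s, f, g, hs, e⟩ := hX
  -- either some `s j` is a nonzero direct summand of `X`, which is split off, or `X` is zero
  by_cases hc : ∃ j, ∃ u : s j ⟶ X, ∃ v : X ⟶ s j, IsIso (u ≫ v) ∧ 𝟙 (s j) ≠ 0
  · obtain ⟨j, u, v, hv, hj⟩ := hc
    obtain ⟨v, hv⟩ : ∃ v' : X ⟶ s j, u ≫ v' = 𝟙 _ := ⟨v ≫ inv (u ≫ v), by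
      rw [← Category.assoc, IsIso.hom_inv_id]⟩
    have hq : (𝟙 X - v ≫ u) ≫ (𝟙 X - v ≫ u) = 𝟙 X - v ≫ u := by
      simp [Preadditive.sub_comp, Preadditive.comp_sub, reassoc_of% hv]
    obtain ⟨X', i, r, h₂, h₃⟩ := IsIdempotentComplete.idempotents_split X _ hq
    have hi : i ≫ v = 0 := by
      have : i ≫ (r ≫ i) ≫ v = 0 := by
        rw [h₃, Preadditive.sub_comp, Category.assoc, hv]; simp
      simpa [reassoc_of% h₂] using this
    have hr : u ≫ r = 0 := by
      have : u ≫ (r ≫ i) ≫ r = 0 := by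
        rw [h₃, Preadditive.sub_comp, Preadditive.comp_sub, Category.assoc, reassoc_of% hv]
        simp
      simpa [h₂] using this
    refine h₁ X (s j) X' u v i r hv h₂ hr hi (by rw [h₃]; simp) (hs j) ?_
    refine ih (d X') ?_ (AddClosure.retract i r h₂ ⟨m, s, f, g, hs, e⟩) rfl
    rw [← hn]
    refine hd _ _ i r h₂ fun h => hj ?_
    rw [h₃, sub_eq_self] at h
    have : u ≫ (v ≫ u) ≫ v = 𝟙 _ := by rw [Category.assoc, hv, Category.comp_id, hv]
    rw [← this, h]
    simp
  · refine h₀ X (id_eq_zero_of_sum s f (fun j w => ?_) Finset.univ g (by rw [e]; infer_instance))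
    rcases hS _ (hs j) (w ≫ f j) with h | h
    · have h' : 𝟙 (s j) = 0 := by
        by_contra h'
        exact hc ⟨j, w, f j, h, h'⟩
      have : w ≫ f j = 0 := by rw [← Category.comp_id (w ≫ f j), h', Limits.comp_zero]
      rw [this]
      exact ⟨1, pow_one _⟩
    · exact h

end AdditiveClosure

/-! ### Monoidal structures reflected by a faithful monoidal functor -/

section Reflect

open Functor LaxMonoidal OplaxMonoidal

variable {C D E : Type*} [Category C] [MonoidalCategory C] [Category D] [MonoidalCategory D]
  [Category E] [MonoidalCategory E]

/-- A functor `L` becomes monoidal if its composite with a faithful monoidal functor `T` is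
monoidal and the comparison isomorphisms of this composite lift along `T`. -/
def coreMonoidalOfFaithful (L : C ⥤ E) (T : E ⥤ D) [T.Monoidal] [T.Faithful]
    (K : (L ⋙ T).CoreMonoidal) (m : ∀ X Y, L.obj X ⊗ L.obj Y ≅ L.obj (X ⊗ Y))
    (e : 𝟙_ E ≅ L.obj (𝟙_ C))
    (hm : ∀ X Y, LaxMonoidal.μ T (L.obj X) (L.obj Y) ≫ T.map (m X Y).hom = (K.μIso X Y).hom)
    (he : LaxMonoidal.ε T ≫ T.map e.hom = K.εIso.hom) :
    L.CoreMonoidal where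
  εIso := e
  μIso := m
  μIso_hom_natural_left f X' := by
    apply T.map_injective
    rw [← cancel_epi (LaxMonoidal.μ T _ _), T.map_comp, T.map_comp, ← μ_natural_left_assoc, hm,
      reassoc_of% hm]
    exact K.μIso_hom_natural_left f X'
  μIso_hom_natural_right X' f := by
    apply T.map_injective
    rw [← cancel_epi (LaxMonoidal.μ T _ _), T.map_comp, T.map_comp, ← μ_natural_right_assoc, hm,
      reassoc_of% hm]
    exact K.μIso_hom_natural_right X' f
  associativity X Y Z := by
    apply T.map_injective
    rw [← cancel_epi (LaxMonoidal.μ T _ _), ← cancel_epi (LaxMonoidal.μ T _ _ ▷ _)]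
    simp only [T.map_comp]
    rw [LaxMonoidal.associativity_assoc, ← μ_natural_left_assoc, reassoc_of% hm,
      ← comp_whiskerRight_assoc, hm, ← μ_natural_right_assoc, hm,
      ← MonoidalCategory.whiskerLeft_comp_assoc, hm]
    exact K.associativity X Y Z
  left_unitality X := by
    apply T.map_injective
    rw [← cancel_epi (LaxMonoidal.μ T _ _), ← cancel_epi (LaxMonoidal.ε T ▷ _)]
    simp only [T.map_comp]
    rw [← LaxMonoidal.left_unitality, ← μ_natural_left_assoc, reassoc_of% hm,
      ← comp_whiskerRight_assoc, he]
    exact K.left_unitality X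
  right_unitality X := by
    apply T.map_injective
    rw [← cancel_epi (LaxMonoidal.μ T _ _), ← cancel_epi (_ ◁ LaxMonoidal.ε T)]
    simp only [T.map_comp]
    rw [← LaxMonoidal.right_unitality, ← μ_natural_right_assoc, reassoc_of% hm,
      ← MonoidalCategory.whiskerLeft_comp_assoc, he]
    exact K.right_unitality X

/-- For the monoidal structure on `L` lifted from the one transported to `L ⋙ T` along an
isomorphism `i : F ≅ L ⋙ T`, the isomorphism `i` is monoidal. -/
theorem isMonoidal_of_lift (F : C ⥤ D) [F.Monoidal] (L : C ⥤ E) [L.Monoidal] (T : E ⥤ D)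
    [T.Monoidal] (i : F ≅ L ⋙ T)
    (hm : ∀ X Y, LaxMonoidal.μ T (L.obj X) (L.obj Y) ≫ T.map (LaxMonoidal.μ L X Y) =
      ((Monoidal.coreMonoidalTransport i).μIso X Y).hom)
    (he : LaxMonoidal.ε T ≫ T.map (LaxMonoidal.ε L) =
      (Monoidal.coreMonoidalTransport i).εIso.hom) : NatTrans.IsMonoidal i.hom where
  unit := by
    rw [LaxMonoidal.comp_ε, he]
    rfl
  tensor X Y := by
    rw [LaxMonoidal.comp_μ, hm]
    simp [tensorHom_comp_tensorHom_assoc]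

end Reflect

open Idempotents Bim

/-! ### Equivariant bimodules -/

section Equivariant

variable {k A : Type u} [Field k] [Ring A] [Algebra k A] [Module.Finite k A]
  {G : Type u} [Group G] [Fintype G] [DecidableEq G] (σ : G →* (A ≃ₐ[k] A))

/-- An equivariant structure on a bimodule `M`: an action `τ` of `G` on `M` with
`τ_g (a · m · b) = g(a) · τ_g m · g(b)`. -/
structure EqStr (M : Bim k A) where
  τ : G → M.carrier →ₗ[k] M.carrier
  τ_l : ∀ g a m, τ g (M.l a m) = M.l (σ g a) (τ g m)
  τ_r : ∀ g a m, τ g (M.r (op a) m) = M.r (op (σ g a)) (τ g m)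
  τ_one : ∀ m, τ 1 m = m
  τ_mul : ∀ g h m, τ (g * h) m = τ g (τ h m)

variable {σ}

/-- The inclusion of `Θ(M, e)` into `⨁_g M^g`. -/
def thetaι (P : XA σ) : (Theta σ).obj P ⟶ bigTwist σ P.X.base := imageι (thetaMap P.p)

/-- The projection of `⨁_g M^g` onto `Θ(M, e)`. -/
def thetaπ (P : XA σ) : bigTwist σ P.X.base ⟶ (Theta σ).obj P := imageπ (thetaMap P.p)

theorem thetaι_π (P : XA σ) : thetaι P ≫ thetaπ P = 𝟙 _ := (skewImage σ).ι_π P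

theorem thetaπ_ι (P : XA σ) : thetaπ P ≫ thetaι P = thetaMap P.p := imageπ_ι _

theorem thetaι_p (P : XA σ) : thetaι P ≫ thetaMap P.p = thetaι P := (skewImage σ).ι_p P

theorem thetap_π (P : XA σ) : thetaMap P.p ≫ thetaπ P = thetaπ P := (skewImage σ).p_π P

theorem theta_map {P Q : XA σ} (f : P ⟶ Q) :
    (Theta σ).map f = thetaι P ≫ thetaMap f.f ≫ thetaπ Q := rfl

/-- The bimodule homomorphism `f` commutes with the families `t` and `t'` of endomorphisms. -/
def IsEquivariant {M N : Bim k A} (t : G → M.carrier →ₗ[k] M.carrier)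
    (t' : G → N.carrier →ₗ[k] N.carrier) (f : M ⟶ N) : Prop :=
  ∀ g m, f.lin (t g m) = t' g (f.lin m)

namespace EqStr

variable {M N K : Bim k A} (S : EqStr σ M) (T : EqStr σ N) (U : EqStr σ K)

/-- The morphism `|G|⁻¹ (τ_g ∘ f)_{g ∈ G}` of `𝒳_A`. -/
def skewMap (f : M ⟶ N) : (⟨M⟩ : Skew σ) ⟶ ⟨N⟩ where
  app g := (Nat.card G : k)⁻¹ • (T.τ g ∘ₗ f.lin)
  map_l g a m := by simp [T.τ_l]
  map_r g a m := by simp [T.τ_r]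

theorem skewMap_app (f : M ⟶ N) (g : G) (m : M.carrier) :
    (T.skewMap f).app g m = (Nat.card G : k)⁻¹ • T.τ g (f.lin m) := rfl

theorem card_smul [NeZero (Nat.card G : k)] (m : M.carrier) :
    Fintype.card G • (Nat.card G : k)⁻¹ • m = m := by
  rw [← Nat.card_eq_fintype_card, ← Nat.cast_smul_eq_nsmul k, smul_smul,
    mul_inv_cancel₀ (NeZero.ne _), one_smul]

theorem skewMap_comp [NeZero (Nat.card G : k)] (f : M ⟶ N) (f' : N ⟶ K)
    (hf : IsEquivariant T.τ U.τ f') : T.skewMap f ≫ U.skewMap f' = U.skewMap (f ≫ f') := by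
  ext s m
  have e : ∀ g : G, (U.skewMap f').app (s * g⁻¹) ((T.skewMap f).app g m) =
      (Nat.card G : k)⁻¹ • (U.skewMap (f ≫ f')).app s m := fun g => by
    refine (congrArg _ (T.skewMap_app f g m)).trans ((map_smul _ _ _).trans (congrArg _ ?_))
    refine (U.skewMap_app f' _ _).trans (congrArg _ ?_)
    rw [hf, ← U.τ_mul, inv_mul_cancel_right]
    rfl
  rw [Skew.comp_app, Finset.sum_congr rfl fun g _ => e g, Finset.sum_const, Finset.card_univ,
    card_smul]

theorem id_equivariant : IsEquivariant S.τ S.τ (𝟙 M) := fun _ _ => rfl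

variable [NeZero (Nat.card G : k)]

/-- The object `(M, |G|⁻¹ (τ_g)_{g ∈ G})` of `X_A`. -/
abbrev obj : XA σ := ⟨⟨M⟩, S.skewMap (𝟙 M), by
  rw [skewMap_comp S S _ _ S.id_equivariant, Category.id_comp]⟩

variable {S T U}

/-- The morphism of `X_A` given by an equivariant homomorphism. -/
def map (f : M ⟶ N) (hf : IsEquivariant S.τ T.τ f) : S.obj ⟶ T.obj where
  f := T.skewMap f
  comm := by
    change S.skewMap (𝟙 M) ≫ T.skewMap f ≫ T.skewMap (𝟙 N) = _
    rw [skewMap_comp T T _ _ T.id_equivariant, skewMap_comp S T _ _ (by simpa using hf)]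
    simp

variable (S) in
/-- The homomorphism `M → ⨁_g M^g`, `m ↦ |G|⁻¹ (τ_g m)_g`. -/
def spread : M ⟶ bigTwist σ M where
  lin := LinearMap.pi fun g => (Nat.card G : k)⁻¹ • S.τ g
  map_l a m := by
    refine funext fun g => ?_
    change (Nat.card G : k)⁻¹ • S.τ g (M.l a m) = M.l (σ g a) ((Nat.card G : k)⁻¹ • S.τ g m)
    rw [S.τ_l, map_smul]
  map_r a m := by
    refine funext fun g => ?_
    change (Nat.card G : k)⁻¹ • S.τ g (M.r (op a.unop) m) =
      M.r (op (σ g a.unop)) ((Nat.card G : k)⁻¹ • S.τ g m)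
    rw [S.τ_r, map_smul]

theorem spread_lin (m : M.carrier) (g : G) :
    btProj M g (S.spread.lin m) = (Nat.card G : k)⁻¹ • S.τ g m := rfl

variable (S) in
/-- The homomorphism `⨁_g M^g → M`, `(m_g)_g ↦ ∑_g τ_{g⁻¹} m_g`. -/
def fold : bigTwist σ M ⟶ M where
  lin := ∑ g, S.τ g⁻¹ ∘ₗ btProj M g
  map_l a m := by
    simp only [LinearMap.sum_apply, LinearMap.comp_apply, bigTwist_l, S.τ_l, act_inv_act, map_sum]
  map_r a m := by
    simp only [LinearMap.sum_apply, LinearMap.comp_apply, bigTwist_r, S.τ_r, act_inv_act, map_sum,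
      op_unop]

theorem fold_lin (m : (bigTwist σ M).carrier) :
    S.fold.lin m = ∑ g, S.τ g⁻¹ (btProj M g m) := by
  change (∑ g, S.τ g⁻¹ ∘ₗ btProj M g) m = _
  simp

theorem spread_fold : S.spread ≫ S.fold = 𝟙 M := by
  refine Bim.hom_ext (LinearMap.ext fun m => (S.fold_lin _).trans ?_)
  simp only [spread_lin, map_smul, ← S.τ_mul, inv_mul_cancel, S.τ_one, Finset.sum_const,
    Finset.card_univ, card_smul]
  rfl

theorem thetaMap_skewMap (f : M ⟶ N) (hf : IsEquivariant S.τ T.τ f) :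
    thetaMap (T.skewMap f : (⟨M⟩ : Skew σ) ⟶ ⟨N⟩) = S.fold ≫ f ≫ T.spread := by
  refine Bim.hom_ext (LinearMap.ext fun x => bigTwist_ext fun h => ?_)
  refine (thetaMap_lin _ x h).trans (Eq.trans ?_ (T.spread_lin _ h).symm)
  simp only [Bim.comp_lin, LinearMap.comp_apply, fold_lin, map_sum, Finset.smul_sum]
  refine Finset.sum_congr rfl fun g _ => ?_
  rw [skewMap_app, hf, ← T.τ_mul]

theorem thetaMap_obj_p : thetaMap S.obj.p = S.fold ≫ S.spread :=
  (thetaMap_skewMap (S := S) _ S.id_equivariant).trans (congrArg _ (Category.id_comp _))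

variable (S) in
/-- The isomorphism of `M` with the image of `(M, |G|⁻¹ (τ_g)_g)` under `Θ`. -/
def thetaIso : M ≅ (Theta σ).obj S.obj where
  hom := S.spread ≫ thetaπ S.obj
  inv := thetaι S.obj ≫ S.fold
  hom_inv_id := by
    rw [Category.assoc, reassoc_of% thetaπ_ι, thetaMap_obj_p, Category.assoc, spread_fold,
      Category.comp_id, spread_fold]
  inv_hom_id := by
    have h : S.fold ≫ S.spread ≫ thetaπ S.obj = thetaπ S.obj := by
      rw [← Category.assoc, ← thetaMap_obj_p, thetap_π]
    rw [Category.assoc, h, thetaι_π]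

theorem thetaIso_naturality (f : M ⟶ N) (hf : IsEquivariant S.τ T.τ f) :
    f ≫ T.thetaIso.hom = S.thetaIso.hom ≫ (Theta σ).map (map f hf) := by
  have h : thetaMap (map f hf).f = S.fold ≫ f ≫ T.spread := thetaMap_skewMap f hf
  rw [theta_map, h]
  change f ≫ T.spread ≫ thetaπ T.obj = (S.spread ≫ thetaπ S.obj) ≫ _
  simp only [Category.assoc]
  rw [reassoc_of% thetaπ_ι, thetaMap_obj_p, Category.assoc, reassoc_of% spread_fold,
    reassoc_of% spread_fold]

end EqStr

/-! ### The action of `G` on the images of `Θ` -/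

/-- The action of `G` on `Θ(P)`, given by relabelling the components. -/
def thetaAct (P : XA σ) (s : G) : ((Theta σ).obj P).carrier →ₗ[k] ((Theta σ).obj P).carrier :=
  (shift P.X.base s).restrict (p := LinearMap.range (thetaMap P.p).lin)
    (q := LinearMap.range (thetaMap P.p).lin) (by
      rintro _ ⟨m, rfl⟩
      exact ⟨shift _ s m, thetaMap_shift P.p s m⟩)

theorem thetaAct_ι (P : XA σ) (s : G) (x : ((Theta σ).obj P).carrier) :
    (thetaι P).lin (thetaAct P s x) = shift P.X.base s ((thetaι P).lin x) := rfl

theorem thetaAct_π (P : XA σ) (s : G) (x : (bigTwist σ P.X.base).carrier) :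
    (thetaπ P).lin (shift P.X.base s x) = thetaAct P s ((thetaπ P).lin x) :=
  Subtype.ext (thetaMap_shift P.p s x)

theorem exists_thetaMap_eq {M N : Skew σ} (F : bigTwist σ M.base ⟶ bigTwist σ N.base)
    (hF : ∀ s x, F.lin (shift M.base s x) = shift N.base s (F.lin x)) :
    ∃ φ : M ⟶ N, thetaMap φ = F := by
  refine ⟨⟨fun g => btProj N.base g ∘ₗ F.lin ∘ₗ btSingle M.base 1, fun g a m => ?_,
    fun g a m => ?_⟩, Bim.hom_ext (LinearMap.ext fun x => bigTwist_ext fun h => ?_)⟩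
  · simp only [LinearMap.comp_apply]
    rw [← bigTwist_l, ← Bim.hom_l, btSingle_l, map_one]
    rfl
  · simp only [LinearMap.comp_apply]
    refine Eq.trans ?_ (bigTwist_r (op a) _ g)
    rw [← Bim.hom_r, btSingle_r, map_one]
    rfl
  · rw [thetaMap_lin]
    conv_rhs => rw [← sum_btSingle x, map_sum, map_sum]
    refine Finset.sum_congr rfl fun g _ => ?_
    change btProj N.base (h * g⁻¹) (F.lin (btSingle M.base 1 (btProj M.base g x))) = _
    rw [← shift_apply, ← hF, shift_single, one_mul, inv_inv]

/-- A homomorphism between images of `Θ` that commutes with the action of `G` comes from `X_A`. -/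
theorem exists_theta_map_eq {P Q : XA σ} (f : (Theta σ).obj P ⟶ (Theta σ).obj Q)
    (hf : IsEquivariant (thetaAct P) (thetaAct Q) f) :
    ∃ f' : P ⟶ Q, (Theta σ).map f' = f := by
  obtain ⟨φ, hφ⟩ := exists_thetaMap_eq (M := P.X) (N := Q.X) (thetaπ P ≫ f ≫ thetaι Q)
    (fun s x => by
      simp only [Bim.comp_lin, LinearMap.comp_apply]
      rw [thetaAct_π, hf, thetaAct_ι])
  have hc : P.p ≫ φ ≫ Q.p = φ := by
    apply thetaMap_injective
    rw [thetaMap_comp, thetaMap_comp, hφ]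
    simp only [Category.assoc]
    rw [thetaι_p, reassoc_of% thetap_π]
  refine ⟨⟨φ, hc⟩, ?_⟩
  rw [theta_map, hφ]
  simp only [Category.assoc]
  rw [reassoc_of% thetaι_π, thetaι_π, Category.comp_id]

theorem IsEquivariant.inv {M N : Bim k A} {t : G → M.carrier →ₗ[k] M.carrier}
    {t' : G → N.carrier →ₗ[k] N.carrier} {f : M ≅ N} (h : IsEquivariant t t' f.hom) :
    IsEquivariant t' t f.inv := fun g n => by
  have h₁ : ∀ m, f.inv.lin (f.hom.lin m) = m := fun m =>
    LinearMap.congr_fun (congrArg Bim.Hom.lin f.hom_inv_id) m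
  have h₂ : ∀ m, f.hom.lin (f.inv.lin m) = m := fun m =>
    LinearMap.congr_fun (congrArg Bim.Hom.lin f.inv_hom_id) m
  rw [← h₁ (t g (f.inv.lin n)), h, h₂]

theorem exists_theta_mapIso_eq {P Q : XA σ} (f : (Theta σ).obj P ≅ (Theta σ).obj Q)
    (hf : IsEquivariant (thetaAct P) (thetaAct Q) f.hom) :
    ∃ f' : P ≅ Q, (Theta σ).map f'.hom = f.hom := by
  obtain ⟨u, hu⟩ := exists_theta_map_eq f.hom hf
  obtain ⟨v, hv⟩ := exists_theta_map_eq f.inv hf.inv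
  refine ⟨⟨u, v, (Theta σ).map_injective ?_, (Theta σ).map_injective ?_⟩, hu⟩ <;>
  simp [hu, hv]

variable [NeZero (Nat.card G : k)]

theorem EqStr.thetaIso_equivariant {M : Bim k A} (S : EqStr σ M) :
    IsEquivariant S.τ (thetaAct S.obj) S.thetaIso.hom := fun g m => by
  refine Eq.trans ?_ (thetaAct_π S.obj g (S.spread.lin m))
  refine congrArg (thetaπ S.obj).lin (bigTwist_ext fun h => ?_)
  refine (S.spread_lin _ h).trans (Eq.trans ?_ (S.spread_lin m (h * g)).symm)
  rw [S.τ_mul]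

theorem theta_μ_act (P Q : XA σ) (s : G) (x : ((Theta σ).obj P).carrier)
    (y : ((Theta σ).obj Q).carrier) :
    (Functor.LaxMonoidal.μ (Theta σ) P Q).lin (tmk _ _ (thetaAct P s x) (thetaAct Q s y)) =
      thetaAct (P ⊗ Q) s ((Functor.LaxMonoidal.μ (Theta σ) P Q).lin (tmk _ _ x y)) := by
  refine Eq.trans ?_ (thetaAct_π (P ⊗ Q) s ((jHom P.X.base Q.X.base).lin
    (tmk _ _ ((thetaι P).lin x) ((thetaι Q).lin y))))
  exact congrArg (thetaπ (P ⊗ Q)).lin (jHom_shift _ _ s _ _).symm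

theorem theta_ε_act (s : G) (a : A) :
    (Functor.LaxMonoidal.ε (Theta σ)).lin (σ s a) =
      thetaAct (𝟙_ (XA σ)) s ((Functor.LaxMonoidal.ε (Theta σ)).lin a) := by
  refine Eq.trans ?_ (thetaAct_π (𝟙_ (XA σ)) s ((spreadHom σ).lin a))
  refine congrArg (thetaπ (𝟙_ (XA σ))).lin (bigTwist_ext fun h => ?_)
  refine (spreadHom_lin σ _ h).trans (Eq.trans ?_ (spreadHom_lin σ _ (h * s)).symm)
  rw [act_act]

/-- An isomorphism `Θ(P) ⊗ Θ(Q) ≅ Θ(R)` that is compatible with the actions of `G` comes from an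
isomorphism in `X_A`. -/
theorem exists_tensor_lift {P Q R : XA σ} (f : (Theta σ).obj P ⊗ (Theta σ).obj Q ≅ (Theta σ).obj R)
    (hf : ∀ s x y, f.hom.lin (tmk _ _ (thetaAct P s x) (thetaAct Q s y)) =
      thetaAct R s (f.hom.lin (tmk _ _ x y))) :
    ∃ m : P ⊗ Q ≅ R, Functor.LaxMonoidal.μ (Theta σ) P Q ≫ (Theta σ).map m.hom = f.hom := by
  let e := Functor.Monoidal.μIso (Theta σ) P Q
  obtain ⟨m, hm⟩ := exists_theta_mapIso_eq (e.symm ≪≫ f) (fun s z => by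
    obtain ⟨t, rfl⟩ : ∃ t, e.hom.lin t = z := ⟨e.inv.lin z,
      LinearMap.congr_fun (congrArg Bim.Hom.lin e.inv_hom_id) z⟩
    have h : ∀ t, (e.symm ≪≫ f).hom.lin (e.hom.lin t) = f.hom.lin t := fun t =>
      congrArg f.hom.lin (LinearMap.congr_fun (congrArg Bim.Hom.lin e.hom_inv_id) t)
    induction t using t_ind with
    | mk x y =>
      refine (congrArg _ (theta_μ_act P Q s x y).symm).trans ((h _).trans ((hf s x y).trans ?_))
      exact congrArg _ (h _).symm
    | add x y hx hy => simp only [map_add, hx, hy])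
  refine ⟨m, ?_⟩
  rw [hm]
  exact e.hom_inv_id_assoc _

/-- An isomorphism `A ≅ Θ(R)` that is compatible with the actions of `G` comes from an
isomorphism in `X_A`. -/
theorem exists_unit_lift {R : XA σ} (f : 𝟙_ (Bim k A) ≅ (Theta σ).obj R)
    (hf : ∀ s (a : A), f.hom.lin (σ s a) = thetaAct R s (f.hom.lin a)) :
    ∃ m : 𝟙_ (XA σ) ≅ R, Functor.LaxMonoidal.ε (Theta σ) ≫ (Theta σ).map m.hom = f.hom := by
  let e := Functor.Monoidal.εIso (Theta σ)
  obtain ⟨m, hm⟩ := exists_theta_mapIso_eq (e.symm ≪≫ f) (fun s z => by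
    obtain ⟨t, rfl⟩ : ∃ t, e.hom.lin t = z := ⟨e.inv.lin z,
      LinearMap.congr_fun (congrArg Bim.Hom.lin e.inv_hom_id) z⟩
    have h : ∀ t, (e.symm ≪≫ f).hom.lin (e.hom.lin t) = f.hom.lin t := fun t =>
      congrArg f.hom.lin (LinearMap.congr_fun (congrArg Bim.Hom.lin e.hom_inv_id) t)
    refine (congrArg _ (theta_ε_act (A := A) s (show A from t)).symm).trans
      ((h _).trans ((hf s (show A from t)).trans ?_))
    exact congrArg _ (h _).symm)
  refine ⟨m, ?_⟩
  rw [hm]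
  exact e.hom_inv_id_assoc _

end Equivariant

/-! ### The pseudofunctor `Λ` -/

section Lambda

variable {k A : Type u} [Field k] [Ring A] [HopfAlgebra k A]

namespace Characters

theorem act_apply (g : Characters k A) (a : A) : act k A g a = TensorProduct.rid k A
    (TensorProduct.map LinearMap.id g.hom.toLinearMap (Coalgebra.comul a)) := rfl

/-- `Δ(g(a)) = Σ a₁ ⊗ g(a₂)`. -/
theorem comul_act (g : Characters k A) (a : A) : Coalgebra.comul (R := k) (act k A g a) =
    (act k A g).toLinearMap.lTensor A (Coalgebra.comul a) := by
  have e₁ : ∀ t : A ⊗[k] A, Coalgebra.comul (R := k) (TensorProduct.rid k A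
      (TensorProduct.map LinearMap.id g.hom.toLinearMap t)) = TensorProduct.map LinearMap.id
        ((TensorProduct.rid k A).toLinearMap ∘ₗ TensorProduct.map LinearMap.id g.hom.toLinearMap)
        (TensorProduct.assoc k A A A (Coalgebra.comul.rTensor A t)) := by
    intro t
    induction t with
    | zero => simp
    | add x y hx hy => simp only [map_add, hx, hy]
    | tmul x y =>
      simp only [LinearMap.rTensor_tmul, TensorProduct.map_tmul, TensorProduct.rid_tmul, map_smul,
        LinearMap.id_apply]
      induction Coalgebra.comul (R := k) x with
      | zero => simp
      | add x y hx hy => simp only [map_add, TensorProduct.add_tmul, hx, hy, smul_add]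
      | tmul z w => simp
  rw [act_apply, e₁, Coalgebra.coassoc_apply]
  induction Coalgebra.comul (R := k) a with
  | zero => simp
  | add x y hx hy => simp only [map_add, hx, hy]
  | tmul x y => rfl

theorem counit_act (g : Characters k A) (a : A) :
    Coalgebra.counit (R := k) (act k A g a) = g.hom a := by
  have e : ∀ t : A ⊗[k] A, Coalgebra.counit (R := k) (TensorProduct.rid k A
      (TensorProduct.map LinearMap.id g.hom.toLinearMap t)) =
      g.hom (TensorProduct.lid k A (Coalgebra.counit.rTensor A t)) := by
    intro t
    induction t with
    | zero => simp
    | add x y hx hy => simp only [map_add, hx, hy]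
    | tmul x y => simp [mul_comm]
  rw [act_apply, e, Coalgebra.rTensor_counit_comul]
  simp

/-- `χ(g(a)) = (χ g)(a)`. -/
theorem hom_act (χ g : Characters k A) (a : A) : χ.hom (act k A g a) = (χ * g).hom a := by
  rw [← counit_act, ← counit_act, map_mul]
  rfl

end Characters

open Characters

variable [Module.Finite k A]

/-- The action `τ_g (m ⊗ a) = m ⊗ g(a)` on `M ⊗ A`. -/
def diagStr (M : RepA k A) : EqStr (act k A) (diag M) where
  τ g := TensorProduct.map LinearMap.id (act k A g).toLinearMap
  τ_l g a m := by
    have e : ∀ (t : A ⊗[k] A) (z : M.carrier ⊗[k] A),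
        TensorProduct.map LinearMap.id (act k A g).toLinearMap
          (act₂ M.ρ (Algebra.lmul k A) t z) =
        act₂ M.ρ (Algebra.lmul k A) ((act k A g).toLinearMap.lTensor A t)
          (TensorProduct.map LinearMap.id (act k A g).toLinearMap z) := by
      intro t z
      induction t with
      | zero => simp
      | add x y hx hy => simp only [map_add, LinearMap.add_apply, hx, hy]
      | tmul a b =>
        induction z with
        | zero => simp
        | add x y hx hy => simp only [map_add, hx, hy]
        | tmul v w => simp
    refine (e _ m).trans ?_
    exact congrArg (fun t => act₂ M.ρ (Algebra.lmul k A) t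
      (TensorProduct.map LinearMap.id (act k A g).toLinearMap m)) (comul_act g a).symm
  τ_r g a m := by
    refine LinearMap.congr_fun (f := TensorProduct.map LinearMap.id (act k A g).toLinearMap ∘ₗ
        TensorProduct.map LinearMap.id (LinearMap.mulRight k a))
      (g := TensorProduct.map LinearMap.id (LinearMap.mulRight k (act k A g a)) ∘ₗ
        TensorProduct.map LinearMap.id (act k A g).toLinearMap)
      (TensorProduct.ext' fun x b => ?_) m
    simp
  τ_one m := by
    refine LinearMap.congr_fun (f := TensorProduct.map LinearMap.id (act k A 1).toLinearMap)
      (g := LinearMap.id) (TensorProduct.ext' fun x b => ?_) m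
    simp
  τ_mul g h m := by
    refine LinearMap.congr_fun (f := TensorProduct.map LinearMap.id (act k A (g * h)).toLinearMap)
      (g := TensorProduct.map LinearMap.id (act k A g).toLinearMap ∘ₗ
        TensorProduct.map LinearMap.id (act k A h).toLinearMap)
      (TensorProduct.ext' fun x b => ?_) m
    simp

theorem diagMap_equivariant {M N : RepA k A} (f : M ⟶ N) :
    IsEquivariant (diagStr M).τ (diagStr N).τ (diagMap f) := fun g => by
  refine LinearMap.congr_fun (f := (diagMap f).lin ∘ₗ (diagStr M).τ g)
    (g := (diagStr N).τ g ∘ₗ (diagMap f).lin) (diag_ext fun x b => ?_)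
  rfl

variable [NeZero (Nat.card (Characters k A) : k)]

variable (k A) in
/-- The functor `Λ : Rep_A → X_A`, `M ↦ (M ⊗ A, |G|⁻¹ (M ⊗ g)_{g ∈ G})`. -/
def Lam : RepA k A ⥤ XA (act k A) where
  obj M := (diagStr M).obj
  map f := EqStr.map (diagMap f) (diagMap_equivariant f)
  map_id M := Karoubi.hom_ext _ _ (congrArg (diagStr M).skewMap ((Diag k A).map_id M))
  map_comp {M N K} f g := Karoubi.hom_ext _ _
    ((congrArg (diagStr K).skewMap ((Diag k A).map_comp f g)).trans
      ((diagStr N).skewMap_comp (diagStr K) (diagMap f) (diagMap g) (diagMap_equivariant g)).symm)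

theorem lam_map_app {M N : RepA k A} (f : M ⟶ N) (g : Characters k A) (m : (diag M).carrier) :
    Skew.Hom.app (σ := act k A) (M := ⟨diag M⟩) (N := ⟨diag N⟩) ((Lam k A).map f).f g m =
      (Nat.card (Characters k A) : k)⁻¹ • (diagStr N).τ g ((diagMap f).lin m) := rfl

instance : (Lam k A).Additive where
  map_add {M N f f'} := Karoubi.hom_ext _ _ (Skew.hom_ext (M := ⟨diag M⟩) (N := ⟨diag N⟩)
    fun g m => by
      refine (lam_map_app _ g m).trans (Eq.trans ?_ (congrArg₂ (· + ·) (lam_map_app f g m)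
        (lam_map_app f' g m)).symm)
      refine Eq.trans ?_ (smul_add _ _ _)
      refine congrArg _ (Eq.trans ?_ (map_add _ _ _))
      refine congrArg _ ?_
      refine LinearMap.congr_fun (f := (diagMap (f + f')).lin)
        (g := (diagMap f).lin + (diagMap f').lin) (diag_ext fun x b => ?_) m
      exact TensorProduct.add_tmul _ _ _)

variable (k A) in
/-- The isomorphism `M ⊗ A ≅ Θ(Λ(M))`. -/
def lamIso : Diag k A ≅ Lam k A ⋙ Theta (act k A) :=
  NatIso.ofComponents (F := Diag k A) (G := Lam k A ⋙ Theta (act k A))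
    (fun M => (diagStr M).thetaIso)
    (fun f => EqStr.thetaIso_naturality (diagMap f) (diagMap_equivariant f))

theorem lamIso_equivariant (M : RepA k A) (s : Characters k A) (x : (diag M).carrier) :
    ((lamIso k A).hom.app M).lin ((diagStr M).τ s x) =
      thetaAct ((Lam k A).obj M) s (((lamIso k A).hom.app M).lin x) :=
  (diagStr M).thetaIso_equivariant s x

theorem lamIso_inv_equivariant (M : RepA k A) (s : Characters k A)
    (x : ((Theta (act k A)).obj ((Lam k A).obj M)).carrier) :
    ((lamIso k A).inv.app M).lin (thetaAct ((Lam k A).obj M) s x) =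
      (diagStr M).τ s (((lamIso k A).inv.app M).lin x) :=
  (diagStr M).thetaIso_equivariant.inv s x

theorem diag_μ_lin (M N : RepA k A) :
    (Functor.LaxMonoidal.μ (Diag k A) M N).lin = unsplit M N := by
  refine LinearMap.ext fun z => ?_
  refine (LinearMap.congr_fun (unsplit_split M N)
    ((Functor.LaxMonoidal.μ (Diag k A) M N).lin z)).symm.trans ?_
  refine congrArg (unsplit M N) ?_
  exact LinearMap.congr_fun (congrArg Bim.Hom.lin (Functor.Monoidal.μ_δ (Diag k A) M N)) z

theorem unsplit_equivariant (M N : RepA k A) (g : Characters k A) (x : (diag M).carrier)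
    (y : (diag N).carrier) :
    unsplit M N (tmk (diag M) (diag N) ((diagStr M).τ g x) ((diagStr N).τ g y)) =
      (diagStr (M ⊗ N)).τ g (unsplit M N (tmk (diag M) (diag N) x y)) := by
  induction x using TensorProduct.induction_on with
  | zero =>
    have h : ∀ z, unsplit M N (tmk (diag M) (diag N) 0 z) = 0 := fun z => by simp
    rw [show (0 : M.carrier ⊗[k] A) = (0 : (diag M).carrier) from rfl, map_zero, h, h]
    exact (map_zero ((diagStr (M ⊗ N)).τ g)).symm
  | add x z hx hz =>
    have h : ∀ x y z, unsplit M N (tmk (diag M) (diag N) (x + y) z) =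
      unsplit M N (tmk (diag M) (diag N) x z) + unsplit M N (tmk (diag M) (diag N) y z) :=
      fun x y z => by simp
    refine (congrArg (fun t => unsplit M N (tmk (diag M) (diag N) t _)) (map_add _ x z)).trans ?_
    refine (h _ _ _).trans ((congrArg₂ (· + ·) hx hz).trans ?_)
    exact (map_add _ _ _).symm.trans (congrArg _ (h _ _ _).symm)
  | tmul m p =>
    apply (TensorProduct.assoc k M.carrier N.carrier A).injective
    have e : ∀ z, TensorProduct.assoc k M.carrier N.carrier A ((diagStr (M ⊗ N)).τ g z) =
        TensorProduct.map LinearMap.id ((diagStr N).τ g)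
          (TensorProduct.assoc k M.carrier N.carrier A z) := fun z =>
      LinearMap.congr_fun
        (f := (TensorProduct.assoc k M.carrier N.carrier A).toLinearMap ∘ₗ
          (diagStr (M ⊗ N)).τ g)
        (g := TensorProduct.map LinearMap.id ((diagStr N).τ g) ∘ₗ
          (TensorProduct.assoc k M.carrier N.carrier A).toLinearMap)
        (diag_ext_tensor fun _ _ _ => rfl) z
    refine (unsplit_tmul M N m _ _).trans (Eq.trans ?_ ((e _).trans
      (congrArg (TensorProduct.map LinearMap.id ((diagStr N).τ g)) (unsplit_tmul M N m p y))).symm)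
    refine congrArg (fun t => m ⊗ₜ[k] t) ?_
    exact ((diagStr N).τ_l g p y).symm

theorem diag_ε_equivariant (g : Characters k A) (a : A) :
    (Functor.LaxMonoidal.ε (Diag k A)).lin (act k A g a) =
      (diagStr (𝟙_ (RepA k A))).τ g ((Functor.LaxMonoidal.ε (Diag k A)).lin a) := by
  have h : IsEquivariant (diagStr (𝟙_ (RepA k A))).τ
      (fun g => (act k A g).toLinearMap : Characters k A → A →ₗ[k] A)
      (Functor.Monoidal.εIso (Diag k A)).symm.hom := fun g =>
    LinearMap.congr_fun (f := (diagUnit (k := k) (A := A)).lin ∘ₗ (diagStr (𝟙_ (RepA k A))).τ g)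
      (g := (act k A g).toLinearMap ∘ₗ (diagUnit (k := k) (A := A)).lin)
      (diag_ext fun (c : k) b => (map_smul (act k A g) c b).symm)
  exact h.inv g a

theorem exists_lam_tensor (M N : RepA k A) :
    ∃ m : (Lam k A).obj M ⊗ (Lam k A).obj N ≅ (Lam k A).obj (M ⊗ N),
      Functor.LaxMonoidal.μ (Theta (act k A)) _ _ ≫ (Theta (act k A)).map m.hom =
        ((Functor.Monoidal.coreMonoidalTransport (lamIso k A)).μIso M N).hom := by
  refine exists_tensor_lift _ fun s x y => ?_
  have e : ∀ x y, ((Functor.Monoidal.coreMonoidalTransport (lamIso k A)).μIso M N).hom.lin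
      (tmk _ _ x y) = ((lamIso k A).hom.app (M ⊗ N)).lin (unsplit M N (tmk (diag M) (diag N)
        (((lamIso k A).inv.app M).lin x) (((lamIso k A).inv.app N).lin y))) := fun x y =>
    congrArg ((lamIso k A).hom.app (M ⊗ N)).lin (LinearMap.congr_fun (diag_μ_lin M N) _)
  refine (e _ _).trans (Eq.trans ?_ (congrArg _ (e x y)).symm)
  refine (congrArg₂ (fun x y => ((lamIso k A).hom.app (M ⊗ N)).lin
    (unsplit M N (tmk (diag M) (diag N) x y))) (lamIso_inv_equivariant M s x)
    (lamIso_inv_equivariant N s y)).trans ?_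
  exact (congrArg _ (unsplit_equivariant M N s _ _)).trans (lamIso_equivariant (M ⊗ N) s _)

theorem exists_lam_unit :
    ∃ m : 𝟙_ (XA (act k A)) ≅ (Lam k A).obj (𝟙_ (RepA k A)),
      Functor.LaxMonoidal.ε (Theta (act k A)) ≫ (Theta (act k A)).map m.hom =
        (Functor.Monoidal.coreMonoidalTransport (lamIso k A)).εIso.hom := by
  refine exists_unit_lift _ fun s a => ?_
  refine Eq.trans (congrArg ((lamIso k A).hom.app (𝟙_ _)).lin (diag_ε_equivariant s a)) ?_
  exact lamIso_equivariant (𝟙_ (RepA k A)) s _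

/-- `Λ` is a pseudofunctor: the comparison isomorphisms of `M ↦ M ⊗ A` are compatible with the
actions of `G`, so they lift along `Θ`. -/
instance : (Lam k A).Monoidal :=
  (coreMonoidalOfFaithful (Lam k A) (Theta (act k A))
    (Functor.Monoidal.coreMonoidalTransport (lamIso k A))
    (fun M N => (exists_lam_tensor M N).choose) exists_lam_unit.choose
    (fun M N => (exists_lam_tensor M N).choose_spec) exists_lam_unit.choose_spec).toMonoidal

instance : NatTrans.IsMonoidal (lamIso k A).hom :=
  isMonoidal_of_lift _ _ _ _ (fun M N => (exists_lam_tensor M N).choose_spec)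
    exists_lam_unit.choose_spec

variable (k A) in
/-- The isomorphism `Γ ≅ Θ ∘ Λ`. -/
def gammaLam : Gamma k A ≅ Lam k A ⋙ Theta (act k A) := gammaDiag ≪≫ lamIso k A

instance : NatTrans.IsMonoidal (gammaLam k A).hom := by
  have h : NatTrans.IsMonoidal (gammaDiag (k := k) (A := A)).hom :=
    { unit := by
        change (Functor.LaxMonoidal.ε (Diag k A) ≫ gammaDiag.inv.app _) ≫ gammaDiag.hom.app _ = _
        simp
      tensor := fun X Y => by
        change ((gammaDiag.hom.app X ⊗ₘ gammaDiag.hom.app Y) ≫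
          Functor.LaxMonoidal.μ (Diag k A) X Y ≫ gammaDiag.inv.app _) ≫ gammaDiag.hom.app _ = _
        simp }
  exact NatTrans.IsMonoidal.comp _ _

end Lambda

/-! ### Recovering `M` from `M ⊗ A` -/

section Undiag

variable {k A : Type u} [Field k] [Ring A] [HopfAlgebra k A] [Module.Finite k A]

/-- The projection `M ⊗ A → M`, `m ⊗ a ↦ ε(a) m`. -/
def diagCounit (M : RepA k A) : (diag M).carrier →ₗ[k] M.carrier :=
  (TensorProduct.rid k M.carrier).toLinearMap ∘ₗ TensorProduct.map LinearMap.id Coalgebra.counit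

theorem diagCounit_tmul (M : RepA k A) (m : M.carrier) (a : A) :
    diagCounit M (m ⊗ₜ[k] a) = Coalgebra.counit (R := k) a • m := rfl

theorem diagCounit_l (M : RepA k A) (a : A) (z : (diag M).carrier) :
    diagCounit M ((diag M).l a z) = M.ρ a (diagCounit M z) := by
  refine (congrArg (TensorProduct.rid k M.carrier) (act₂_nat (ρ' := M.ρ) (τ' := actCounit k A)
    LinearMap.id Coalgebra.counit (fun _ _ => rfl) (fun x y => ?_) _ z)).trans
    (actComul_counit_right M.ρ a _)
  exact Bialgebra.counit_mul x y

theorem diagCounit_r (M : RepA k A) (a : A) (z : (diag M).carrier) :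
    diagCounit M ((diag M).r (op a) z) = Coalgebra.counit (R := k) a • diagCounit M z := by
  refine LinearMap.congr_fun (f := diagCounit M ∘ₗ (diag M).r (op a))
    (g := Coalgebra.counit (R := k) a • diagCounit M) (diag_ext fun m b => ?_) z
  change Coalgebra.counit (R := k) (b * a) • m =
    Coalgebra.counit (R := k) a • Coalgebra.counit (R := k) b • m
  rw [Bialgebra.counit_mul, mul_comm, mul_smul]

/-- The homomorphism `M → N` that a homomorphism `M ⊗ A → N ⊗ A` of bimodules induces on the
quotients `M = (M ⊗ A) ⊗_A k` and `N = (N ⊗ A) ⊗_A k`. -/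
def undiagLin {M N : RepA k A} (f : diag M ⟶ diag N) : M.carrier →ₗ[k] N.carrier :=
  diagCounit N ∘ₗ f.lin ∘ₗ (TensorProduct.mk k M.carrier A).flip 1

theorem undiagLin_counit {M N : RepA k A} (f : diag M ⟶ diag N) (z : (diag M).carrier) :
    undiagLin f (diagCounit M z) = diagCounit N (f.lin z) := by
  refine LinearMap.congr_fun (f := undiagLin f ∘ₗ diagCounit M) (g := diagCounit N ∘ₗ f.lin)
    (diag_ext fun m b => ?_) z
  have h : (m ⊗ₜ[k] b : (diag M).carrier) = (diag M).r (op b) (m ⊗ₜ[k] (1 : A)) :=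
    congrArg (fun t => m ⊗ₜ[k] t) (one_mul b).symm
  change undiagLin f (Coalgebra.counit (R := k) b • m) = diagCounit N (f.lin (m ⊗ₜ[k] b))
  refine (map_smul _ _ _).trans (Eq.trans ?_ (congrArg (fun t => diagCounit N (f.lin t)) h).symm)
  exact ((congrArg (diagCounit N) (f.map_r _ _)).trans (diagCounit_r N b _)).symm

theorem diagCounit_one (M : RepA k A) (m : M.carrier) : diagCounit M (m ⊗ₜ[k] (1 : A)) = m := by
  rw [diagCounit_tmul, Bialgebra.counit_one, one_smul]

/-- `undiagLin` as a homomorphism of modules. -/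
def undiag {M N : RepA k A} (f : diag M ⟶ diag N) : M ⟶ N where
  lin := undiagLin f
  map_ρ a m := by
    have h := diagCounit_l M a (m ⊗ₜ[k] (1 : A))
    rw [diagCounit_one] at h
    rw [← h, undiagLin_counit]
    exact (congrArg (diagCounit N) (f.map_l _ _)).trans (diagCounit_l N a _)

theorem undiag_comp_lin {M N : RepA k A} (f : diag M ⟶ diag N) (g : diag N ⟶ diag M)
    (h : f ≫ g = 𝟙 _) : undiag f ≫ undiag g = 𝟙 _ := by
  refine RepA.hom_ext (LinearMap.ext fun m => ?_)
  refine (undiagLin_counit g _).trans ?_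
  refine Eq.trans ?_ (diagCounit_one M m)
  exact congrArg _ (LinearMap.congr_fun (congrArg Bim.Hom.lin h) (m ⊗ₜ[k] (1 : A)))

/-- `M` is determined up to isomorphism by the bimodule `M ⊗ A`. -/
def undiagIso {M N : RepA k A} (e : diag M ≅ diag N) : M ≅ N where
  hom := undiag e.hom
  inv := undiag e.inv
  hom_inv_id := undiag_comp_lin _ _ e.hom_inv_id
  inv_hom_id := undiag_comp_lin _ _ e.inv_hom_id

theorem undiag_diagMap {M N : RepA k A} (f : M ⟶ N) : undiag (diagMap f) = f :=
  RepA.hom_ext (LinearMap.ext fun m => diagCounit_one N (f.lin m))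

instance : (Diag k A).Faithful where
  map_injective {M N f g} h := by
    rw [← undiag_diagMap f, ← undiag_diagMap g]
    exact congrArg undiag h

variable [NeZero (Nat.card (Characters k A) : k)]

instance : (Lam k A).Faithful := Functor.Faithful.of_comp_iso (lamIso k A).symm

theorem nonempty_iso_of_lam {M N : RepA k A} (h : Nonempty ((Lam k A).obj M ≅ (Lam k A).obj N)) :
    Nonempty (M ≅ N) := by
  obtain ⟨e⟩ := h
  exact ⟨undiagIso ((lamIso k A).app M ≪≫ (Theta (Characters.act k A)).mapIso e ≪≫
    ((lamIso k A).app N).symm)⟩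

end Undiag

/-! ### The free bimodule -/

section Free

variable {k A : Type u} [Field k] [Ring A] [Algebra k A]

/-- The action of `A ⊗ Aᵒᵖ` on an `A`-`A`-bimodule. -/
def Bim.act (M : Bim k A) : A ⊗[k] Aᵐᵒᵖ →ₐ[k] Module.End k M.carrier :=
  Algebra.TensorProduct.lift M.l M.r (fun a b => LinearMap.ext fun m => M.l_r a b m)

theorem Bim.act_tmul (M : Bim k A) (a : A) (b : Aᵐᵒᵖ) (m : M.carrier) :
    M.act (a ⊗ₜ b) m = M.l a (M.r b m) :=
  LinearMap.congr_fun (Algebra.TensorProduct.lift_tmul _ _ _ a b) m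

theorem Bim.hom_act {M N : Bim k A} (f : M ⟶ N) (z : A ⊗[k] Aᵐᵒᵖ) (m : M.carrier) :
    f.lin (M.act z m) = N.act z (f.lin m) := by
  induction z with
  | zero => simp
  | add x y hx hy => simp only [map_add, LinearMap.add_apply, hx, hy]
  | tmul a b => simp only [Bim.act_tmul, Bim.hom_l, Bim.hom_r]

variable (k A) [Module.Finite k A]

instance : Module.Finite k Aᵐᵒᵖ := Module.Finite.equiv (opLinearEquiv k)

/-- The free bimodule of rank one, with underlying space `A ⊗ Aᵒᵖ`. -/
def freeB : Bim k A where
  carrier := A ⊗[k] Aᵐᵒᵖ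
  l := (Algebra.lmul k (A ⊗[k] Aᵐᵒᵖ)).comp Algebra.TensorProduct.includeLeft
  r := (Algebra.lmul k (A ⊗[k] Aᵐᵒᵖ)).comp Algebra.TensorProduct.includeRight
  l_r a b m := by
    change (a ⊗ₜ[k] (1 : Aᵐᵒᵖ)) * (((1 : A) ⊗ₜ[k] b) * m) =
      ((1 : A) ⊗ₜ[k] b) * ((a ⊗ₜ[k] (1 : Aᵐᵒᵖ)) * m)
    rw [← mul_assoc, ← mul_assoc]
    simp

variable {k A}

theorem freeB_act (z w : A ⊗[k] Aᵐᵒᵖ) : (freeB k A).act z w = z * w := by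
  induction z with
  | zero => rw [map_zero, zero_mul]; rfl
  | add x y hx hy => rw [map_add, add_mul, ← hx, ← hy]; rfl
  | tmul a b =>
    refine (Bim.act_tmul _ a b _).trans ?_
    change (a ⊗ₜ[k] (1 : Aᵐᵒᵖ)) * (((1 : A) ⊗ₜ[k] b) * w) = _
    rw [← mul_assoc]
    simp

/-- The homomorphism from the free bimodule that sends the generator to `m`. -/
def freeHom {M : Bim k A} (m : M.carrier) : freeB k A ⟶ M where
  lin := (LinearMap.flip M.act.toLinearMap) m
  map_l a (z : A ⊗[k] Aᵐᵒᵖ) := by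
    change M.act ((a ⊗ₜ 1) * z) m = _
    rw [map_mul]
    refine (Bim.act_tmul _ _ _ _).trans ?_
    rw [map_one]
    rfl
  map_r b (z : A ⊗[k] Aᵐᵒᵖ) := by
    change M.act ((1 ⊗ₜ b) * z) m = _
    rw [map_mul]
    refine (Bim.act_tmul _ _ _ _).trans ?_
    rw [map_one]
    rfl

/-- The two descriptions of the free bimodule are isomorphic. -/
def freeIso : Bim.free k A ≅ freeB k A :=
  isoOfInv (M := Bim.free k A) (N := freeB k A)
    { lin := (opLinearEquiv k).toLinearMap.lTensor A
      map_l := fun a => by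
        refine LinearMap.congr_fun
          (f := (opLinearEquiv k).toLinearMap.lTensor A ∘ₗ (Bim.free k A).l a)
          (g := (freeB k A).l a ∘ₗ (opLinearEquiv k).toLinearMap.lTensor A)
          (TensorProduct.ext' fun x y => ?_)
        change (a * x) ⊗ₜ[k] op y = (a ⊗ₜ[k] (1 : Aᵐᵒᵖ)) * (x ⊗ₜ[k] op y)
        simp
      map_r := fun b => by
        refine LinearMap.congr_fun
          (f := (opLinearEquiv k).toLinearMap.lTensor A ∘ₗ (Bim.free k A).r b)
          (g := (freeB k A).r b ∘ₗ (opLinearEquiv k).toLinearMap.lTensor A)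
          (TensorProduct.ext' fun x y => ?_)
        change x ⊗ₜ[k] op (y * b.unop) = ((1 : A) ⊗ₜ[k] b) * (x ⊗ₜ[k] op y)
        simp }
    ((opLinearEquiv k).symm.toLinearMap.lTensor A)
    (LinearMap.congr_fun (f := (opLinearEquiv k).symm.toLinearMap.lTensor A ∘ₗ
      (opLinearEquiv k).toLinearMap.lTensor A) (g := LinearMap.id)
      (TensorProduct.ext' fun x y => rfl))
    (LinearMap.congr_fun (f := (opLinearEquiv k).toLinearMap.lTensor A ∘ₗ
      (opLinearEquiv k).symm.toLinearMap.lTensor A) (g := LinearMap.id)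
      (TensorProduct.ext' fun x y => rfl))

end Free

section Kappa

variable (k A : Type u) [Field k] [Ring A] [HopfAlgebra k A] [Module.Finite k A]

theorem straightBil_eq_act {k A : Type u} [Field k] [Ring A] [HopfAlgebra k A]
    [Module.Finite k A] (z : A ⊗[k] Aᵐᵒᵖ) (v : A) :
    straightBil (Algebra.lmul k A) z v = (diag (RepA.reg k A)).act z (v ⊗ₜ[k] (1 : A)) := by
  induction z with
  | zero => rw [map_zero, map_zero]; rfl
  | add x y hx hy => rw [map_add, map_add, LinearMap.add_apply, hx, hy]; rfl
  | tmul a b =>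
    obtain ⟨b, rfl⟩ := op_surjective b
    refine Eq.trans ?_ (Bim.act_tmul (diag (RepA.reg k A)) a (op b) (v ⊗ₜ[k] (1 : A))).symm
    exact congrArg ((diag (RepA.reg k A)).l a)
      (congrArg (fun t : A => v ⊗ₜ[k] t) (one_mul b).symm)

/-- The homomorphism `A ⊗ Aᵒᵖ → A ⊗ A`, `a ⊗ b ↦ a · (1 ⊗ b)`, to the bimodule `Λ(A)`. -/
def kappaHom : freeB k A ⟶ diag (RepA.reg k A) :=
  freeHom (M := diag (RepA.reg k A)) ((1 : A) ⊗ₜ[k] (1 : A))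

theorem kappaHom_lin (z : A ⊗[k] Aᵐᵒᵖ) :
    (kappaHom k A).lin z = straightBil (Algebra.lmul k A) z 1 :=
  (straightBil_eq_act z 1).symm

/-- The homomorphism `(z, v) ↦ z φ(v)` from `Γ(A)` to `A ⊗ Aᵒᵖ`. -/
def gammaReg : BT (phiRight k A) (Algebra.lmul k A) →ₗ[k] A ⊗[k] Aᵐᵒᵖ :=
  BT.lift ((LinearMap.mul k (A ⊗[k] Aᵐᵒᵖ)).compl₂ (phi k A).toLinearMap) (fun a v w => by
    simp [mul_assoc])

theorem kappa_gammaReg (t : BT (phiRight k A) (Algebra.lmul k A)) :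
    (kappaHom k A).lin (gammaReg k A t) = straight (Algebra.lmul k A) t := by
  induction t using BT.induction with
  | add x y hx hy =>
    rw [map_add, map_add, ← hx, ← hy]
    exact map_add _ _ _
  | mk z v =>
    refine (kappaHom_lin k A _).trans ?_
    refine (straightBil_bal (Algebra.lmul k A) v z 1).trans ?_
    exact congrArg (straightBil (Algebra.lmul k A) z) (mul_one v)

/-- The bimodule `Λ(A)` is free of rank one on `1 ⊗ 1`. -/
def kappa : freeB k A ≅ diag (RepA.reg k A) :=
  isoOfInv (kappaHom k A) (gammaReg k A ∘ₗ straightInv (Algebra.lmul k A))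
    (fun (z : A ⊗[k] Aᵐᵒᵖ) => by
      have h : (kappaHom k A).lin z =
          straight (Algebra.lmul k A) (BT.mk (phiRight k A) (Algebra.lmul k A) z (1 : A)) :=
        kappaHom_lin k A z
      refine (congrArg (fun t => gammaReg k A (straightInv (Algebra.lmul k A) t)) h).trans ?_
      refine (congrArg (gammaReg k A) (straightInv_straight _ _)).trans ?_
      change z * phi k A 1 = z
      rw [map_one, mul_one])
    (fun w => (kappa_gammaReg k A _).trans (straight_straightInv _ w))

end Kappa

/-! ### The additive closure `H_A` -/

section HA

variable {k A : Type u} [Field k] [Ring A] [HopfAlgebra k A]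

instance : MonoidalPreadditive (RepA k A) where
  whiskerLeft_zero := RepA.hom_ext (RepA.ten_ext fun m n => TensorProduct.tmul_zero _ m)
  zero_whiskerRight := RepA.hom_ext (RepA.ten_ext fun m n => TensorProduct.zero_tmul _ n)
  whiskerLeft_add f g := RepA.hom_ext (RepA.ten_ext fun m n => TensorProduct.tmul_add m _ _)
  add_whiskerRight f g := RepA.hom_ext (RepA.ten_ext fun m n => TensorProduct.add_tmul _ _ n)

namespace RepA

/-- The direct sum of two modules. -/
def prod (M N : RepA k A) : RepA k A where
  carrier := M.carrier × N.carrier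
  ρ := AlgHom.ofLinearMap
    { toFun := fun a => (M.ρ a).prodMap (N.ρ a)
      map_add' := fun _ _ => by ext <;> simp
      map_smul' := fun _ _ => by ext <;> simp }
    (by ext <;> simp) (fun _ _ => by ext <;> simp)

/-- The inclusion of the first summand. -/
def inl (M N : RepA k A) : M ⟶ prod M N where
  lin := LinearMap.inl k M.carrier N.carrier
  map_ρ a m := Prod.ext rfl (map_zero (N.ρ a)).symm

/-- The inclusion of the second summand. -/
def inr (M N : RepA k A) : N ⟶ prod M N where
  lin := LinearMap.inr k M.carrier N.carrier
  map_ρ a m := Prod.ext (map_zero (M.ρ a)).symm rfl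

/-- The projection to the first summand. -/
def fst (M N : RepA k A) : prod M N ⟶ M where
  lin := LinearMap.fst k M.carrier N.carrier
  map_ρ a m := rfl

/-- The projection to the second summand. -/
def snd (M N : RepA k A) : prod M N ⟶ N where
  lin := LinearMap.snd k M.carrier N.carrier
  map_ρ a m := rfl

theorem inl_fst (M N : RepA k A) : inl M N ≫ fst M N = 𝟙 M := rfl

theorem inr_snd (M N : RepA k A) : inr M N ≫ snd M N = 𝟙 N := rfl

theorem prod_total (M N : RepA k A) : fst M N ≫ inl M N + snd M N ≫ inr M N = 𝟙 _ :=
  hom_ext (LinearMap.ext fun m => Prod.ext (add_zero _) (zero_add _))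

variable (k A) in
/-- The zero module. -/
def zero : RepA k A where
  carrier := PUnit
  ρ := AlgHom.ofLinearMap 0 (by ext) (fun _ _ => by ext)

theorem id_zero : 𝟙 (zero k A) = 0 := hom_ext (LinearMap.ext fun _ => rfl)

variable [Module.Finite k A]

/-- The homomorphism `A → M`, `a ↦ a m`. -/
def ofElement (M : RepA k A) (m : M.carrier) : reg k A ⟶ M where
  lin := (LinearMap.flip M.ρ.toLinearMap) m
  map_ρ a b := LinearMap.congr_fun (map_mul M.ρ a b) m

/-- Right multiplication by `v`, as an endomorphism of the regular module. -/
def mulRight (v : A) : reg k A ⟶ reg k A where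
  lin := LinearMap.mulRight k v
  map_ρ a b := mul_assoc a b v

/-- The left ideal `A v`. -/
def leftIdeal (v : A) : RepA k A where
  carrier := LinearMap.range (LinearMap.mulRight k v)
  ρ := AlgHom.ofLinearMap
    { toFun := fun a => (LinearMap.mulLeft k a).restrict (p := LinearMap.range _)
        (q := LinearMap.range _) (by rintro _ ⟨b, rfl⟩; exact ⟨a * b, by simp [mul_assoc]⟩)
      map_add' := fun _ _ => by ext; simp [add_mul]
      map_smul' := fun _ _ => by ext; simp }
    (by ext; simp) (fun _ _ => by ext; simp [mul_assoc])

/-- The inclusion `A v → A`. -/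
def leftIdealι (v : A) : leftIdeal (k := k) v ⟶ reg k A where
  lin := Submodule.subtype _
  map_ρ _ _ := rfl

/-- The homomorphism `A → A v`, `a ↦ a v`. -/
def leftIdealπ (v : A) : reg k A ⟶ leftIdeal (k := k) v where
  lin := LinearMap.rangeRestrict (LinearMap.mulRight k v)
  map_ρ a b := Subtype.ext (mul_assoc a b v)

theorem leftIdealπ_ι (v : A) : leftIdealπ (k := k) v ≫ leftIdealι v = mulRight v := rfl

theorem leftIdealι_π {v : A} (hv : v * v = v) : leftIdealι (k := k) v ≫ leftIdealπ v = 𝟙 _ := by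
  refine hom_ext (LinearMap.ext ?_)
  rintro ⟨_, b, rfl⟩
  exact Subtype.ext (by change b * v * v = b * v; rw [mul_assoc, hv])

end RepA

variable [Module.Finite k A]

theorem HA.leftIdeal {v : A} (hv : v * v = v) : HA k A (RepA.leftIdeal v) :=
  AddClosure.of_retract _ _ (RepA.leftIdealι_π hv) (Or.inr rfl)

theorem HA.prod {M N : RepA k A} (hM : HA k A M) (hN : HA k A N) : HA k A (M.prod N) :=
  AddClosure.add (RepA.inl M N) (RepA.fst M N) (RepA.inr M N) (RepA.snd M N)
    (RepA.prod_total M N) hM hN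

theorem HA.zero : HA k A (RepA.zero k A) := AddClosure.of_id_eq_zero RepA.id_zero

/-- The homomorphism `A ⊗ A → A` of left modules given by the coordinate `c` of the second factor
of `A ⊗ Aᵒᵖ`. -/
def coordHom (c : A →ₗ[k] k) : RepA.reg k A ⊗ RepA.reg k A ⟶ RepA.reg k A where
  lin := (TensorProduct.rid k A).toLinearMap ∘ₗ
    TensorProduct.map LinearMap.id (c ∘ₗ (opLinearEquiv k).symm.toLinearMap) ∘ₗ
    (kappa k A).inv.lin
  map_ρ a z := by
    have e : ∀ z : A ⊗[k] Aᵐᵒᵖ, (TensorProduct.rid k A) (TensorProduct.map LinearMap.id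
        (c ∘ₗ (opLinearEquiv k).symm.toLinearMap) ((a ⊗ₜ[k] (1 : Aᵐᵒᵖ)) * z)) =
        a * (TensorProduct.rid k A) (TensorProduct.map LinearMap.id
          (c ∘ₗ (opLinearEquiv k).symm.toLinearMap) z) := by
      intro z
      induction z with
      | zero => simp
      | add x y hx hy => simp only [map_add, mul_add, hx, hy]
      | tmul x y => simp
    exact (congrArg (fun t => (TensorProduct.rid k A) (TensorProduct.map LinearMap.id
      (c ∘ₗ (opLinearEquiv k).symm.toLinearMap) t)) ((kappa k A).inv.map_l a z)).trans (e _)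

theorem HA_reg_tensor_reg : HA k A (RepA.reg k A ⊗ RepA.reg k A) := by
  let b := Module.finBasis k A
  -- the elements `1 ⊗ b j` form a basis of `A ⊗ A` as a left module
  refine AddClosure.of_fintype (fun _ => RepA.reg k A) (fun j => coordHom (b.coord j))
    (fun j => RepA.ofElement _ ((1 : A) ⊗ₜ[k] b j)) (fun _ => Or.inr rfl) ?_
  have hsum : ∀ (M N : RepA k A) (f : Fin (Module.finrank k A) → (M ⟶ N)) (m : M.carrier),
      (∑ j, f j).lin m = ∑ j, (f j).lin m := fun M N f m => by
    have h : (∑ j, f j).lin = ∑ j, (f j).lin :=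
      map_sum (⟨⟨fun g : M ⟶ N => g.lin, rfl⟩, fun _ _ => rfl⟩ : (M ⟶ N) →+ _) f _
    rw [h, LinearMap.sum_apply]
  refine RepA.hom_ext (LinearMap.ext fun w => (hsum _ _ _ w).trans ?_)
  have h : ∀ z : A ⊗[k] Aᵐᵒᵖ, ∑ j, actComul (Algebra.lmul k A) (Algebra.lmul k A)
      ((TensorProduct.rid k A) (TensorProduct.map LinearMap.id
        (b.coord j ∘ₗ (opLinearEquiv k).symm.toLinearMap) z)) ((1 : A) ⊗ₜ[k] b j) =
      (kappa k A).hom.lin z := by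
    intro z
    induction z with
    | zero => simp only [map_zero, LinearMap.zero_apply, Finset.sum_const_zero]; rfl
    | add x y hx hy =>
      simp only [map_add, LinearMap.add_apply, Finset.sum_add_distrib, hx, hy]
      exact (map_add (kappa k A).hom.lin x y).symm
    | tmul x y =>
      obtain ⟨y, rfl⟩ := op_surjective y
      refine Eq.trans ?_ (kappaHom_lin k A (x ⊗ₜ op y)).symm
      rw [straightBil_tmul]
      conv_rhs => rw [← b.sum_repr y, TensorProduct.tmul_sum, map_sum]
      simp
  refine (h ((kappa k A).inv.lin w)).trans ?_
  exact LinearMap.congr_fun (congrArg Bim.Hom.lin (kappa k A).inv_hom_id) w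

instance : (HA k A).IsMonoidal where
  prop_unit := AddClosure.of_mem (Or.inl rfl)
  prop_tensor X Y hX hY := by
    refine AddClosure.tensor (fun X Y hX hY => ?_) hX hY
    rcases hX with rfl | rfl
    · exact AddClosure.iso (λ_ Y) (AddClosure.of_mem hY)
    · rcases hY with rfl | rfl
      · exact AddClosure.iso (ρ_ _) (AddClosure.of_mem (Or.inr rfl))
      · exact HA_reg_tensor_reg

/-! ### `Λ` maps `H_A` to `G_A` -/

variable [NeZero (Nat.card (Characters k A) : k)]

theorem freeXA_iso : Nonempty (freeXA (Characters.act k A) ≅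
    (toKaroubi (Skew (Characters.act k A))).obj ⟨freeB k A⟩) := by
  refine ⟨(toKaroubi _).mapIso ⟨Skew.incl (M := ⟨Bim.free k A⟩) (N := ⟨freeB k A⟩) freeIso.hom,
    Skew.incl (M := ⟨freeB k A⟩) (N := ⟨Bim.free k A⟩) freeIso.inv, ?_, ?_⟩⟩
  · rw [incl_comp]; exact congrArg Skew.incl freeIso.hom_inv_id
  · rw [incl_comp]; exact congrArg Skew.incl freeIso.inv_hom_id

theorem GA_lam_reg : GA (Characters.act k A) ((Lam k A).obj (RepA.reg k A)) := by
  obtain ⟨e⟩ := freeXA_iso (k := k) (A := A)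
  let Y := (toKaroubi (Skew (Characters.act k A))).obj ⟨diag (RepA.reg k A)⟩
  let c : (⟨freeB k A⟩ : Skew (Characters.act k A)) ⟶ ⟨diag (RepA.reg k A)⟩ :=
    Skew.incl (kappa k A).hom
  let d : (⟨diag (RepA.reg k A)⟩ : Skew (Characters.act k A)) ⟶ ⟨freeB k A⟩ :=
    Skew.incl (kappa k A).inv
  have hdc : d ≫ c = 𝟙 _ := by
    rw [incl_comp]; exact congrArg Skew.incl (kappa k A).inv_hom_id
  have h : AddClosure (fun X => X = freeXA (Characters.act k A)) Y :=
    AddClosure.of_retract ((toKaroubi _).map d ≫ e.inv) (e.hom ≫ (toKaroubi _).map c)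
      (by rw [Category.assoc, e.inv_hom_id_assoc, ← Functor.map_comp, hdc,
        CategoryTheory.Functor.map_id]) rfl
  refine AddClosure.trans (fun X hX => AddClosure.of_mem (Or.inr hX)) (AddClosure.retract
    (Y := Y) (Karoubi.decompId_i ((Lam k A).obj (RepA.reg k A)))
    (Karoubi.decompId_p ((Lam k A).obj (RepA.reg k A))) ?_ h)
  exact (Karoubi.decompId _).symm

theorem GA_lam {M : RepA k A} (hM : HA k A M) : GA (Characters.act k A) ((Lam k A).obj M) := by
  refine AddClosure.map (Lam k A) (fun Y hY => ?_) hM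
  rcases hY with rfl | rfl
  · exact AddClosure.iso (Functor.Monoidal.εIso (Lam k A)).symm (AddClosure.of_mem (Or.inl rfl))
  · exact GA_lam_reg

end HA

/-! ### Characters and the radical -/

section Radical

variable {k A : Type u} [Field k] [Ring A] [HopfAlgebra k A] [Module.Finite k A]

open Characters

theorem isNilpotent_jacobson (k : Type*) {A : Type*} [Field k] [Ring A] [Algebra k A]
    [Module.Finite k A] : IsNilpotent (Ring.jacobson A) := by
  have : IsArtinianRing A := IsArtinianRing.of_finite k A
  have h := IsArtinianRing.isNilpotent_jacobson_bot (R := A)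
  rwa [Ideal.jacobson_bot] at h

theorem hom_eq_zero_of_mem_jacobson (χ : Characters k A) {a : A} (ha : a ∈ Ring.jacobson A) :
    χ.hom a = 0 := by
  obtain ⟨n, hn⟩ := isNilpotent_jacobson k (A := A)
  have h : a ^ n ∈ Ring.jacobson A ^ n := Ideal.pow_mem_pow ha n
  rw [hn] at h
  have h' : χ.hom a ^ n = 0 := by
    rw [← map_pow, (Submodule.mem_bot A).1 h, map_zero]
  exact eq_zero_of_pow_eq_zero h'

/-- The radical of a basic Hopf algebra is the common kernel of its characters. -/
theorem mem_jacobson_of_hom (hA : IsBasic k A) {a : A} (ha : ∀ χ : Characters k A, χ.hom a = 0) :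
    a ∈ Ring.jacobson A := by
  obtain ⟨n, ⟨e⟩⟩ := hA
  have h : e (Ideal.Quotient.mk (Ring.jacobson A) a) = 0 := funext fun i =>
    ha (WithConv.toConv ((Pi.evalAlgHom k (fun _ : Fin n => k) i).comp
      (e.toAlgHom.comp (Ideal.Quotient.mkₐ k (Ring.jacobson A)))))
  exact Ideal.Quotient.eq_zero_iff_mem.1 (e.map_eq_zero_iff.1 h)

/-- By the linear independence of characters, there is a family dual to the characters. -/
theorem exists_dual : ∃ e : Characters k A → A,
    ∀ χ ψ : Characters k A, χ.hom (e ψ) = if χ = ψ then 1 else 0 := by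
  let ev : A →ₗ[k] (Characters k A → k) := LinearMap.pi fun χ => χ.hom.toLinearMap
  suffices h : LinearMap.range ev = ⊤ by
    choose e he using fun ψ : Characters k A => LinearMap.range_eq_top.1 h (Pi.single ψ 1)
    refine ⟨e, fun χ ψ => ?_⟩
    have := congrFun (he ψ) χ
    rw [Pi.single_apply] at this
    exact this
  by_contra h
  have ⟨f, hf, hf'⟩ := Submodule.exists_le_ker_of_lt_top _ (lt_top_iff_ne_top.2 h)
  have hli : LinearIndependent k (fun χ : Characters k A => χ.hom.toLinearMap) :=
    (linearIndependent_toLinearMap k A k).comp _ WithConv.ofConv_injective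
  rw [Fintype.linearIndependent_iff] at hli
  have h₀ := hli (fun χ => f (Pi.single χ 1)) (LinearMap.ext fun a => by
    have h₁ : f (ev a) = 0 := hf' ⟨a, rfl⟩
    rw [LinearMap.pi_apply_eq_sum_univ f] at h₁
    simp only [LinearMap.sum_apply, LinearMap.smul_apply, LinearMap.zero_apply]
    rw [← h₁]
    refine Finset.sum_congr rfl fun χ _ => ?_
    rw [smul_eq_mul, smul_eq_mul, mul_comm]
    congr 2
    ext ψ
    simp [Pi.single_apply, eq_comm])
  refine hf (LinearMap.pi_ext' fun χ => LinearMap.ext_ring ?_)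
  exact h₀ χ

/-- The degree zero part of a radically graded Hopf algebra: a Hopf subalgebra complementary to the
radical. -/
theorem exists_coradical (hA : IsRadicallyGraded k A) : ∃ A₀ : Submodule k A,
    (1 : A) ∈ A₀ ∧ (∀ a ∈ A₀, ∀ b ∈ A₀, a * b ∈ A₀) ∧
    (∀ a ∈ A₀, Coalgebra.comul (R := k) a ∈
      LinearMap.range (TensorProduct.map A₀.subtype A₀.subtype)) ∧
    (∀ a ∈ A₀, HopfAlgebra.antipode k a ∈ A₀) ∧
    (∀ a, ∃ b ∈ A₀, a - b ∈ Ring.jacobson A) ∧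
    ∀ a ∈ A₀, a ∈ Ring.jacobson A → a = 0 := by
  obtain ⟨𝒜, _, hc, _, hs, hr⟩ := hA
  have hr' : ∀ a, a ∈ Ring.jacobson A ↔ a ∈ ⨆ n ≥ 1, 𝒜 n := fun a => by
    have := hr 1 a
    rwa [Submodule.pow_one] at this
  refine ⟨𝒜 0, SetLike.GradedOne.one_mem, fun a ha b hb => ?_, fun a ha => ?_, hs 0, fun a => ?_,
    fun a ha ha' => ?_⟩
  · simpa using SetLike.GradedMul.mul_mem ha hb
  · refine (iSup_le fun p => iSup_le fun hp => ?_ : _ ≤ LinearMap.range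
      (TensorProduct.map (𝒜 0).subtype (𝒜 0).subtype)) (hc 0 a ha)
    obtain ⟨p, q⟩ := p
    obtain ⟨rfl, rfl⟩ : p = 0 ∧ q = 0 := by simpa using hp
    exact le_rfl
  · refine ⟨(DirectSum.decompose 𝒜 a 0 : A), SetLike.coe_mem _, (hr' _).2 ?_⟩
    classical
    have h := DirectSum.sum_support_decompose 𝒜 a
    have h' : a - (DirectSum.decompose 𝒜 a 0 : A) =
        ∑ i ∈ (DirectSum.decompose 𝒜 a).support.erase 0, (DirectSum.decompose 𝒜 a i : A) := by
      rw [sub_eq_iff_eq_add]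
      refine h.symm.trans ?_
      by_cases h₀ : 0 ∈ (DirectSum.decompose 𝒜 a).support
      · exact (Finset.sum_erase_add _ _ h₀).symm
      · rw [Finset.erase_eq_of_notMem h₀, DFinsupp.notMem_support_iff.1 h₀, ZeroMemClass.coe_zero,
          add_zero]
    rw [h']
    refine Submodule.sum_mem _ fun i hi => ?_
    exact Submodule.mem_iSup_of_mem i (Submodule.mem_iSup_of_mem
      (Nat.one_le_iff_ne_zero.2 (Finset.ne_of_mem_erase hi)) (SetLike.coe_mem _))
  · have h := (DirectSum.Decomposition.isInternal 𝒜).submodule_iSupIndep 0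
    rw [Submodule.disjoint_def] at h
    refine h a ha (?_ : a ∈ ⨆ j, ⨆ (_ : j ≠ 0), 𝒜 j)
    have := (hr' a).1 ha'
    exact (iSup_mono fun n => iSup_mono' fun hn => ⟨Nat.one_le_iff_ne_zero.1 hn, le_rfl⟩ :
      (⨆ n ≥ 1, 𝒜 n) ≤ ⨆ n, ⨆ (_ : n ≠ 0), 𝒜 n) this

/-- The character `a ⊗ b ↦ χ(a) ψ(b)` of `A ⊗ Aᵒᵖ`. -/
def bichar (χ ψ : Characters k A) : A ⊗[k] Aᵐᵒᵖ →ₐ[k] k :=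
  Algebra.TensorProduct.lift χ.hom (ψ.hom.fromOpposite fun _ _ => mul_comm _ _)
    (fun _ _ => mul_comm _ _)

theorem bichar_tmul (χ ψ : Characters k A) (a b : A) :
    bichar χ ψ (a ⊗ₜ op b) = χ.hom a * ψ.hom b :=
  Algebra.TensorProduct.lift_tmul _ _ _ _ _

theorem bichar_phi (χ ψ : Characters k A) (a : A) : bichar χ ψ (phi k A a) = (χ * ψ⁻¹).hom a := by
  rw [mul_hom]
  change bichar χ ψ (Algebra.TensorProduct.map (AlgHom.id k A) (HopfAlgebra.antipodeAlgHomOp k A)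
    (Coalgebra.comul a)) = _
  induction Coalgebra.comul (R := k) a with
  | zero => simp
  | add x y hx hy => simp only [map_add, hx, hy]
  | tmul x y => exact bichar_tmul χ ψ x (HopfAlgebra.antipode k y)

/-- A family `e` is a complete system of orthogonal idempotents of `A` indexed by the characters,
on which the Hopf structure is that of the algebra of functions on `G`. -/
structure IsCharacterBasis (e : Characters k A → A) : Prop where
  hom_apply : ∀ χ ψ : Characters k A, χ.hom (e ψ) = if χ = ψ then 1 else 0
  mul : ∀ x y, e x * e y = if x = y then e x else 0
  sum : ∑ x, e x = 1
  act : ∀ g x, act k A g (e x) = e (x * g⁻¹)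
  phi : ∀ h, phi k A (e h) = ∑ u, e u ⊗ₜ op (e (h⁻¹ * u))
  sub_mem : ∀ a, a - ∑ χ : Characters k A, χ.hom a • e χ ∈ Ring.jacobson A

theorem exists_characterBasis (hA : IsBasic k A) (hA' : IsRadicallyGraded k A) :
    ∃ e : Characters k A → A, IsCharacterBasis e := by
  obtain ⟨A₀, h1, hmul, hcomul, hS, hsub, hdisj⟩ := exists_coradical hA'
  obtain ⟨e', he'⟩ := exists_dual (k := k) (A := A)
  choose e he hee using fun x => hsub (e' x)
  have hom_apply : ∀ χ ψ : Characters k A, χ.hom (e ψ) = if χ = ψ then 1 else 0 := fun χ ψ => by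
    rw [← he' χ ψ, eq_comm, ← sub_eq_zero, ← map_sub, hom_eq_zero_of_mem_jacobson χ (hee ψ)]
  -- the elements of `A₀` are separated by the characters
  have ext : ∀ a ∈ A₀, ∀ b ∈ A₀, (∀ χ : Characters k A, χ.hom a = χ.hom b) → a = b :=
    fun a ha b hb h => sub_eq_zero.1 (hdisj _ (A₀.sub_mem ha hb) (mem_jacobson_of_hom hA fun χ => by
      rw [map_sub, h, sub_self]))
  have hom_sum : ∀ (χ : Characters k A) a, χ.hom (∑ ψ : Characters k A, ψ.hom a • e ψ) = χ.hom a :=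
    fun χ a => by simp [hom_apply]
  have sum_mem : ∀ a, ∑ ψ : Characters k A, ψ.hom a • e ψ ∈ A₀ := fun a =>
    A₀.sum_mem fun ψ _ => A₀.smul_mem _ (he ψ)
  have expand : ∀ a ∈ A₀, a = ∑ ψ : Characters k A, ψ.hom a • e ψ := fun a ha =>
    ext a ha _ (sum_mem a) fun χ => (hom_sum χ a).symm
  refine ⟨e, hom_apply, fun x y => ?_, ?_, fun g x => ?_, fun h => ?_, fun a => ?_⟩
  · refine ext _ (hmul _ (he x) _ (he y)) _ (by split_ifs; exacts [he x, A₀.zero_mem]) fun χ => ?_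
    rw [map_mul, hom_apply, hom_apply]
    by_cases hxy : x = y
    · subst hxy
      rw [if_pos rfl, hom_apply]
      split_ifs <;> simp
    · rw [if_neg hxy, map_zero]
      by_cases hx : χ = x
      · rw [if_neg fun h => hxy (hx.symm.trans h), mul_zero]
      · rw [if_neg hx, zero_mul]
  · refine ext _ (A₀.sum_mem fun x _ => he x) _ h1 fun χ => ?_
    simp [hom_apply]
  · refine ext _ ?_ _ (he _) fun χ => ?_
    · obtain ⟨t, ht⟩ := hcomul _ (he x)
      rw [act_apply, ← ht]
      clear ht
      induction t with
      | zero => simp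
      | add x y hx hy => simpa only [map_add] using A₀.add_mem hx hy
      | tmul x y => exact A₀.smul_mem _ x.2
    · rw [Characters.hom_act, hom_apply, hom_apply]
      simp [eq_mul_inv_iff_mul_eq]
  · have key : phi k A (e h) = ∑ u : Characters k A, ∑ w : Characters k A,
        bichar u w (phi k A (e h)) • (e u ⊗ₜ[k] op (e w)) := by
      obtain ⟨t, ht⟩ := hcomul _ (he h)
      have hphi : phi k A (e h) = Algebra.TensorProduct.map (AlgHom.id k A)
        (HopfAlgebra.antipodeAlgHomOp k A) (TensorProduct.map A₀.subtype A₀.subtype t) :=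
        congrArg _ ht.symm
      rw [hphi]
      clear hphi ht
      induction t with
      | zero => simp
      | add x y hx hy =>
        simp only [map_add, add_smul, Finset.sum_add_distrib]
        rw [← hx, ← hy]
      | tmul x y =>
        have hy : HopfAlgebra.antipodeAlgHomOp k A (y : A) = op (HopfAlgebra.antipode k (y : A)) :=
          rfl
        simp only [TensorProduct.map_tmul, Submodule.subtype_apply, Algebra.TensorProduct.map_tmul,
          hy, AlgHom.id_apply, bichar_tmul]
        conv_lhs => rw [expand _ x.2, expand _ (hS _ y.2), Finset.op_sum, TensorProduct.sum_tmul]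
        refine Finset.sum_congr rfl fun u _ => ?_
        rw [TensorProduct.tmul_sum]
        refine Finset.sum_congr rfl fun w _ => ?_
        rw [op_smul, TensorProduct.smul_tmul_smul]
    rw [key]
    refine Finset.sum_congr rfl fun u _ => ?_
    rw [Finset.sum_eq_single (h⁻¹ * u)]
    · rw [bichar_phi, hom_apply, if_pos (by group), one_smul]
    · intro w _ hw
      rw [bichar_phi, hom_apply, if_neg fun h' => hw ?_, zero_smul]
      rw [← h']
      group
    · simp
  · exact mem_jacobson_of_hom hA fun χ => by rw [map_sub, hom_sum, sub_self]

end Radical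

/-! ### Nilpotent filtrations -/

section Filtration

theorem isNilpotent_of_le_jacobson {k R : Type*} [Field k] [Ring R] [Algebra k R]
    [Module.Finite k R] {J : Submodule k R} (h : ∀ a ∈ J, a ∈ Ring.jacobson R) :
    IsNilpotent J := by
  obtain ⟨n, hn⟩ := isNilpotent_jacobson k (A := R)
  have le : ∀ n, J ^ n ≤ (Ring.jacobson R ^ n).restrictScalars k := fun n => by
    induction n with
    | zero =>
      rw [Submodule.pow_zero (M := Ring.jacobson R)]
      intro a _
      exact (Ideal.one_eq_top (R := R)).symm ▸ Submodule.mem_top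
    | succ n ih =>
      rw [pow_succ, Submodule.pow_succ (M := Ring.jacobson R)]
      refine Submodule.mul_le.2 fun a ha b hb => ?_
      have ha' : a ∈ Ring.jacobson R ^ n := ih ha
      exact Ideal.mul_mem_mul ha' (h b hb)
  refine ⟨n, (Submodule.eq_bot_iff _).2 fun a ha => ?_⟩
  have := le n ha
  rw [hn] at this
  exact this

theorem mem_jacobson_of_isNilpotent_mul {R : Type*} [Ring R] {a : R}
    (h : ∀ y, IsNilpotent (y * a)) : a ∈ Ring.jacobson R := by
  rw [← Ideal.jacobson_bot, Ideal.mem_jacobson_iff]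
  intro y
  obtain ⟨z, hz⟩ := (h y).isUnit_one_add.exists_left_inv
  refine ⟨z, (Submodule.mem_bot R).2 ?_⟩
  rw [mul_assoc, add_comm, sub_eq_zero, ← hz, mul_add, mul_one]

variable {k : Type*} [Field k] {R R' : Type*} [Ring R] [Algebra k R] [Ring R'] [Algebra k R']

theorem map₂_mk_pow_le (I : Submodule k R) (V : Submodule k R') (n : ℕ) :
    Submodule.map₂ (TensorProduct.mk k R R') I V ^ n ≤
      Submodule.map₂ (TensorProduct.mk k R R') (I ^ n) (V ^ n) := by
  induction n with
  | zero =>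
    simp only [pow_zero]
    rw [Submodule.one_le]
    exact Submodule.apply_mem_map₂ (TensorProduct.mk k R R') (Submodule.one_le.1 le_rfl)
      (Submodule.one_le.1 le_rfl)
  | succ n ih =>
    rw [pow_succ, pow_succ, pow_succ]
    refine (mul_le_mul' ih le_rfl).trans ?_
    generalize I ^ n = I', V ^ n = V'
    rw [Submodule.map₂_eq_span_image2 _ I' V', Submodule.map₂_eq_span_image2 _ I V,
      Submodule.span_mul_span]
    refine Submodule.span_le.2 ?_
    rintro _ ⟨_, ⟨a, ha, b, hb, rfl⟩, _, ⟨c, hc, d, hd, rfl⟩, rfl⟩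
    change (a ⊗ₜ[k] b) * (c ⊗ₜ[k] d) ∈ _
    rw [Algebra.TensorProduct.tmul_mul_tmul]
    exact Submodule.apply_mem_map₂ (TensorProduct.mk k R R') (Submodule.mul_mem_mul ha hc)
      (Submodule.mul_mem_mul hb hd)

theorem isNilpotent_of_mem {J : Submodule k R} (hJ : IsNilpotent J) {a : R} (ha : a ∈ J) :
    IsNilpotent a := by
  obtain ⟨n, hn⟩ := hJ
  have h := Submodule.pow_mem_pow J ha n
  rw [hn] at h
  exact ⟨n, (Submodule.mem_bot k).1 h⟩

theorem tmul_one_mem_jacobson [Module.Finite k R] {a : R} (ha : a ∈ Ring.jacobson R) :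
    (a ⊗ₜ[k] (1 : R')) ∈ Ring.jacobson (R ⊗[k] R') := by
  let J : Submodule k R := (Ring.jacobson R).restrictScalars k
  obtain ⟨n, hn⟩ : IsNilpotent J := isNilpotent_of_le_jacobson fun _ h => h
  have hK : IsNilpotent (Submodule.map₂ (TensorProduct.mk k R R') J ⊤) :=
    ⟨n, le_bot_iff.1 ((map₂_mk_pow_le J ⊤ n).trans (by rw [hn]; simp))⟩
  refine mem_jacobson_of_isNilpotent_mul fun y => isNilpotent_of_mem hK ?_
  induction y with
  | zero => simp
  | add x y hx hy => rw [add_mul]; exact Submodule.add_mem _ hx hy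
  | tmul b c =>
    rw [Algebra.TensorProduct.tmul_mul_tmul]
    exact Submodule.apply_mem_map₂ (TensorProduct.mk k R R')
      (Ideal.mul_mem_left _ b ha : b * a ∈ Ring.jacobson R) Submodule.mem_top

theorem one_tmul_op_mem_jacobson [Module.Finite k R'] {b : R'} (hb : b ∈ Ring.jacobson R') :
    ((1 : R) ⊗ₜ[k] op b) ∈ Ring.jacobson (R ⊗[k] R'ᵐᵒᵖ) := by
  let J : Submodule k R' := (Ring.jacobson R').restrictScalars k
  obtain ⟨n, hn⟩ : IsNilpotent J := isNilpotent_of_le_jacobson fun _ h => h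
  let J' : Submodule k R'ᵐᵒᵖ := J.map (opLinearEquiv k).toLinearMap
  have hn' : J' ^ n = 0 := by
    rw [← Submodule.map_op_pow, hn]
    exact Submodule.map_bot _
  have hK : IsNilpotent (Submodule.map₂ (TensorProduct.mk k R R'ᵐᵒᵖ) ⊤ J') :=
    ⟨n, le_bot_iff.1 ((map₂_mk_pow_le ⊤ J' n).trans (by rw [hn']; simp))⟩
  refine mem_jacobson_of_isNilpotent_mul fun y => isNilpotent_of_mem hK ?_
  induction y with
  | zero => simp
  | add x y hx hy => rw [add_mul]; exact Submodule.add_mem _ hx hy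
  | tmul c d =>
    obtain ⟨d, rfl⟩ := op_surjective d
    rw [Algebra.TensorProduct.tmul_mul_tmul]
    have : Ring.jacobson R' |>.IsTwoSided := inferInstance
    exact Submodule.apply_mem_map₂ (TensorProduct.mk k R R'ᵐᵒᵖ) Submodule.mem_top
      ⟨b * d, (Ring.jacobson R').mul_mem_right d hb, rfl⟩

/-- A nilpotent subspace `J` of an algebra that is stable under a set `s` of endomorphisms gives
a finite filtration by the left ideals `R Jⁿ`. -/
theorem exists_filtration {J : Submodule k R} (hJ : IsNilpotent J) {ι : Type*} (s : ι → R →ₐ[k] R)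
    (hs : ∀ i, ∀ a ∈ J, s i a ∈ J) : ∃ (F : ℕ → Submodule k R) (N : ℕ), F 0 = ⊤ ∧ F (N + 1) = ⊥ ∧
      ∀ n i, ∀ a ∈ F n, ∀ v ∈ J, s i a * v ∈ F (n + 1) := by
  obtain ⟨N, hN⟩ := hJ
  refine ⟨fun n => ⊤ * J ^ n, N, by simp, ?_, fun n i a ha v hv => ?_⟩
  · change ⊤ * J ^ (N + 1) = ⊥
    rw [pow_succ, hN]
    simp
  · have h : ∀ n, (⊤ * J ^ n : Submodule k R).map (s i).toLinearMap ≤ ⊤ * J ^ n := fun n => by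
      rw [Submodule.map_mul, Submodule.map_pow]
      exact mul_le_mul' le_top (pow_le_pow_left'
        (Submodule.map_le_iff_le_comap.2 (hs i)) n)
    change _ ∈ ⊤ * J ^ (n + 1)
    rw [pow_succ, ← mul_assoc]
    exact Submodule.mul_mem_mul (h n ⟨a, ha, rfl⟩) hv

end Filtration

/-! ### Objects of `X_A` with local endomorphism rings -/

section Local

variable {k A : Type u} [Field k] [Ring A] [Algebra k A] [Module.Finite k A]
  {G : Type u} [Group G] [Fintype G] [DecidableEq G] {σ : G →* (A ≃ₐ[k] A)}

theorem isNilpotent_of_filtration {X : XA σ} (F : ℕ → Submodule k X.X.base.carrier) (N : ℕ)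
    (h₀ : F 0 = ⊤) (hN : F (N + 1) = ⊥) (t : X ⟶ X)
    (h : ∀ n g, ∀ m ∈ F n, t.f.app g m ∈ F (n + 1)) : IsNilpotent (show End X from t) := by
  have hp : ∀ n g, ∀ m ∈ F 0,
      Skew.Hom.app (Karoubi.Hom.f ((show End X from t) ^ (n + 1))) g m ∈ F (n + 1) := by
    intro n
    induction n with
    | zero =>
      intro g m hm
      rw [pow_one]
      exact h 0 g m hm
    | succ n ih =>
      intro g m hm
      rw [pow_succ']
      change ((((show End X from t) ^ (n + 1) : End X) : X ⟶ X).f ≫ t.f).app g m ∈ _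
      rw [Skew.comp_app]
      exact Submodule.sum_mem _ fun s _ => h _ _ _ (ih s m hm)
  refine ⟨N + 1, Karoubi.hom_ext _ _ (Skew.hom_ext fun g m => ?_)⟩
  have := hp N g m (h₀ ▸ Submodule.mem_top)
  rw [hN] at this
  exact (Submodule.mem_bot k).1 this

theorem Skew.smul_comp (c : k) {M N K : Skew σ} (f : M ⟶ N) (g : N ⟶ K) :
    (c • f) ≫ g = c • (f ≫ g) := by
  ext s m
  simp [Finset.smul_sum]

theorem Skew.comp_smul (c : k) {M N K : Skew σ} (f : M ⟶ N) (g : N ⟶ K) :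
    f ≫ (c • g) = c • (f ≫ g) := by
  ext s m
  simp [Finset.smul_sum]

/-- Multiplication by a scalar, as an endomorphism of an object of `X_A`. -/
def scalar (X : XA σ) (c : k) : X ⟶ X where
  f := c • X.p
  comm := by rw [Skew.smul_comp, Skew.comp_smul, X.idem, X.idem]

theorem scalar_comp_scalar (X : XA σ) {c d : k} (h : c * d = 1) :
    scalar X c ≫ scalar X d = 𝟙 X := by
  refine Karoubi.hom_ext _ _ ?_
  change (c • X.p) ≫ (d • X.p) = X.p
  rw [Skew.smul_comp, Skew.comp_smul, X.idem]
  ext s m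
  simp [smul_smul, h]

/-- If every endomorphism acts on the quotients of a finite filtration by a scalar, then every
endomorphism is invertible or nilpotent. -/
theorem isIso_or_isNilpotent {X : XA σ} (F : ℕ → Submodule k X.X.base.carrier) (N : ℕ)
    (h₀ : F 0 = ⊤) (hN : F (N + 1) = ⊥) (t : X ⟶ X) (c : k)
    (h : ∀ n g, ∀ m ∈ F n, t.f.app g m - c • X.p.app g m ∈ F (n + 1)) :
    IsIso t ∨ IsNilpotent (show End X from t) := by
  by_cases hc : c = 0
  · right
    refine isNilpotent_of_filtration F N h₀ hN t fun n g m hm => ?_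
    have := h n g m hm
    rwa [hc, zero_smul, sub_zero] at this
  · left
    have hz : IsIso (scalar X c⁻¹) :=
      ⟨scalar X c, scalar_comp_scalar X (inv_mul_cancel₀ hc),
        scalar_comp_scalar X (mul_inv_cancel₀ hc)⟩
    have hn : IsNilpotent (show End X from 𝟙 X - t ≫ scalar X c⁻¹) := by
      refine isNilpotent_of_filtration F N h₀ hN _ fun n g m hm => ?_
      have e : (𝟙 X - t ≫ scalar X c⁻¹).f = X.p - c⁻¹ • t.f := by
        change X.p - t.f ≫ (c⁻¹ • X.p) = _
        rw [Skew.comp_smul, Karoubi.comp_p]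
      have e' : Skew.Hom.app (X.p - c⁻¹ • t.f) g m =
          - (c⁻¹ • (t.f.app g m - c • X.p.app g m)) := by
        rw [sub_eq_add_neg, Skew.add_app, Skew.neg_app, Skew.smul_app, smul_sub, smul_smul,
          inv_mul_cancel₀ hc, one_smul]
        abel
      rw [e, e']
      exact Submodule.neg_mem _ (Submodule.smul_mem _ _ (h n g m hm))
    have h' : IsIso (t ≫ scalar X c⁻¹) := by
      have := (isUnit_iff_isIso _).1 hn.isUnit_one_sub
      have e : (1 - (show End X from 𝟙 X - t ≫ scalar X c⁻¹) : End X) = t ≫ scalar X c⁻¹ :=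
        sub_sub_cancel _ _
      rwa [e] at this
    exact IsIso.of_isIso_comp_right t (scalar X c⁻¹)

/-- The automorphism `g ⊗ g` of `A ⊗ Aᵒᵖ`. -/
def twist (σ : G →* (A ≃ₐ[k] A)) (g : G) : A ⊗[k] Aᵐᵒᵖ →ₐ[k] A ⊗[k] Aᵐᵒᵖ :=
  Algebra.TensorProduct.map (σ g : A →ₐ[k] A) (AlgHom.op (σ g : A →ₐ[k] A))

theorem twist_tmul (g : G) (a b : A) : twist σ g (a ⊗ₜ op b) = σ g a ⊗ₜ op (σ g b) := rfl

theorem twist_one (z : A ⊗[k] Aᵐᵒᵖ) : twist σ 1 z = z := by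
  induction z with
  | zero => simp
  | add x y hx hy => rw [map_add, hx, hy]
  | tmul a b =>
    obtain ⟨b, rfl⟩ := op_surjective b
    simp [twist_tmul]

theorem Skew.hom_act {M N : Skew σ} (f : M ⟶ N) (g : G) (z : A ⊗[k] Aᵐᵒᵖ) (m : M.base.carrier) :
    f.app g (M.base.act z m) = N.base.act (twist σ g z) (f.app g m) := by
  induction z with
  | zero => simp
  | add x y hx hy => simp only [map_add, LinearMap.add_apply, hx, hy]
  | tmul a b =>
    obtain ⟨b, rfl⟩ := op_surjective b
    rw [Bim.act_tmul, Skew.hom_l, Skew.hom_r, twist_tmul, Bim.act_tmul]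

/-- Right multiplication by `w`, as an endomorphism of the free bimodule. -/
abbrev freeMul (w : A ⊗[k] Aᵐᵒᵖ) : freeB k A ⟶ freeB k A := freeHom (M := freeB k A) w

theorem freeMul_lin (w z : A ⊗[k] Aᵐᵒᵖ) : (freeMul w).lin z = z * w := freeB_act z w

theorem freeMul_comp (v w : A ⊗[k] Aᵐᵒᵖ) : freeMul v ≫ freeMul w = freeMul (v * w) := by
  refine Bim.hom_ext (LinearMap.ext fun z => ?_)
  refine (freeMul_lin w _).trans ((congrArg (· * w) (freeMul_lin v z)).trans ?_)
  refine Eq.trans ?_ (freeMul_lin (v * w) z).symm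
  exact mul_assoc (show A ⊗[k] Aᵐᵒᵖ from z) v w

variable (σ) in
/-- The direct summand of the free bimodule given by right multiplication with `w`. -/
def freeSummand {w : A ⊗[k] Aᵐᵒᵖ} (hw : w * w = w) : XA σ where
  X := ⟨freeB k A⟩
  p := Skew.incl (M := ⟨freeB k A⟩) (N := ⟨freeB k A⟩) (freeMul w)
  idem := by
    rw [incl_comp]
    exact congrArg Skew.incl ((freeMul_comp w w).trans (congrArg freeMul hw))

theorem Skew.incl_comp_app {M N K : Skew σ} (f : M.base ⟶ N.base) (t : N ⟶ K) (g : G)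
    (m : M.base.carrier) : ((Skew.incl f : M ⟶ N) ≫ t).app g m = t.app g (f.lin m) := by
  rw [Skew.comp_app, Finset.sum_eq_single 1 (fun s _ hs => by rw [incl_app_ne _ hs, map_zero])
    (by simp), incl_app_one, inv_one, mul_one]

theorem Skew.comp_incl_app {M N K : Skew σ} (t : M ⟶ N) (f : N.base ⟶ K.base) (g : G)
    (m : M.base.carrier) : (t ≫ (Skew.incl f : N ⟶ K)).app g m = f.lin (t.app g m) := by
  rw [Skew.comp_app, Finset.sum_eq_single g (fun s _ hs =>
    incl_app_ne _ (fun h => hs (mul_inv_eq_one.1 h).symm) _) (by simp), mul_inv_cancel,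
    incl_app_one]

theorem freeB_app (f : (⟨freeB k A⟩ : Skew σ) ⟶ ⟨freeB k A⟩) (g : G) (z : A ⊗[k] Aᵐᵒᵖ) :
    f.app g z = twist σ g z * (show A ⊗[k] Aᵐᵒᵖ from f.app g (1 : A ⊗[k] Aᵐᵒᵖ)) := by
  have h := Skew.hom_act f g z (1 : A ⊗[k] Aᵐᵒᵖ)
  have h' : (freeB k A).act z (1 : A ⊗[k] Aᵐᵒᵖ) = z := (freeB_act z 1).trans (mul_one z)
  exact ((congrArg (f.app g) h').symm.trans h).trans (freeB_act _ _)

theorem freeSummand_p {w : A ⊗[k] Aᵐᵒᵖ} (hw : w * w = w) (g : G) (z : A ⊗[k] Aᵐᵒᵖ) :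
    (freeSummand σ hw).p.app g z = twist σ g z * if g = 1 then w else 0 := by
  by_cases hg : g = 1
  · subst hg
    rw [if_pos rfl, twist_one]
    exact (incl_app_one (M := ⟨freeB k A⟩) (N := ⟨freeB k A⟩) _ _).trans (freeMul_lin _ z)
  · rw [if_neg hg, mul_zero]
    exact incl_app_ne (M := ⟨freeB k A⟩) (N := ⟨freeB k A⟩) _ hg _

/-- The components of an endomorphism of a summand of the free bimodule are determined by elements
`v` of `A ⊗ Aᵒᵖ` that absorb the idempotent on both sides. -/
theorem freeSummand_app {w : A ⊗[k] Aᵐᵒᵖ} (hw : w * w = w) (t : freeSummand σ hw ⟶ freeSummand σ hw)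
    (g : G) : ∃ v, (∀ z : A ⊗[k] Aᵐᵒᵖ, t.f.app g z = twist σ g z * v) ∧
      twist σ g w * v = v ∧ v * w = v := by
  refine ⟨t.f.app g (1 : A ⊗[k] Aᵐᵒᵖ), freeB_app t.f g, ?_, ?_⟩
  · refine (freeB_app t.f g w).symm.trans ?_
    refine Eq.trans ?_ (congrArg (fun f => Skew.Hom.app f g (1 : A ⊗[k] Aᵐᵒᵖ)) (Karoubi.p_comp t))
    refine Eq.trans ?_ (Skew.incl_comp_app (M := ⟨freeB k A⟩) (N := ⟨freeB k A⟩) (freeMul w) t.f g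
      (1 : A ⊗[k] Aᵐᵒᵖ)).symm
    exact congrArg (t.f.app g) ((freeMul_lin w 1).trans (one_mul w)).symm
  · refine Eq.trans ?_ (congrArg (fun f => Skew.Hom.app f g (1 : A ⊗[k] Aᵐᵒᵖ)) (Karoubi.comp_p t))
    refine Eq.trans ?_ (Skew.comp_incl_app (N := ⟨freeB k A⟩) (K := ⟨freeB k A⟩) t.f (freeMul w) g
      (1 : A ⊗[k] Aᵐᵒᵖ)).symm
    exact (freeMul_lin w _).symm

end Local

section Hopf

variable {k A : Type u} [Field k] [Ring A] [HopfAlgebra k A] [Module.Finite k A]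

open Characters

theorem bichar_twist (χ ψ g : Characters k A) (z : A ⊗[k] Aᵐᵒᵖ) :
    bichar χ ψ (twist (act k A) g z) = bichar (χ * g) (ψ * g) z := by
  induction z with
  | zero => simp
  | add x y hx hy => simp only [map_add, hx, hy]
  | tmul a b =>
    obtain ⟨b, rfl⟩ := op_surjective b
    rw [twist_tmul, bichar_tmul, bichar_tmul, Characters.hom_act, Characters.hom_act]

variable {e : Characters k A → A}

theorem IsCharacterBasis.sub_mem_tensor (he : IsCharacterBasis e) (z : A ⊗[k] Aᵐᵒᵖ) :
    z - ∑ u : Characters k A, ∑ w : Characters k A, bichar u w z • (e u ⊗ₜ[k] op (e w)) ∈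
      Ring.jacobson (A ⊗[k] Aᵐᵒᵖ) := by
  induction z with
  | zero => simp
  | add x y hx hy =>
    simp only [map_add, add_smul, Finset.sum_add_distrib]
    rw [add_sub_add_comm]
    exact Ideal.add_mem _ hx hy
  | tmul a b =>
    obtain ⟨b, rfl⟩ := op_surjective b
    have h : ∑ u : Characters k A, ∑ w : Characters k A,
        bichar u w (a ⊗ₜ[k] op b) • (e u ⊗ₜ[k] op (e w)) =
        (∑ u : Characters k A, u.hom a • e u) ⊗ₜ[k]
          op (∑ w : Characters k A, w.hom b • e w) := by
      rw [Finset.op_sum, TensorProduct.sum_tmul]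
      refine Finset.sum_congr rfl fun u _ => ?_
      rw [TensorProduct.tmul_sum]
      refine Finset.sum_congr rfl fun w _ => ?_
      rw [op_smul, TensorProduct.smul_tmul_smul, bichar_tmul]
    rw [h]
    set a' := ∑ u : Characters k A, u.hom a • e u
    set b' := ∑ w : Characters k A, w.hom b • e w
    have h' : a ⊗ₜ[k] op b - a' ⊗ₜ[k] op b' = ((1 : A) ⊗ₜ[k] op b) * ((a - a') ⊗ₜ[k] (1 : Aᵐᵒᵖ)) +
        (a' ⊗ₜ[k] (1 : Aᵐᵒᵖ)) * ((1 : A) ⊗ₜ[k] op (b - b')) := by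
      simp [TensorProduct.sub_tmul, TensorProduct.tmul_sub, mul_sub]
    rw [h']
    exact Ideal.add_mem _ (Ideal.mul_mem_left _ _ (tmul_one_mem_jacobson (he.sub_mem a)))
      (Ideal.mul_mem_left _ _ (one_tmul_op_mem_jacobson (he.sub_mem b)))

/-- The common kernel of the characters `a ⊗ b ↦ χ(a) ψ(b)` is nilpotent. -/
theorem IsCharacterBasis.isNilpotent_ker (he : IsCharacterBasis e) :
    IsNilpotent (⨅ (χ : Characters k A) (ψ : Characters k A),
      LinearMap.ker (bichar χ ψ).toLinearMap) := by
  refine isNilpotent_of_le_jacobson fun z hz => ?_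
  have h := he.sub_mem_tensor z
  rwa [Finset.sum_eq_zero, sub_zero] at h
  intro u _
  refine Finset.sum_eq_zero fun w _ => ?_
  have : bichar u w z = 0 := Submodule.mem_iInf _ |>.1 (Submodule.mem_iInf _ |>.1 hz u) w
  rw [this, zero_smul]

theorem IsCharacterBasis.idem (he : IsCharacterBasis e) (x y : Characters k A) :
    (e x ⊗ₜ[k] op (e y)) * (e x ⊗ₜ[k] op (e y)) = e x ⊗ₜ[k] op (e y) := by
  rw [Algebra.TensorProduct.tmul_mul_tmul, ← op_mul, he.mul, he.mul, if_pos rfl, if_pos rfl]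

/-- The endomorphisms of the summand of the free bimodule given by `e_x ⊗ e_y` are invertible or
nilpotent: modulo the common kernel of the characters they are scalars, because no element `g ≠ 1`
of the group fixes `e_x ⊗ e_y`. -/
theorem freeSummand_local (he : IsCharacterBasis e) (x y : Characters k A)
    (t : freeSummand (act k A) (he.idem x y) ⟶ freeSummand (act k A) (he.idem x y)) :
    IsIso t ∨ IsNilpotent (show End (freeSummand (act k A) (he.idem x y)) from t) := by
  obtain ⟨F, N, h₀, hN, hF⟩ := exists_filtration he.isNilpotent_ker (twist (act k A))
    (fun g z hz => by
      simp only [Submodule.mem_iInf, LinearMap.mem_ker] at hz ⊢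
      exact fun χ ψ => (bichar_twist χ ψ g z).trans (hz _ _))
  choose v hv hv₁ hv₂ using freeSummand_app (he.idem x y) t
  refine isIso_or_isNilpotent (X := freeSummand (act k A) (he.idem x y)) F N h₀ hN t
    (bichar x y (v 1)) fun n g m hm => ?_
  have key : ∀ χ ψ : Characters k A, bichar χ ψ (v g -
      if g = 1 then bichar x y (v 1) • (e x ⊗ₜ[k] op (e y)) else 0) = 0 := fun χ ψ => by
    have h₁ := congrArg (bichar χ ψ) (hv₁ g)
    have h₂ := congrArg (bichar χ ψ) (hv₂ g)
    rw [map_mul, bichar_twist, bichar_tmul, he.hom_apply, he.hom_apply] at h₁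
    rw [map_mul, bichar_tmul, he.hom_apply, he.hom_apply] at h₂
    rw [map_sub]
    by_cases hg : g = 1
    · subst hg
      rw [if_pos rfl, map_smul, bichar_tmul, he.hom_apply, he.hom_apply]
      by_cases hx : χ = x
      · by_cases hy : ψ = y
        · subst hx hy
          simp
        · simp [hy] at h₂ ⊢
          exact h₂.symm
      · simp [hx] at h₂ ⊢
        exact h₂.symm
    · rw [if_neg hg, map_zero, sub_zero]
      by_cases hx : χ = x
      · rw [← h₁, if_neg (by rw [hx]; simpa using hg)]
        simp
      · rw [← h₂, if_neg hx]
        simp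
  have e₁ : t.f.app g m - bichar x y (v 1) • (freeSummand (act k A) (he.idem x y)).p.app g m =
      twist (act k A) g m * (v g -
        if g = 1 then bichar x y (v 1) • (e x ⊗ₜ[k] op (e y)) else 0) := by
    rw [mul_sub]
    have e₂ : ∀ (c : k) (z w : A ⊗[k] Aᵐᵒᵖ), c • (z * if g = 1 then w else 0) =
        z * if g = 1 then c • w else 0 := fun c z w => by
      split_ifs
      exacts [(mul_smul_comm c z w).symm, by rw [mul_zero, smul_zero]]
    exact congrArg₂ _ (hv g m) ((congrArg _ (freeSummand_p _ g _)).trans (e₂ _ _ _))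
  rw [e₁]
  refine hF n g m hm _ ?_
  simp only [Submodule.mem_iInf, LinearMap.mem_ker]
  exact key

variable [NeZero (Nat.card (Characters k A) : k)]

/-- The endomorphisms of the identity `1`-morphism `(A, π₁)` are invertible or nilpotent: they are
given by the invariant elements `z` of `A`, and all characters agree on such an element. -/
theorem unit_local (hA : IsBasic k A) (t : 𝟙_ (XA (act k A)) ⟶ 𝟙_ (XA (act k A))) :
    IsIso t ∨ IsNilpotent (show End (𝟙_ (XA (act k A))) from t) := by
  let J : Submodule k A := ⨅ χ : Characters k A, LinearMap.ker χ.hom.toLinearMap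
  have hJ : ∀ a, a ∈ J ↔ ∀ χ : Characters k A, χ.hom a = 0 := fun a => by
    simp only [J, Submodule.mem_iInf, LinearMap.mem_ker]
    rfl
  obtain ⟨F, N, h₀, hN, hF⟩ := exists_filtration (J := J)
    (isNilpotent_of_le_jacobson fun a ha => mem_jacobson_of_hom hA ((hJ a).1 ha))
    (fun g => (act k A g : A →ₐ[k] A))
    (fun g a ha => (hJ _).2 fun χ => (Characters.hom_act χ g a).trans ((hJ a).1 ha _))
  let v : Characters k A → A := fun g => t.f.app g (1 : A)
  have hv : ∀ g (a : A), t.f.app g a = act k A g a * v g := fun g a =>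
    (congrArg (t.f.app g) (mul_one a).symm).trans
      (Skew.hom_l (N := ⟨reg k A⟩) (M := ⟨reg k A⟩) t.f g a (1 : A))
  let c : k := (Nat.card (Characters k A) : k)⁻¹
  have hc : c ≠ 0 := inv_ne_zero (NeZero.ne _)
  have hp : ∀ g (a : A), (𝟙_ (XA (act k A))).p.app g a = c • act k A g a := fun _ _ => rfl
  -- the component at `1` determines the others, because `t` absorbs the idempotent `π₁`
  have hv₁ : ∀ g, v g = ∑ s, c • v s := fun g => by
    refine (congrArg (fun f => Skew.Hom.app f g (1 : A)) (Karoubi.p_comp t)).symm.trans ?_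
    refine (Skew.comp_app (M := ⟨reg k A⟩) (N := ⟨reg k A⟩) (K := ⟨reg k A⟩) _ _ _ _).trans ?_
    refine Fintype.sum_equiv ((Equiv.inv _).trans (Equiv.mulLeft g)) _ _ fun s => ?_
    refine (congrArg (t.f.app (g * s⁻¹)) ((hp s 1).trans (congrArg _ (map_one (act k A s))))).trans
      (map_smul _ _ _)
  have hv₂ : ∀ g, v g = act k A g (v 1) := fun g => by
    have h : ∀ g, v g = ∑ s, c • act k A s (v 1) := fun g => by
      refine (congrArg (fun f => Skew.Hom.app f g (1 : A)) (Karoubi.comp_p t)).symm.trans ?_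
      refine (Skew.comp_app (M := ⟨reg k A⟩) (N := ⟨reg k A⟩) (K := ⟨reg k A⟩) _ _ _ _).trans ?_
      refine Fintype.sum_equiv ((Equiv.inv _).trans (Equiv.mulLeft g)) _ _ fun s => ?_
      refine (hp (g * s⁻¹) (v s)).trans ?_
      rw [hv₁ s, ← hv₁ 1]
      rfl
    refine (h g).trans (Eq.trans ?_ (congrArg (act k A g) (h 1)).symm)
    simp only [map_sum, map_smul]
    refine (Fintype.sum_equiv (Equiv.mulLeft g) _ _ fun s => ?_).symm
    change _ = c • act k A (g * s) (v 1)
    rw [map_mul]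
    rfl
  refine isIso_or_isNilpotent (X := 𝟙_ (XA (act k A))) F N h₀ hN t
    (c⁻¹ * Coalgebra.counit (R := k) (v 1)) fun n g m hm => ?_
  have e₁ : t.f.app g m - (c⁻¹ * Coalgebra.counit (R := k) (v 1)) •
      (𝟙_ (XA (act k A))).p.app g m =
      act k A g m * (v g - Coalgebra.counit (R := k) (v 1) • (1 : A)) := by
    rw [mul_sub]
    have e₂ : ∀ (d : k) (a : A), (c⁻¹ * d) • c • a = a * d • (1 : A) := fun d a => by
      rw [smul_smul, mul_right_comm, inv_mul_cancel₀ hc, one_mul, mul_smul_comm, mul_one]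
    exact congrArg₂ _ (hv g m) ((congrArg _ (hp g m)).trans (e₂ _ _))
  rw [e₁]
  refine hF n g m hm _ ((hJ _).2 fun χ => ?_)
  have h₁ : v g = v χ := (hv₁ g).trans (hv₁ χ).symm
  have h₂ : v g = v 1 := (hv₁ g).trans (hv₁ 1).symm
  have h₃ : χ.hom (v 1) = Coalgebra.counit (R := k) (v 1) := by
    rw [← counit_act, ← hv₂, hv₁ χ, ← hv₁ 1]
  rw [map_sub, map_smul, map_one, h₂, h₃, smul_eq_mul, mul_one, sub_self]

end Hopf

/-! ### Summands of the free bimodule in `X_A` -/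

section Split

variable {k A : Type u} [Field k] [Ring A] [Algebra k A] [Module.Finite k A]
  {G : Type u} [Group G] [Fintype G] [DecidableEq G] {σ : G →* (A ≃ₐ[k] A)}

theorem twist_mul (g h : G) (z : A ⊗[k] Aᵐᵒᵖ) : twist σ (g * h) z = twist σ g (twist σ h z) := by
  induction z with
  | zero => simp
  | add x y hx hy => simp only [map_add, hx, hy]
  | tmul a b =>
    obtain ⟨b, rfl⟩ := op_surjective b
    simp [twist_tmul]

theorem EqStr.τ_act {M : Bim k A} (T : EqStr σ M) (g : G) (z : A ⊗[k] Aᵐᵒᵖ) (m : M.carrier) :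
    T.τ g (M.act z m) = M.act (twist σ g z) (T.τ g m) := by
  induction z with
  | zero => simp
  | add x y hx hy => simp only [map_add, LinearMap.add_apply, hx, hy]
  | tmul a b =>
    obtain ⟨b, rfl⟩ := op_surjective b
    rw [Bim.act_tmul, T.τ_l, T.τ_r, twist_tmul, Bim.act_tmul]

variable [NeZero (Nat.card G : k)] {M : Bim k A} (T : EqStr σ M) (κ : freeB k A ≅ M)
  {w : A ⊗[k] Aᵐᵒᵖ} (hw : w * w = w)

/-- The morphism to `M` with its equivariant structure from a summand of the free bimodule that is
given by an isomorphism `κ` of `M` with the free bimodule; its components are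
`z ↦ |G|⁻¹ τ_g(κ(z w))`. -/
def toEqStr : freeSummand σ hw ⟶ T.obj where
  f := T.skewMap (freeMul w ≫ κ.hom)
  comm := by
    change Skew.incl (M := ⟨freeB k A⟩) (N := ⟨freeB k A⟩) (freeMul w) ≫
      T.skewMap (freeMul w ≫ κ.hom) ≫ T.skewMap (𝟙 M) = _
    rw [EqStr.skewMap_comp T T _ _ T.id_equivariant, Category.comp_id]
    refine Skew.hom_ext fun g z => (Skew.incl_comp_app _ _ _ _).trans ?_
    have h : freeMul w ≫ freeMul w = freeMul w := (freeMul_comp w w).trans (congrArg freeMul hw)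
    exact congrArg (fun t => (Nat.card G : k)⁻¹ • T.τ g (κ.hom.lin t))
      (LinearMap.congr_fun (congrArg Bim.Hom.lin h) z)

/-- A morphism in the opposite direction, with components `m ↦ κ⁻¹(τ_g m) w`. -/
def ofEqStr : T.obj ⟶ freeSummand σ hw where
  f := (Nat.card G : k) • (T.skewMap (𝟙 M) ≫
    Skew.incl (M := ⟨M⟩) (N := ⟨freeB k A⟩) (κ.inv ≫ freeMul w))
  comm := by
    change T.skewMap (𝟙 M) ≫ _ ≫ Skew.incl (M := ⟨freeB k A⟩) (N := ⟨freeB k A⟩) (freeMul w) = _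
    rw [Skew.smul_comp, Skew.comp_smul, Category.assoc, incl_comp, ← Category.assoc,
      EqStr.skewMap_comp T T _ _ T.id_equivariant, Category.id_comp]
    refine congrArg (fun f => (Nat.card G : k) • (T.skewMap (𝟙 M) ≫
      Skew.incl (M := ⟨M⟩) (N := ⟨freeB k A⟩) f)) ?_
    exact (Category.assoc _ _ _).trans (congrArg _ ((freeMul_comp w w).trans (congrArg freeMul hw)))

theorem toEqStr_app (g : G) (z : A ⊗[k] Aᵐᵒᵖ) :
    (toEqStr T κ hw).f.app g z = (Nat.card G : k)⁻¹ • T.τ g (κ.hom.lin (z * w : A ⊗[k] Aᵐᵒᵖ)) :=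
  congrArg (fun t => (Nat.card G : k)⁻¹ • T.τ g (κ.hom.lin t)) (freeMul_lin w z)

theorem ofEqStr_app (g : G) (m : M.carrier) :
    (ofEqStr T κ hw).f.app g m = (show A ⊗[k] Aᵐᵒᵖ from κ.inv.lin (T.τ g m)) * w := by
  refine (congrArg ((Nat.card G : k) • ·) (Skew.comp_incl_app (M := ⟨M⟩) (N := ⟨M⟩)
    (K := ⟨freeB k A⟩) (T.skewMap (𝟙 M)) (κ.inv ≫ freeMul w) g m)).trans ?_
  refine (map_smul (κ.inv ≫ freeMul w).lin _ _).symm.trans ?_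
  refine (congrArg (κ.inv ≫ freeMul w).lin (?_ : _ = T.τ g m)).trans (freeMul_lin w _)
  rw [EqStr.skewMap_app, smul_smul, mul_inv_cancel₀ (NeZero.ne _), one_smul]
  rfl

variable (hκ : ∀ g (z : A ⊗[k] Aᵐᵒᵖ), T.τ g (κ.hom.lin z) = κ.hom.lin (twist σ g z))

include hκ

/-- If the translates `g(w)`, `g ≠ 1`, are orthogonal to `w`, then the summand given by `w` is a
direct summand of `M`. -/
theorem toEqStr_ofEqStr (hw' : ∀ g, g ≠ 1 → twist σ g w * w = 0) :
    toEqStr T κ hw ≫ ofEqStr T κ hw = 𝟙 _ := by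
  have hinv : ∀ z : A ⊗[k] Aᵐᵒᵖ, κ.inv.lin (κ.hom.lin z) = z := fun z =>
    LinearMap.congr_fun (congrArg Bim.Hom.lin κ.hom_inv_id) z
  refine Karoubi.hom_ext _ _ (Skew.hom_ext fun s (z : A ⊗[k] Aᵐᵒᵖ) => ?_)
  refine (Skew.comp_app (M := ⟨freeB k A⟩) (N := ⟨M⟩) (K := ⟨freeB k A⟩) _ _ s z).trans ?_
  have e : ∀ g, (ofEqStr T κ hw).f.app (s * g⁻¹) ((toEqStr T κ hw).f.app g z) =
      (Nat.card G : k)⁻¹ • (twist σ s (z * w) * w : A ⊗[k] Aᵐᵒᵖ) := fun g => by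
    refine (congrArg _ (toEqStr_app T κ hw g z)).trans ((map_smul _ _ _).trans (congrArg _ ?_))
    refine (ofEqStr_app T κ hw _ _).trans (congrArg (fun t : A ⊗[k] Aᵐᵒᵖ => t * w) ?_)
    rw [← T.τ_mul, inv_mul_cancel_right, hκ]
    exact hinv _
  refine (Finset.sum_congr rfl fun g _ => e g).trans ((Finset.sum_const _).trans ?_)
  rw [Finset.card_univ]
  refine (EqStr.card_smul (k := k) (G := G) (M := freeB k A) _).trans ?_
  refine Eq.trans ?_ (freeSummand_p hw s z).symm
  rw [map_mul, mul_assoc]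
  refine congrArg _ ?_
  split_ifs with h
  · rw [h, twist_one, hw]
  · exact hw' s h

/-- The corresponding idempotent endomorphism of `M` is right multiplication by the sum of the
translates of `w`. -/
theorem ofEqStr_toEqStr (E : M ⟶ M) (hE : IsEquivariant T.τ T.τ E)
    (hE' : ∀ z : A ⊗[k] Aᵐᵒᵖ, E.lin (κ.hom.lin z) =
      κ.hom.lin (z * ∑ g, twist σ g w : A ⊗[k] Aᵐᵒᵖ)) :
    ofEqStr T κ hw ≫ toEqStr T κ hw = EqStr.map E hE := by
  have hinv : ∀ z : A ⊗[k] Aᵐᵒᵖ, κ.inv.lin (κ.hom.lin z) = z := fun z =>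
    LinearMap.congr_fun (congrArg Bim.Hom.lin κ.hom_inv_id) z
  refine Karoubi.hom_ext _ _ (Skew.hom_ext fun s m => ?_)
  obtain ⟨z, rfl⟩ : ∃ z : A ⊗[k] Aᵐᵒᵖ, κ.hom.lin z = m := ⟨κ.inv.lin m,
    LinearMap.congr_fun (congrArg Bim.Hom.lin κ.inv_hom_id) m⟩
  refine (Skew.comp_app (M := ⟨M⟩) (N := ⟨freeB k A⟩) (K := ⟨M⟩) _ _ s _).trans ?_
  have e : ∀ g, (toEqStr T κ hw).f.app (s * g⁻¹) ((ofEqStr T κ hw).f.app g (κ.hom.lin z)) =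
      (Nat.card G : k)⁻¹ • κ.hom.lin (twist σ s z * twist σ (s * g⁻¹) w : A ⊗[k] Aᵐᵒᵖ) := by
    intro g
    refine (congrArg _ (ofEqStr_app T κ hw g _)).trans ?_
    refine (toEqStr_app T κ hw _ _).trans (congrArg _ ?_)
    rw [hκ, hκ]
    refine congrArg κ.hom.lin ?_
    rw [hinv, mul_assoc, hw, map_mul, ← twist_mul, inv_mul_cancel_right]
  refine (Finset.sum_congr rfl fun g _ => e g).trans ?_
  rw [← Finset.smul_sum]
  refine congrArg _ ?_
  refine Eq.trans ?_ (congrArg (T.τ s) (hE' z)).symm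
  rw [hκ, map_mul, map_sum, Finset.mul_sum]
  refine (map_sum κ.hom.lin _ _).symm.trans (congrArg κ.hom.lin ?_)
  refine Fintype.sum_equiv (Equiv.inv G) _ _ fun g => ?_
  rw [← twist_mul]
  rfl

end Split

section FreeAdditive

variable {k A : Type u} [Field k] [Ring A] [Algebra k A] [Module.Finite k A]
  {G : Type u} [Group G] [Fintype G] [DecidableEq G] {σ : G →* (A ≃ₐ[k] A)}

variable (σ) in
/-- Right multiplication, as an additive map to the endomorphisms of the free bimodule in
`𝒳_A`. -/
def skewFreeMul : A ⊗[k] Aᵐᵒᵖ →+ ((⟨freeB k A⟩ : Skew σ) ⟶ ⟨freeB k A⟩) :=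
  AddMonoidHom.mk' (fun w => Skew.incl (M := ⟨freeB k A⟩) (N := ⟨freeB k A⟩) (freeMul w))
    (fun v w => Skew.hom_ext fun g (z : A ⊗[k] Aᵐᵒᵖ) => by
      by_cases hg : g = 1
      · subst hg
        refine (incl_app_one (M := ⟨freeB k A⟩) (N := ⟨freeB k A⟩) _ z).trans ?_
        refine Eq.trans ?_ (congrArg₂ (· + ·)
          (incl_app_one (M := ⟨freeB k A⟩) (N := ⟨freeB k A⟩) (freeMul v) z)
          (incl_app_one (M := ⟨freeB k A⟩) (N := ⟨freeB k A⟩) (freeMul w) z)).symm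
        exact (freeMul_lin _ z).trans ((mul_add z v w).trans
          (congrArg₂ (· + ·) (freeMul_lin v z) (freeMul_lin w z)).symm)
      · refine (incl_app_ne (M := ⟨freeB k A⟩) (N := ⟨freeB k A⟩) _ hg z).trans ?_
        refine Eq.trans ?_ (congrArg₂ (· + ·)
          (incl_app_ne (M := ⟨freeB k A⟩) (N := ⟨freeB k A⟩) (freeMul v) hg z)
          (incl_app_ne (M := ⟨freeB k A⟩) (N := ⟨freeB k A⟩) (freeMul w) hg z)).symm
        exact (add_zero _).symm)

theorem skewFreeMul_one : skewFreeMul σ (1 : A ⊗[k] Aᵐᵒᵖ) = 𝟙 (⟨freeB k A⟩ : Skew σ) :=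
  congrArg Skew.incl (Bim.hom_ext (LinearMap.ext fun z => (freeMul_lin 1 z).trans
    (mul_one (show A ⊗[k] Aᵐᵒᵖ from z))))

/-- The free bimodule is the direct sum of the summands given by a complete system of
idempotents. -/
theorem addClosure_freeB {ι : Type*} [Fintype ι] (w : ι → A ⊗[k] Aᵐᵒᵖ)
    (hw : ∀ j, w j * w j = w j) (h : ∑ j, w j = 1) :
    AddClosure (fun X => ∃ j, X = freeSummand σ (hw j))
      ((toKaroubi (Skew σ)).obj ⟨freeB k A⟩) := by
  have hi : ∀ j, skewFreeMul σ (w j) ≫ skewFreeMul σ (w j) = skewFreeMul σ (w j) := fun j =>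
    (freeSummand σ (hw j)).idem
  refine AddClosure.of_fintype (fun j => freeSummand σ (hw j))
    (fun j => ⟨skewFreeMul σ (w j), ?_⟩) (fun j => ⟨skewFreeMul σ (w j), ?_⟩) (fun j => ⟨j, rfl⟩) ?_
  · change 𝟙 _ ≫ skewFreeMul σ (w j) ≫ skewFreeMul σ (w j) = _
    rw [hi, Category.id_comp]
  · change skewFreeMul σ (w j) ≫ skewFreeMul σ (w j) ≫ 𝟙 _ = _
    rw [Category.comp_id, hi]
  · refine Karoubi.hom_ext _ _ ?_
    refine (map_sum (Karoubi.inclusionHom ((toKaroubi (Skew σ)).obj ⟨freeB k A⟩)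
      ((toKaroubi (Skew σ)).obj ⟨freeB k A⟩)) _ _).trans ?_
    refine Eq.trans ?_ skewFreeMul_one
    rw [← h, map_sum]
    exact Finset.sum_congr rfl fun j _ => hi j

end FreeAdditive

section Hopf

variable {k A : Type u} [Field k] [Ring A] [HopfAlgebra k A] [Module.Finite k A]

open Characters

theorem diagMap_mulRight_kappa (v : A) (z : A ⊗[k] Aᵐᵒᵖ) :
    (diagMap (RepA.mulRight (k := k) v)).lin ((kappa k A).hom.lin z) =
      (kappa k A).hom.lin (z * phi k A v : A ⊗[k] Aᵐᵒᵖ) := by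
  refine (Bim.hom_act (diagMap (RepA.mulRight (k := k) v)) z _).trans ?_
  refine Eq.trans ?_ (kappaHom_lin k A (z * phi k A v)).symm
  refine Eq.trans ?_ (straightBil_bal (Algebra.lmul k A) v z 1).symm
  refine Eq.trans ?_ (straightBil_eq_act z _).symm
  exact congrArg (fun t : A => (diag (RepA.reg k A)).act z (t ⊗ₜ[k] (1 : A)))
    ((one_mul v).trans (mul_one v).symm)

theorem diagStr_kappa (g : Characters k A) (z : A ⊗[k] Aᵐᵒᵖ) :
    (diagStr (RepA.reg k A)).τ g ((kappa k A).hom.lin z) =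
      (kappa k A).hom.lin (twist (act k A) g z) := by
  refine (EqStr.τ_act _ g z _).trans ?_
  exact congrArg (fun t : A => (diag (RepA.reg k A)).act (twist (act k A) g z) ((1 : A) ⊗ₜ[k] t))
    (map_one (act k A g))

variable {e : Characters k A → A} [NeZero (Nat.card (Characters k A) : k)]

theorem IsCharacterBasis.twist_mul (he : IsCharacterBasis e) (x y g : Characters k A) (hg : g ≠ 1) :
    twist (Characters.act k A) g (e x ⊗ₜ op (e y)) * (e x ⊗ₜ op (e y)) = 0 := by
  rw [twist_tmul, Algebra.TensorProduct.tmul_mul_tmul, he.act, he.mul,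
    if_neg (by simpa using hg), TensorProduct.zero_tmul]

theorem IsCharacterBasis.sum_twist (he : IsCharacterBasis e) (x y : Characters k A) :
    ∑ g, twist (Characters.act k A) g (e x ⊗ₜ op (e y)) = HopfBimod.phi k A (e (x * y⁻¹)) := by
  rw [he.phi]
  refine Fintype.sum_equiv ((Equiv.inv _).trans (Equiv.mulLeft x)) _ _ fun g => ?_
  rw [twist_tmul, he.act, he.act]
  simp [mul_assoc]

/-- The summand of the free bimodule given by `e_x ⊗ e_y` is `Λ` of the projective module
`A e_{x y⁻¹}`. -/
theorem exists_lam_iso_freeSummand (he : IsCharacterBasis e) (x y : Characters k A) :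
    ∃ M, HA k A M ∧
      Nonempty ((Lam k A).obj M ≅ freeSummand (Characters.act k A) (he.idem x y)) := by
  let v := e (x * y⁻¹)
  have hv : v * v = v := by rw [he.mul, if_pos rfl]
  let T := diagStr (RepA.reg k A)
  let f : freeSummand (Characters.act k A) (he.idem x y) ⟶ (Lam k A).obj (RepA.reg k A) :=
    toEqStr T (kappa k A) (he.idem x y)
  let g : (Lam k A).obj (RepA.reg k A) ⟶ freeSummand (Characters.act k A) (he.idem x y) :=
    ofEqStr T (kappa k A) (he.idem x y)
  have hfg : f ≫ g = 𝟙 _ :=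
    toEqStr_ofEqStr T (kappa k A) (he.idem x y) diagStr_kappa (he.twist_mul x y)
  have hgf : g ≫ f = (Lam k A).map (RepA.leftIdealπ v) ≫ (Lam k A).map (RepA.leftIdealι v) := by
    rw [← Functor.map_comp, RepA.leftIdealπ_ι]
    refine ofEqStr_toEqStr T (kappa k A) (he.idem x y) diagStr_kappa
      (diagMap (RepA.mulRight v)) (diagMap_equivariant _) fun z => ?_
    rw [he.sum_twist]
    exact diagMap_mulRight_kappa v z
  have hιπ : (Lam k A).map (RepA.leftIdealι v) ≫ (Lam k A).map (RepA.leftIdealπ v) = 𝟙 _ := by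
    rw [← Functor.map_comp, RepA.leftIdealι_π hv, CategoryTheory.Functor.map_id]
  refine ⟨RepA.leftIdeal v, HA.leftIdeal hv, ⟨⟨(Lam k A).map (RepA.leftIdealι v) ≫ g,
    f ≫ (Lam k A).map (RepA.leftIdealπ v), ?_, ?_⟩⟩⟩
  · rw [Category.assoc, reassoc_of% hgf, hιπ, Category.comp_id, hιπ]
  · rw [Category.assoc, ← reassoc_of% hgf, hfg, Category.comp_id, hfg]

/-! ### Every object of `G_A` comes from `H_A` -/

theorem GA_addClosure (he : IsCharacterBasis e) {X : XA (Characters.act k A)}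
    (hX : GA (Characters.act k A) X) :
    AddClosure (fun X => X = 𝟙_ _ ∨
      ∃ x y, X = freeSummand (Characters.act k A) (he.idem x y)) X := by
  refine AddClosure.trans (fun Y hY => ?_) hX
  rcases hY with rfl | rfl
  · exact AddClosure.of_mem (Or.inl rfl)
  · obtain ⟨i⟩ := freeXA_iso (k := k) (A := A)
    refine AddClosure.iso i (AddClosure.trans ?_ (addClosure_freeB
      (fun j : Characters k A × Characters k A => e j.1 ⊗ₜ[k] op (e j.2))
      (fun j => he.idem j.1 j.2) ?_))
    · rintro _ ⟨j, rfl⟩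
      exact AddClosure.of_mem (Or.inr ⟨j.1, j.2, rfl⟩)
    · rw [Fintype.sum_prod_type]
      simp only [← TensorProduct.tmul_sum, ← TensorProduct.sum_tmul, ← Finset.op_sum, he.sum]
      rfl

/-- A proper direct summand in `X_A` has an image under `Θ` of smaller dimension. -/
theorem finrank_theta_lt {X Y : XA (Characters.act k A)} (i : X ⟶ Y) (r : Y ⟶ X) (h : i ≫ r = 𝟙 X)
    (h' : r ≫ i ≠ 𝟙 Y) : Module.finrank k ((Theta (Characters.act k A)).obj X).carrier <
      Module.finrank k ((Theta (Characters.act k A)).obj Y).carrier := by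
  let I := ((Theta (Characters.act k A)).map i).lin
  let R := ((Theta (Characters.act k A)).map r).lin
  have hRI : ∀ m, R (I m) = m := fun m => by
    have := congrArg Bim.Hom.lin (congrArg (Theta (Characters.act k A)).map h)
    rw [Functor.map_comp, CategoryTheory.Functor.map_id] at this
    exact LinearMap.congr_fun this m
  have hi : Function.Injective I := Function.LeftInverse.injective hRI
  refine lt_of_le_of_ne (LinearMap.finrank_le_finrank_of_injective hi) fun hd => h' ?_
  have hs := (LinearMap.injective_iff_surjective_of_finrank_eq_finrank hd).1 hi
  apply (Theta (Characters.act k A)).map_injective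
  rw [Functor.map_comp, CategoryTheory.Functor.map_id]
  refine Bim.hom_ext (LinearMap.ext fun m => ?_)
  obtain ⟨m, rfl⟩ := hs m
  exact congrArg I (hRI m)

/-- `Λ` maps `H_A` onto the isomorphism classes of `G_A`. -/
theorem exists_lam_iso (hA : IsBasic k A) (hA' : IsRadicallyGraded k A)
    {X : XA (Characters.act k A)} (hX : GA (Characters.act k A) X) :
    ∃ M, HA k A M ∧ Nonempty ((Lam k A).obj M ≅ X) := by
  obtain ⟨e, he⟩ := exists_characterBasis hA hA'
  refine AddClosure.induction_local (P := fun X => ∃ M, HA k A M ∧ Nonempty ((Lam k A).obj M ≅ X))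
    ?_ (fun X => Module.finrank k ((Theta (Characters.act k A)).obj X).carrier)
    (fun X Y i r => finrank_theta_lt i r) ?_ ?_ (GA_addClosure he hX)
  · rintro _ (rfl | ⟨x, y, rfl⟩) t
    · exact unit_local hA t
    · exact freeSummand_local he x y t
  · intro X h
    have h' : 𝟙 ((Lam k A).obj (RepA.zero k A)) = 0 := by
      rw [← CategoryTheory.Functor.map_id, RepA.id_zero, Functor.map_zero]
    exact ⟨RepA.zero k A, HA.zero, ⟨⟨0, 0, by rw [h', Limits.zero_comp], by
      rw [h, Limits.zero_comp]⟩⟩⟩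
  · intro X Y Z i r j s hir hjs his hjr hX hY hZ
    obtain ⟨N, hN, ⟨b⟩⟩ := hZ
    obtain ⟨M, hM, ⟨a⟩⟩ : ∃ M, HA k A M ∧ Nonempty ((Lam k A).obj M ≅ Y) := by
      rcases hY with rfl | ⟨x, y, rfl⟩
      · exact ⟨𝟙_ _, ObjectProperty.prop_unit _, ⟨(Functor.Monoidal.εIso (Lam k A)).symm⟩⟩
      · exact exists_lam_iso_freeSummand he x y
    refine ⟨M.prod N, hM.prod hN, ⟨⟨(Lam k A).map (M.fst N) ≫ a.hom ≫ i +
      (Lam k A).map (M.snd N) ≫ b.hom ≫ j, r ≫ a.inv ≫ (Lam k A).map (M.inl N) +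
      s ≫ b.inv ≫ (Lam k A).map (M.inr N), ?_, ?_⟩⟩⟩
    · simp only [Preadditive.add_comp, Preadditive.comp_add, Category.assoc]
      rw [reassoc_of% hir, reassoc_of% his, reassoc_of% hjr, reassoc_of% hjs]
      simp only [Iso.hom_inv_id_assoc, Limits.zero_comp, Limits.comp_zero, add_zero, zero_add,
        ← Functor.map_comp, ← Functor.map_add, RepA.prod_total, CategoryTheory.Functor.map_id]
    · have h₁ : (Lam k A).map (M.inl N) ≫ (Lam k A).map (M.fst N) = 𝟙 _ := by
        rw [← Functor.map_comp, RepA.inl_fst, CategoryTheory.Functor.map_id]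
      have h₂ : (Lam k A).map (M.inr N) ≫ (Lam k A).map (M.snd N) = 𝟙 _ := by
        rw [← Functor.map_comp, RepA.inr_snd, CategoryTheory.Functor.map_id]
      have h₃ : (Lam k A).map (M.inl N) ≫ (Lam k A).map (M.snd N) = 0 := by
        rw [← Functor.map_comp, ← Functor.map_zero]; rfl
      have h₄ : (Lam k A).map (M.inr N) ≫ (Lam k A).map (M.fst N) = 0 := by
        rw [← Functor.map_comp, ← Functor.map_zero]; rfl
      simp only [Preadditive.add_comp, Preadditive.comp_add, Category.assoc]
      rw [reassoc_of% h₁, reassoc_of% h₂, reassoc_of% h₃, reassoc_of% h₄]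
      simp only [Iso.inv_hom_id_assoc, Limits.zero_comp, Limits.comp_zero, add_zero, zero_add, hX]

/-- `G_A` is closed under `⊗`: up to isomorphism its objects are `Λ(M)` with `M` in `H_A`, and
`Λ(M) ⊗ Λ(N) ≅ Λ(M ⊗ N)`. -/
theorem GA_isMonoidal (hA : IsBasic k A) (hA' : IsRadicallyGraded k A) :
    (GA (Characters.act k A)).IsMonoidal where
  prop_unit := AddClosure.of_mem (Or.inl rfl)
  prop_tensor X Y hX hY := by
    obtain ⟨M, hM, ⟨a⟩⟩ := exists_lam_iso hA hA' hX
    obtain ⟨N, hN, ⟨b⟩⟩ := exists_lam_iso hA hA' hY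
    exact AddClosure.iso ((a.symm ⊗ᵢ b.symm) ≪≫ Functor.Monoidal.μIso (Lam k A) M N)
      (GA_lam (ObjectProperty.prop_tensor hM hN))

end Hopf

end HopfBimod

end

theorem mainTheorem3 (k A : Type u) [Field k] [IsAlgClosed k] [Ring A] [HopfAlgebra k A]
    [Module.Finite k A] (hA : IsBasic k A) (hA' : IsRadicallyGraded k A)
    [NeZero (Nat.card (Characters k A) : k)] :
    ∃ (Λ : RepA k A ⥤ XA (Characters.act k A)) (_ : Λ.Monoidal)
      (η : Gamma k A ≅ Λ ⋙ Theta (Characters.act k A)),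
      NatTrans.IsMonoidal η.hom ∧
      Λ.Faithful ∧
      (∀ M N : RepA k A, Nonempty (Λ.obj M ≅ Λ.obj N) → Nonempty (M ≅ N)) ∧
      (HA k A).IsMonoidal ∧
      (GA (Characters.act k A)).IsMonoidal ∧
      (∀ M, HA k A M → GA (Characters.act k A) (Λ.obj M)) ∧
      (∀ X, GA (Characters.act k A) X → ∃ M, HA k A M ∧ Nonempty (Λ.obj M ≅ X)) ∧
      (∀ N : Bim k A, (Gamma k A).essImage N → (Theta (Characters.act k A)).essImage N) ∧
      ∀ N : Bim k A, (∃ M, HA k A M ∧ Nonempty ((Gamma k A).obj M ≅ N)) ↔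
        ∃ X, GA (Characters.act k A) X ∧ Nonempty ((Theta (Characters.act k A)).obj X ≅ N) := by
  refine ⟨Lam k A, inferInstance, gammaLam k A, inferInstance, inferInstance,
    fun M N => nonempty_iso_of_lam, inferInstance, GA_isMonoidal hA hA', fun M => GA_lam,
    fun X => exists_lam_iso hA hA', ?_, fun N => ⟨?_, ?_⟩⟩
  · rintro N ⟨M, ⟨i⟩⟩
    exact ⟨(Lam k A).obj M, ⟨((gammaLam k A).app M).symm ≪≫ i⟩⟩
  · rintro ⟨M, hM, ⟨i⟩⟩
    exact ⟨(Lam k A).obj M, GA_lam hM, ⟨((gammaLam k A).app M).symm ≪≫ i⟩⟩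
  · rintro ⟨X, hX, ⟨i⟩⟩
    obtain ⟨M, hM, ⟨a⟩⟩ := exists_lam_iso hA hA' hX
    exact ⟨M, hM, ⟨(gammaLam k A).app M ≪≫ (Theta (Characters.act k A)).mapIso a ≪≫ i⟩⟩
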